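/- For a group $\Gamma$ and a finite set $S\subseteq\Gamma$ (for instance a finite generating set), a loop of length $n$ is a word of length $n$ over the alphabet $S\cup S^{-1}$ that represents the identity. All series below are formal power series and all infinite sums converge coefficientwise. **(A) Wreath products.** Let $G$ be a group, $S$ a finite subset, and $a_j$ the number of loops of length $j$ in $G$. Let $F(x)$ be the generating function, by length, of the loops in the restricted wreath product $G\wr\mathbb Z$ with respect to $\{a\}\cup S$, where $a$ generates $\mathbb Z$ and $G$ is the copy at position $0$. For $n\ge 1$ put $$P_n(x)=\sum_{j\ge 0}\binom{j+n-1}{n-1}a_jx^j,$$ and for $d\ge1$ let $$\Omega_d(x)=\sum P_{d_n}(x)\prod_{j=1}^{n-1}x^{2d_{j+1}}\binom{d_j+d_{j+1}-1}{d_j-1}P_{d_j+d_{j+1}}(x),$$ the sum being over all $n\ge 1$ and all sequences $d_1,\dots,d_n$ of positive integers with $d_1=d$. These sums converge and $$F(x)=\sum_{c,d\ge1}x^{2c+2d}\binom{c+d}{c}P_{c+d+1}(x)\Omega_d(x)\Omega_c(x)+2\sum_{d\ge1}x^{2d}P_{d+1}(x)\Omega_d(x)+P_1(x),$$ $$\Omega_d(x)=P_d(x)+\sum_{b\ge1}x^{2b}\binom{b+d-1}{d-1}P_{b+d}(x)\Omega_b(x)\qquad(d\ge1).$$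 There is a single algorithm (a program for a random access machine with logarithmic, i.e. bit, cost) which for all $G$, $S$, $n$ computes $[x^0]F,\dots,[x^n]F$ from $a_0,\dots,a_n$ in time polynomial in $n$ and the bit length of $|S|$. **(B) The Navas–Brin group.** Let $B=(\cdots\wr\mathbb Z\wr\mathbb Z\wr\mathbb Z\wr\cdots)\rtimes\mathbb Z$, where the copies of $\mathbb Z$ in the infinite wreath product are generated by $\dots,a_1,a_0,a_{-1},\dots$ (so that $\langle a_j:j\ge i\rangle=\langle a_j:j>i\rangle\wr\langle a_i\rangle$), and the generator $t$ of the last factor satisfies $ta_it^{-1}=a_{i+1}$. Words are over $\{a,t,a^{-1},t^{-1}\}$ with $a=a_0$. The height of a word is its exponent sum in $t$; a step of a word ends at height $h$ if the initial subword ending with this step has height $h$; a word never goes below $0$ if all its initial subwords have height $\ge0$. Let * $G(x,y)$ be the generating function of the loops that never go below $0$, where $x$ counts the length and $y$ the steps that end at height $0$; * $H_n(x,y)$, $n\ge1$, be the generating function of the $n$-tuples of words each of which has height $0$, never goes below $0$ and has no step $a^{\pm1}$ that ends at height $0$, and whose concatenation is a loop; $x$ counts the total length and $y$ the total number of steps that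 end at height $0$; * $J_k(x)$, $k\ge0$, be the generating function, by length, of the loops that never go below $0$ and have exactly $k$ steps that end at height $0$, none of them $a^{\pm1}$; * $\Lambda_d(x,y)=\sum H_{d_n}\prod_{j=1}^{n-1}x^{2d_{j+1}}y^{2d_{j+1}}\binom{d_j+d_{j+1}-1}{d_j-1}H_{d_j+d_{j+1}}$, the sum being over all $n\ge 1$ and all sequences $d_1,\dots,d_n$ of positive integers with $d_1=d$. These sums converge and $$G=\sum_{c,d\ge1}x^{2c+2d}y^{2c+2d}\binom{c+d}{c}H_{c+d+1}\Lambda_d\Lambda_c+2\sum_{d\ge1}x^{2d}y^{2d}H_{d+1}\Lambda_d+H_1,$$ $$\Lambda_d=H_d+\sum_{b\ge1}x^{2b}y^{2b}\binom{b+d-1}{d-1}H_{b+d}\Lambda_b\qquad(d\ge1),$$ $$H_n(x,y)=\sum_{k\ge0}y^k\binom{k+n-1}{n-1}J_k(x)\qquad(n\ge1),$$ $$J_0=1,\qquad J_k(x)=\sum_{m\ge0}x^{2k}\binom{m+k-1}{k-1}[y^m]G(x,y)\qquad(k\ge1).$$ For $n\ge1$ the number $b_n$ of loops of length $n$ in $B$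 is $b_n=\sum_{m\ge1}\frac nm[y^m][x^n]G(x,y)$. There are algorithms (in the same machine model) which compute $[x^ny^m]G(x,y)$ from $n,m$ in time polynomial in $n+m$, and $b_0,\dots,b_n$ from $n$ in time polynomial in $n$. -/

import Mathlib

open scoped PowerSeries PowerSeries.WithPiTopology Pointwise

noncomputable section

/-! ## Loops in a group with respect to a finite generating set -/

/-- The words over the alphabet `S ∪ S⁻¹` (letters are group elements). -/
def IsWordOver {Γ : Type*} [Group Γ] (S : Set Γ) (w : List Γ) : Prop :=
  ∀ g ∈ w, g ∈ S ∪ S⁻¹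

/-- The number of loops of length `n`: words of length `n` over `S ∪ S⁻¹` that represent the
identity. -/
def loopCount {Γ : Type*} [Group Γ] (S : Set Γ) (n : ℕ) : ℕ :=
  {w : List Γ | w.length = n ∧ IsWordOver S w ∧ w.prod = 1}.ncard

/-- The cogrowth generating function, counting loops by length. -/
def loopSeries {Γ : Type*} [Group Γ] (S : Set Γ) : ℕ⟦X⟧ :=
  PowerSeries.mk (loopCount S)

/-! ## The wreath product `G ≀ ℤ` -/

/-- The (restricted) wreath product `G ≀ ℤ`, as the subgroup of the unrestricted one that
consists of the elements whose lamp configuration `ℤ → G` has finite support. -/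
def WreathZ (G : Type*) [Group G] : Subgroup (RegularWreathProduct G (Multiplicative ℤ)) where
  carrier := {w | (Function.mulSupport w.left).Finite}
  one_mem' := by simp
  mul_mem' := by
    intro v w hv hw
    have h : (Function.mulSupport fun x => w.left (v.right⁻¹ * x)).Finite := by
      refine Set.Finite.preimage (f := fun x => v.right⁻¹ * x) ?_ hw
      exact (mul_right_injective _).injOn
    exact (hv.union h).subset (Function.mulSupport_mul _ _)
  inv_mem' := by
    intro w hw
    have hw' : (Function.mulSupport w.left⁻¹).Finite := by
      rw [Function.mulSupport_inv]; exact hw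
    exact Set.Finite.preimage (f := fun x => w.right * x) (mul_right_injective _).injOn hw'

/-- The generator `a` of the factor `ℤ` of `G ≀ ℤ`. -/
def WreathZ.step (G : Type*) [Group G] : WreathZ G :=
  ⟨RegularWreathProduct.inl (Multiplicative.ofAdd 1), by
    change (Function.mulSupport (1 : Multiplicative ℤ → G)).Finite
    simp⟩

/-- The embedding of `G` in `G ≀ ℤ` as the copy of `G` at position `0`. -/
def WreathZ.lamp {G : Type*} [Group G] (g : G) : WreathZ G :=
  ⟨⟨Pi.mulSingle 1 g, 1⟩,
    (Set.finite_singleton (1 : Multiplicative ℤ)).subset Pi.mulSupport_mulSingle_subset⟩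

/-- The generating set `{a} ∪ S` of `G ≀ ℤ`. -/
def WreathZ.gens {G : Type*} [Group G] (S : Set G) : Set (WreathZ G) :=
  {WreathZ.step G} ∪ WreathZ.lamp '' S

/-! ## The auxiliary series -/

/-- `P_n(x) = ∑_j C(j+n-1, n-1) a_j x^j`. -/
def tupleSeries (a : ℕ → ℕ) (n : ℕ+) : ℕ⟦X⟧ :=
  PowerSeries.mk fun j => (j + (n : ℕ) - 1).choose ((n : ℕ) - 1) * a j

/-- For a sequence `d = d₁, d₂, …, dₙ` of positive integers with tail `l = [d₂, …, dₙ]`, the product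
`P_{dₙ} ∏_{j=1}^{n-1} z^{d_{j+1}} C(d_j + d_{j+1} - 1, d_j - 1) P_{d_j + d_{j+1}}`. -/
def chainTerm {R : Type*} [CommSemiring R] (z : R) (P : ℕ+ → R) (d : ℕ+) (l : List ℕ+) : R :=
  P (l.getLastD d) *
    (List.zipWith
      (fun c b : ℕ+ => z ^ (b : ℕ) * ((((c : ℕ) + b - 1).choose ((c : ℕ) - 1) : ℕ) : R) * P (c + b))
      (d :: l) l).prod

/-- The sum of `chainTerm` over all sequences `n, d₁, …, dₙ` with `n ≥ 1` and `d₁ = d`. For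
`z = x²` it is `Ω_d(x)`; for `z = x²y²` and `H` in place of `P` it is `Λ_d(x, y)`. -/
def chainSeries {R : Type*} [CommSemiring R] [TopologicalSpace R] (z : R) (P : ℕ+ → R)
    (d : ℕ+) : R :=
  ∑' l : List ℕ+, chainTerm z P d l

/-- `P_n(x)` for the loop counts `a_j` of a group with respect to `S`. -/
def serP {Γ : Type*} [Group Γ] (S : Set Γ) (n : ℕ+) : ℕ⟦X⟧ := tupleSeries (loopCount S) n

/-- `Ω_d(x)`. -/
def serOmega {Γ : Type*} [Group Γ] (S : Set Γ) (d : ℕ+) : ℕ⟦X⟧ :=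
  chainSeries (PowerSeries.X ^ 2) (serP S) d

/-! ## The Navas–Brin group

The bi-infinite iterated wreath product `… ≀ ℤ ≀ ℤ ≀ ℤ ≀ …` is realised by the usual (faithful)
action of an iterated wreath product on sequences of coordinates: in `D ≀ ℤ` acting on `Λ × ℤ`,
where `D` acts on `Λ`, the generator of `ℤ` sends `(p, n)` to `(p, n + 1)`, and `D` acts on
`Λ × {0}` and fixes all other points.  Here `⟨a_j : j ≥ i⟩ = ⟨a_j : j > i⟩ ≀ ⟨a_i⟩`. -/

open Classical in
/-- The generator `a_i` of the `i`-th copy of `ℤ`: it increases the coordinate `i` by one on the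
sequences all of whose coordinates `j < i` vanish, and fixes all other sequences. -/
def towerGen (i : ℤ) : Equiv.Perm (ℤ → ℤ) where
  toFun f := if ∀ j < i, f j = 0 then Function.update f i (f i + 1) else f
  invFun f := if ∀ j < i, f j = 0 then Function.update f i (f i - 1) else f
  left_inv f := by
    by_cases h : ∀ j < i, f j = 0
    · have h' : ∀ j < i, Function.update f i (f i + 1) j = 0 := fun j hj => by
        rw [Function.update_of_ne hj.ne]; exact h j hj
      simp only [if_pos h, if_pos h']
      simp
    · simp only [if_neg h]
  right_inv f := by
    by_cases h : ∀ j < i, f j = 0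
    · have h' : ∀ j < i, Function.update f i (f i - 1) j = 0 := fun j hj => by
        rw [Function.update_of_ne hj.ne]; exact h j hj
      simp only [if_pos h, if_pos h']
      simp
    · simp only [if_neg h]

/-- The infinite wreath product `… ≀ ℤ ≀ ℤ ≀ ℤ ≀ …`, generated by the `a_i`, `i ∈ ℤ`. -/
def InfWreath : Subgroup (Equiv.Perm (ℤ → ℤ)) :=
  Subgroup.closure (Set.range towerGen)

/-- The shift of the coordinates by one. -/
def coordShift : Equiv.Perm (ℤ → ℤ) where
  toFun f := fun j => f (j - 1)
  invFun f := fun j => f (j + 1)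
  left_inv f := by funext j; simp
  right_inv f := by funext j; simp

theorem coordShift_conj (i : ℤ) :
    coordShift * towerGen i * coordShift⁻¹ = towerGen (i + 1) := by
  rw [mul_inv_eq_iff_eq_mul]
  ext f k
  have hiff : (∀ j < i + 1, f (j - 1) = 0) ↔ ∀ j < i, f j = 0 := by
    constructor
    · intro h j hj
      have := h (j + 1) (by lia)
      simpa using this
    · intro h j hj
      exact h (j - 1) (by lia)
  by_cases h : ∀ j < i, f j = 0
  · have h' := hiff.2 h
    simp only [Equiv.Perm.coe_mul, Function.comp_apply, towerGen, coordShift, Equiv.coe_fn_mk,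
      if_pos h, if_pos h', Function.update_apply]
    by_cases hk : k = i + 1
    · simp [hk]
    · rw [if_neg (by lia), if_neg hk]
  · have h' := fun h0 => h (hiff.1 h0)
    simp only [Equiv.Perm.coe_mul, Function.comp_apply, towerGen, coordShift, Equiv.coe_fn_mk,
      if_neg h, if_neg h']

theorem coordShift_mem_normalizer :
    coordShift ∈ Subgroup.normalizer (InfWreath : Set (Equiv.Perm (ℤ → ℤ))) := by
  have key : InfWreath.map (MulAut.conj coordShift).toMonoidHom = InfWreath := by
    unfold InfWreath
    rw [MonoidHom.map_closure]
    congr 1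
    ext g
    constructor
    · rintro ⟨_, ⟨i, rfl⟩, rfl⟩
      exact ⟨i + 1, (coordShift_conj i).symm⟩
    · rintro ⟨i, rfl⟩
      refine ⟨towerGen (i - 1), ⟨i - 1, rfl⟩, ?_⟩
      have := coordShift_conj (i - 1)
      rw [sub_add_cancel] at this
      exact this
  rw [Subgroup.mem_normalizer_iff]
  intro g
  constructor
  · intro hg
    have h := Subgroup.mem_map_of_mem (MulAut.conj coordShift).toMonoidHom hg
    rw [key] at h
    exact h
  · intro hg
    have h : coordShift * g * coordShift⁻¹ ∈
        InfWreath.map (MulAut.conj coordShift).toMonoidHom := by rw [key]; exact hg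
    obtain ⟨g', hg', h⟩ := h
    have : g' = g := (MulAut.conj coordShift).injective h
    exact this ▸ hg'

/-- The action of `ℤ = ⟨t⟩` on the infinite wreath product, with `t a_i t⁻¹ = a_{i+1}`. -/
def shiftAction : Multiplicative ℤ →* MulAut InfWreath :=
  InfWreath.normalizerMonoidHom.comp (zpowersHom _ ⟨coordShift, coordShift_mem_normalizer⟩)

/-- The Navas–Brin group `B = (… ≀ ℤ ≀ ℤ ≀ ℤ ≀ …) ⋊ ℤ`. -/
abbrev NavasBrin : Type := InfWreath ⋊[shiftAction] Multiplicative ℤ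

namespace NavasBrin

/-- The generator `a = a₀`. -/
def a : NavasBrin := SemidirectProduct.inl ⟨towerGen 0, Subgroup.subset_closure ⟨0, rfl⟩⟩

/-- The generator `t`. -/
def t : NavasBrin := SemidirectProduct.inr (Multiplicative.ofAdd 1)

/-- The words over the alphabet `{a, t, a⁻¹, t⁻¹}`. -/
def IsWord (w : List NavasBrin) : Prop := IsWordOver {a, t} w

/-- The `t`-height of a word: the sum of its powers of `t`, i.e. the image of the word in `ℤ`. -/
def height (w : List NavasBrin) : ℤ := Multiplicative.toAdd w.prod.right

/-- No initial subword has negative height. -/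
def NeverBelow (w : List NavasBrin) : Prop := ∀ i ≤ w.length, 0 ≤ height (w.take i)

/-- The number of steps of a word which end at height `0`. -/
def zeroSteps (w : List NavasBrin) : ℕ :=
  {i : ℕ | i < w.length ∧ height (w.take (i + 1)) = 0}.ncard

/-- No step `a` or `a⁻¹` of the word is at height `0`. -/
def NoFlatStep (w : List NavasBrin) : Prop :=
  ∀ (i : ℕ) (hi : i < w.length), (w[i] = a ∨ w[i] = a⁻¹) → height (w.take (i + 1)) ≠ 0

/-- `G(x, y)`: loops with no initial subword of negative height; `x` counts the length and `y` the
steps which end at height `0`. Series in `x, y` are power series in `y` over power series in `x`. -/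
def serG : ℕ⟦X⟧⟦X⟧ :=
  PowerSeries.mk fun m => PowerSeries.mk fun n =>
    {w : List NavasBrin | IsWord w ∧ w.prod = 1 ∧ NeverBelow w ∧
      w.length = n ∧ zeroSteps w = m}.ncard

/-- `H_n(x, y)`: `n`-tuples of words, each ending at height `0`, never going below height `0` and
without steps `a`, `a⁻¹` at height `0`, whose concatenation is a loop; `x` counts the total length
and `y` the total number of steps which end at height `0`. -/
def serH (n : ℕ+) : ℕ⟦X⟧⟦X⟧ :=
  PowerSeries.mk fun m => PowerSeries.mk fun k =>
    {w : Fin n → List NavasBrin |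
      (∀ i, IsWord (w i) ∧ height (w i) = 0 ∧ NeverBelow (w i) ∧ NoFlatStep (w i)) ∧
      (List.ofFn w).flatten.prod = 1 ∧
      ∑ i, (w i).length = k ∧ ∑ i, zeroSteps (w i) = m}.ncard

/-- `J_k(x)`: loops which never go below height `0` and have exactly `k` steps that end at height
`0`, none of which is `a` or `a⁻¹`; `x` counts the length. -/
def serJ (k : ℕ) : ℕ⟦X⟧ :=
  PowerSeries.mk fun n =>
    {w : List NavasBrin | IsWord w ∧ w.prod = 1 ∧ NeverBelow w ∧ NoFlatStep w ∧
      zeroSteps w = k ∧ w.length = n}.ncard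

/-- The variable `x`. -/
def x : ℕ⟦X⟧⟦X⟧ := PowerSeries.C PowerSeries.X

/-- The variable `y`. -/
def y : ℕ⟦X⟧⟦X⟧ := PowerSeries.X

/-- `Λ_d(x, y)`. -/
def serLambda (d : ℕ+) : ℕ⟦X⟧⟦X⟧ := chainSeries (x ^ 2 * y ^ 2) serH d

end NavasBrin

/-! ## Running times: while programs on a random access machine, with logarithmic (bit) cost -/

namespace RAM

/-- A memory: `s k i` is the natural number in cell `i` of memory bank `k`. A program mentions only
finitely many banks, but addresses within a bank can be computed. -/
abbrev Store := ℕ → ℕ → ℕ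

/-- Expressions: constants, reading a cell of a bank at a computed address, and arithmetic
(`sub` is truncated, `div` is the floor of the quotient). -/
inductive Expr : Type
  | lit (n : ℕ)
  | get (k : ℕ) (e : Expr)
  | add (e f : Expr)
  | sub (e f : Expr)
  | mul (e f : Expr)
  | div (e f : Expr)

/-- The value of an expression. -/
def Expr.eval (s : Store) : Expr → ℕ
  | .lit n => n
  | .get k e => s k (e.eval s)
  | .add e f => e.eval s + f.eval s
  | .sub e f => e.eval s - f.eval s
  | .mul e f => e.eval s * f.eval s
  | .div e f => e.eval s / f.eval s

/-- The cost of the evaluation of an expression, in bit operations: linear in the bit lengths of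
the operands and addresses, quadratic (schoolbook) for multiplication and division. -/
def Expr.cost (s : Store) : Expr → ℕ
  | .lit n => n.size + 1
  | .get k e => e.cost s + (e.eval s).size + (s k (e.eval s)).size + 1
  | .add e f => e.cost s + f.cost s + (e.eval s).size + (f.eval s).size + 1
  | .sub e f => e.cost s + f.cost s + (e.eval s).size + (f.eval s).size + 1
  | .mul e f => e.cost s + f.cost s + ((e.eval s).size + 1) * ((f.eval s).size + 1)
  | .div e f => e.cost s + f.cost s + ((e.eval s).size + 1) * ((f.eval s).size + 1)

/-- Programs. -/
inductive Prog : Type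
  | skip
  | set (k : ℕ) (i e : Expr)
  | comp (p q : Prog)
  | cond (e : Expr) (p q : Prog)
  | loop (e : Expr) (p : Prog)

/-- The store after writing `v` into cell `i` of bank `k`. -/
def Store.write (s : Store) (k i v : ℕ) : Store :=
  Function.update s k (Function.update (s k) i v)

/-- `Runs p s s' c`: started in the store `s`, the program `p` halts in the store `s'` at total
cost `c`. -/
inductive Runs : Prog → Store → Store → ℕ → Prop
  | skip (s : Store) : Runs .skip s s 1
  | set (s : Store) (k : ℕ) (i e : Expr) :
      Runs (.set k i e) s (s.write k (i.eval s) (e.eval s))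
        (i.cost s + e.cost s + (i.eval s).size + (e.eval s).size + 1)
  | comp {p q : Prog} {s s' s'' : Store} {c c' : ℕ} :
      Runs p s s' c → Runs q s' s'' c' → Runs (.comp p q) s s'' (c + c' + 1)
  | cond_true {e : Expr} {p q : Prog} {s s' : Store} {c : ℕ} :
      e.eval s ≠ 0 → Runs p s s' c → Runs (.cond e p q) s s' (e.cost s + c + 1)
  | cond_false {e : Expr} {p q : Prog} {s s' : Store} {c : ℕ} :
      e.eval s = 0 → Runs q s s' c → Runs (.cond e p q) s s' (e.cost s + c + 1)
  | loop_true {e : Expr} {p : Prog} {s s' s'' : Store} {c c' : ℕ} :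
      e.eval s ≠ 0 → Runs p s s' c → Runs (.loop e p) s' s'' c' →
      Runs (.loop e p) s s'' (e.cost s + c + c' + 1)
  | loop_false {e : Expr} {p : Prog} {s : Store} :
      e.eval s = 0 → Runs (.loop e p) s s (e.cost s + 1)

/-- The initial store: bank `0` holds the length of the input, followed by the input; all other
cells are `0`. -/
def load (xs : List ℕ) : Store :=
  fun k i => if k = 0 then (xs.length :: xs).getD i 0 else 0

/-- On input `xs` the program halts after at most `T` bit operations, with the output `ys` in bank
`1` (the other cells of that bank being `0`). -/
def ComputesWithin (p : Prog) (xs ys : List ℕ) (T : ℕ) : Prop :=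
  ∃ (s : Store) (c : ℕ), Runs p (load xs) s c ∧ c ≤ T ∧ s 1 = fun i => ys.getD i 0

end RAM

end

/-!
A loop in `G ≀ ℤ` is a walk of a cursor on `ℤ` that returns to its start and writes letters of
`S ∪ S⁻¹` on the way, such that at each position the letters written there multiply to `1`: the walk
is *balanced* (`WreathZ.prod_ofStep_eq_one`). A nonnegative walk from `0` to `0` is a sequence of
letters, written at position `0`, and of excursions `up, v, down`, where `v` is again a nonnegative
walk, one level higher (`Walk.dyckEquiv`); a closed walk has excursions of two kinds, above and
below `0` (`Walk.closedEquiv`). It is balanced if the letters multiply to `1` and the concatenation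
of the excursions of each kind is balanced. This leads to the tuples of `c` nonnegative walks whose
concatenation is balanced, and to their generating function `halfSeries c`: if these walks have `b`
excursions altogether, then these form a balanced `b`-tuple, and binomial coefficients count the
interleavings and the ways of cutting (`Walk.hasSum_halfSeries`, `Walk.hasSum_closedSeries`). The
recursion for `halfSeries` has a unique solution, since its coefficients contain a power of the
variable, and unfolding it gives the sum over all chains `d₁, …, dₙ` (`chainSeries_eq`).

The Navas–Brin group is treated by the same argument. A loop that never goes below height `0` is a
sequence of letters `a^{±1}` at height `0` and of excursions `t v t⁻¹`. In the action on sequences of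
coordinates, `a` moves a cursor (coordinate `0`), and an excursion changes the higher coordinates,
and does so only if the cursor is at `0`. Hence the word is a loop iff it is, as a walk of the
cursor, closed and balanced for the alphabet of excursions (`NavasBrin.outerStep_prod_eq_one`), and
`G(x, y)` is the generating function of balanced closed walks. The number of `k`-tuples of
excursions with trivial product, that is `J_k`, comes from the loops that never go below `0`, cut
into `k` pieces (`NavasBrin.hasSum_serJ`). For an arbitrary
loop, the number of its rotations that never go below `0` is invariant under rotation and positive;
for a loop that never goes below `0` it is the number of steps that end at height `0`. Double
counting yields the formula for `b_n` (`NavasBrin.mul_card_goodRotations_eq`).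

For the algorithms, the recursions are read coefficientwise: the number of closed walks and the
numbers of `d`-tuples with given length and number of steps depend on those of smaller length only,
and the tuples occur as parts of closed walks, so that all these numbers have polynomially many bits
(`Walk.halfCount_succ`, `Walk.closedCount_eq`, `Walk.halfCount_le`). A small language of terms with
bounded sums and products is compiled to programs with polynomial cost (`RAM.Term.poly`), and a
program that fills a table with the values of a term computes the recursion
(`RAM.exists_prog_of_table`, `Walk.exists_prog`).
-/

noncomputable section

universe u v

/-! ### Summation of families of power series -/

/-- Sums in `R` behave like coefficientwise locally finite sums: a summable family stays summable
when its terms are reused along a map with finite fibres and with natural multiplicities, and the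
products of the terms of two summable families form a summable family. -/
class LocSummable.{w, r} (R : Type r) [CommSemiring R] [TopologicalSpace R] : Prop where
  pull : ∀ {ι κ : Type w} {f : κ → R} (e : ι → κ) (m : ι → ℕ),
    (∀ k, (e ⁻¹' {k}).Finite) → Summable f → Summable fun i => (m i : R) * f (e i)
  mul : ∀ {ι κ : Type w} {f : ι → R} {g : κ → R},
    Summable f → Summable g → Summable fun p : ι × κ => f p.1 * g p.2

theorem Nat.finite_support_of_summable {ι : Type*} {f : ι → ℕ} (h : Summable f) :
    (Function.support f).Finite := by
  classical
  obtain ⟨a, ha⟩ := h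
  rw [HasSum, nhds_discrete, Filter.tendsto_pure, SummationFilter.unconditional_filter,
    Filter.eventually_atTop] at ha
  obtain ⟨s, hs⟩ := ha
  refine s.finite_toSet.subset fun i hi => ?_
  by_contra his
  have h1 := hs s le_rfl
  have h2 := hs (insert i s) (Finset.subset_insert i s)
  rw [Finset.sum_insert (by simpa using his), h1] at h2
  have : f i ≠ 0 := hi
  omega

instance Nat.locSummable : LocSummable.{u} ℕ where
  pull {ι κ f} e m he hf := by
    refine summable_of_hasFiniteSupport
      (((Nat.finite_support_of_summable hf).preimage' fun k _ => he k).subset fun i hi => ?_)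
    exact right_ne_zero_of_mul hi
  mul {ι κ f g} hf hg := by
    refine summable_of_hasFiniteSupport
      (((Nat.finite_support_of_summable hf).prod (Nat.finite_support_of_summable hg)).subset
        fun p hp => ?_)
    exact ⟨left_ne_zero_of_mul hp, right_ne_zero_of_mul hp⟩

theorem PowerSeries.summable_pull {S : Type v} [CommSemiring S] [TopologicalSpace S]
    [LocSummable.{u} S] {ι κ : Type u} {f : κ → S⟦X⟧} (e : ι → κ) (m : ι → ℕ)
    (he : ∀ k, (e ⁻¹' {k}).Finite) (hf : Summable f) :
    Summable fun i => (m i : S⟦X⟧) * f (e i) := by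
  have hf := (PowerSeries.WithPiTopology.summable_iff_summable_coeff _).1 hf
  refine (PowerSeries.WithPiTopology.summable_iff_summable_coeff _).2 fun d => ?_
  have h2 : ∀ i, PowerSeries.coeff d ((m i : S⟦X⟧) * f (e i))
      = (m i : S) * PowerSeries.coeff d (f (e i)) := fun i => by
    rw [← map_natCast (PowerSeries.C (R := S)) (m i), PowerSeries.coeff_C_mul]
  have h3 := LocSummable.pull e m he (hf d)
  simpa only [h2] using h3

theorem PowerSeries.summable_mul {S : Type v} [CommSemiring S] [TopologicalSpace S]
    [ContinuousAdd S] [LocSummable.{u} S] {ι κ : Type u} {f : ι → S⟦X⟧} {g : κ → S⟦X⟧}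
    (hf : Summable f) (hg : Summable g) : Summable fun p : ι × κ => f p.1 * g p.2 := by
  have hf := (PowerSeries.WithPiTopology.summable_iff_summable_coeff _).1 hf
  have hg := (PowerSeries.WithPiTopology.summable_iff_summable_coeff _).1 hg
  refine (PowerSeries.WithPiTopology.summable_iff_summable_coeff _).2 fun d => ?_
  have h : ∀ q ∈ Finset.HasAntidiagonal.antidiagonal d, Summable fun p : ι × κ =>
      PowerSeries.coeff q.1 (f p.1) * PowerSeries.coeff q.2 (g p.2) :=
    fun q _ => LocSummable.mul (f := fun i => PowerSeries.coeff q.1 (f i))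
      (g := fun i => PowerSeries.coeff q.2 (g i)) (hf q.1) (hg q.2)
  have h2 := summable_sum h
  simpa only [PowerSeries.coeff_mul] using h2

instance PowerSeries.locSummable {S : Type v} [CommSemiring S] [TopologicalSpace S]
    [ContinuousAdd S] [LocSummable.{u} S] : LocSummable.{u} S⟦X⟧ :=
  ⟨PowerSeries.summable_pull, PowerSeries.summable_mul⟩

/-- The topology of coefficientwise convergence is a product topology. -/
instance PowerSeries.t3Space {S : Type*} [TopologicalSpace S] [T3Space S] : T3Space S⟦X⟧ :=
  inferInstanceAs (T3Space ((Unit →₀ ℕ) → S))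

section fibres

variable {R : Type v} [CommSemiring R] [TopologicalSpace R]

/-- Summing a function of `e x` over `x` amounts to summing over the values `y` of `e`, weighted by
the sizes of the fibres. -/
theorem HasSum.of_fibres [IsTopologicalSemiring R] [T3Space R] {X Y : Type*} {e : X → Y}
    {N : Y → ℕ} {g : Y → R} {s : R}
    (hN : ∀ y, (e ⁻¹' {y}).encard = N y) (h : HasSum (fun x => g (e x)) s) :
    HasSum (fun y => (N y : R) * g y) s := by
  have h1 := (Equiv.sigmaFiberEquiv e).hasSum_iff.2 h
  refine h1.sigma fun y => ?_
  have hfin : (e ⁻¹' {y}).Finite := Set.finite_of_encard_eq_coe (hN y)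
  have : Fintype {x // e x = y} := hfin.fintype
  have hc : Fintype.card {x // e x = y} = N y := by
    have h2 := hN y
    rw [← hfin.cast_ncard_eq] at h2
    rw [← Nat.card_eq_fintype_card]
    exact_mod_cast h2
  have h3 := hasSum_fintype fun x : {x // e x = y} => g y
  rw [Finset.sum_const, Finset.card_univ, hc, nsmul_eq_mul] at h3
  convert h3 using 1
  funext x
  obtain ⟨x, rfl⟩ := x
  rfl

theorem LocSummable.of_injective [LocSummable.{u} R] {ι κ : Type u} {f : κ → R} (hf : Summable f)
    {e : ι → κ} (he : Function.Injective e) : Summable fun i => f (e i) := by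
  refine (LocSummable.pull e (fun _ => 1) (fun k => ?_) hf).congr fun i => by simp
  exact (Set.finite_singleton k).preimage he.injOn

theorem LocSummable.ite [LocSummable.{u} R] {ι : Type u} {f : ι → R} (hf : Summable f)
    (p : ι → Prop) [DecidablePred p] : Summable fun i => if p i then f i else 0 := by
  refine (LocSummable.pull id (fun i => if p i then 1 else 0) (fun k => ?_) hf).congr fun i => ?_
  · exact (Set.finite_singleton k).preimage (Function.injective_id).injOn
  · split_ifs <;> simp

end fibres

section monomials

theorem hasSum_ite_ncard {X : Type*} (q : X → Prop) [DecidablePred q] (h : {x | q x}.Finite) :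
    HasSum (fun x => if q x then 1 else 0) {x | q x}.ncard := by
  have h1 := hasSum_sum_of_ne_finset_zero (f := fun x => if q x then 1 else 0)
    (s := h.toFinset) (L := .unconditional X) (by simp +contextual)
  rw [Set.ncard_eq_toFinset_card _ h]
  convert h1
  rw [Finset.sum_ite, Finset.filter_true_of_mem (by simp)]
  simp

/-- A counting series is the sum of the monomials of the counted objects. -/
theorem hasSum_monomials {X : Type*} (p : X → Prop) [DecidablePred p] (d : X → ℕ)
    (h : ∀ n, {x | p x ∧ d x = n}.Finite) :
    HasSum (fun x => if p x then (PowerSeries.X : ℕ⟦X⟧) ^ d x else 0)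
      (PowerSeries.mk fun n => {x | p x ∧ d x = n}.ncard) := by
  rw [PowerSeries.WithPiTopology.hasSum_iff_hasSum_coeff]
  intro n
  rw [PowerSeries.coeff_mk]
  refine HasSum.congr_fun (hasSum_ite_ncard _ (h n)) fun x => ?_
  by_cases hp : p x <;> simp [hp, PowerSeries.coeff_X_pow, eq_comm]

/-- The version of `hasSum_monomials` for two variables: `x` counts `d` and `y` counts `e`. -/
theorem hasSum_monomials₂ {X : Type*} (p : X → Prop) [DecidablePred p] (d e : X → ℕ)
    (h : ∀ n m, {x | p x ∧ d x = n ∧ e x = m}.Finite) :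
    HasSum (fun x => if p x then NavasBrin.x ^ d x * NavasBrin.y ^ e x else 0)
      (PowerSeries.mk fun m => PowerSeries.mk fun n => {x | p x ∧ d x = n ∧ e x = m}.ncard) := by
  rw [PowerSeries.WithPiTopology.hasSum_iff_hasSum_coeff]
  intro m
  rw [PowerSeries.coeff_mk, PowerSeries.WithPiTopology.hasSum_iff_hasSum_coeff]
  intro n
  rw [PowerSeries.coeff_mk]
  refine HasSum.congr_fun (hasSum_ite_ncard _ (h n m)) fun x => ?_
  by_cases hp : p x
  · simp only [hp, true_and, if_true, NavasBrin.x, NavasBrin.y, ← map_pow, PowerSeries.coeff_C_mul,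
      PowerSeries.coeff_X_pow]
    by_cases h1 : d x = n <;> by_cases h2 : e x = m <;>
      simp [h1, h2, PowerSeries.coeff_X_pow, eq_comm]
    all_goals grind
  · simp [hp]

end monomials

/-! ### Counting lists -/

namespace List

variable {A B T : Type*}

/-- The entries of a list that lie in the left summand. -/
def lefts (w : List (A ⊕ B)) : List A := w.filterMap Sum.getLeft?

/-- The entries of a list that lie in the right summand. -/
def rights (w : List (A ⊕ B)) : List B := w.filterMap Sum.getRight?

@[simp] theorem lefts_nil : lefts ([] : List (A ⊕ B)) = [] := rfl
@[simp] theorem rights_nil : rights ([] : List (A ⊕ B)) = [] := rfl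
@[simp] theorem lefts_inl (a : A) (w : List (A ⊕ B)) : lefts (.inl a :: w) = a :: lefts w := rfl
@[simp] theorem lefts_inr (b : B) (w : List (A ⊕ B)) : lefts (.inr b :: w) = lefts w := rfl
@[simp] theorem rights_inl (a : A) (w : List (A ⊕ B)) : rights (.inl a :: w) = rights w := rfl
@[simp] theorem rights_inr (b : B) (w : List (A ⊕ B)) : rights (.inr b :: w) = b :: rights w := rfl

theorem length_lefts_add_rights (w : List (A ⊕ B)) :
    (lefts w).length + (rights w).length = w.length := by
  induction w with
  | nil => rfl
  | cons s w ih => cases s <;> simp <;> omega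

/-- The number of interleavings of two lists. -/
theorem encard_interleavings (α : List A) (β : List B) :
    {w : List (A ⊕ B) | lefts w = α ∧ rights w = β}.encard
      = ((α.length + β.length).choose α.length : ℕ) := by
  induction α generalizing β with
  | nil =>
    have : {w : List (A ⊕ B) | lefts w = [] ∧ rights w = β} = {β.map Sum.inr} := by
      ext w
      simp only [Set.mem_ofPred_eq, Set.mem_singleton_iff]
      constructor
      · rintro ⟨h1, rfl⟩
        induction w with
        | nil => rfl
        | cons s w ih =>
          cases s with
          | inl a => simp at h1
          | inr b => exact congrArg (List.cons (Sum.inr b)) (ih h1)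
      · rintro rfl
        induction β with
        | nil => simp
        | cons b β ih => exact ⟨ih.1, congrArg (List.cons b) ih.2⟩
    rw [this]
    simp
  | cons a α iha =>
    induction β with
    | nil =>
      have : {w : List (A ⊕ B) | lefts w = a :: α ∧ rights w = []}
          = {(a :: α).map Sum.inl} := by
        ext w
        simp only [Set.mem_ofPred_eq, Set.mem_singleton_iff]
        constructor
        · rintro ⟨h1, h2⟩
          rw [← h1]
          clear h1
          induction w with
          | nil => rfl
          | cons s w ih =>
            cases s with
            | inl a => exact congrArg (List.cons (Sum.inl a)) (ih h2)
            | inr b => simp at h2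
        · rintro rfl
          generalize a :: α = γ
          induction γ with
          | nil => simp
          | cons b β ih => exact ⟨congrArg (List.cons b) ih.1, ih.2⟩
      rw [this]
      simp
    | cons b β ihb =>
      have : {w : List (A ⊕ B) | lefts w = a :: α ∧ rights w = b :: β}
          = (List.cons (.inl a)) '' {w | lefts w = α ∧ rights w = b :: β}
            ∪ (List.cons (.inr b)) '' {w | lefts w = a :: α ∧ rights w = β} := by
        ext w
        cases w with
        | nil => simp
        | cons s w => cases s <;> simp <;> grind
      rw [this, Set.encard_union_eq, Function.Injective.encard_image List.cons_injective,
        Function.Injective.encard_image List.cons_injective, iha, ihb]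
      · rw [← Nat.cast_add]
        congr 1
        have := Nat.choose_succ_succ (α.length + β.length + 1) α.length
        simp only [List.length_cons]
        rw [show α.length + 1 + (β.length + 1) = (α.length + β.length + 1).succ by omega, this]
        congr 2; omega
      · rw [Set.disjoint_left]
        rintro _ ⟨w, -, rfl⟩ ⟨w', -, h⟩
        simp at h

/-- The number of ways to cut a list into `n + 1` consecutive pieces. -/
theorem encard_cuts (n : ℕ) (τ : List T) :
    {ws : List (List T) | ws.length = n + 1 ∧ ws.flatten = τ}.encard
      = ((τ.length + n).choose n : ℕ) := by
  induction n generalizing τ with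
  | zero =>
    have : {ws : List (List T) | ws.length = 0 + 1 ∧ ws.flatten = τ} = {[τ]} := by
      ext ws
      simp only [Set.mem_ofPred_eq, Set.mem_singleton_iff, zero_add, List.length_eq_one_iff]
      constructor
      · rintro ⟨⟨w, rfl⟩, rfl⟩; simp
      · rintro rfl; simp
    rw [this]
    simp
  | succ n ihn =>
    induction τ with
    | nil =>
      have : {ws : List (List T) | ws.length = n + 1 + 1 ∧ ws.flatten = []}
          = {List.replicate (n + 2) []} := by
        ext ws
        simp only [Set.mem_ofPred_eq, Set.mem_singleton_iff, List.flatten_eq_nil_iff,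
          List.eq_replicate_iff]
      rw [this]
      simp
    | cons t τ iht =>
      have : {ws : List (List T) | ws.length = n + 1 + 1 ∧ ws.flatten = t :: τ}
          = (List.cons []) '' {ws | ws.length = n + 1 ∧ ws.flatten = t :: τ}
            ∪ (List.modifyHead (List.cons t)) ''
              {ws | ws.length = n + 1 + 1 ∧ ws.flatten = τ} := by
        ext ws
        simp only [Set.mem_ofPred_eq, Set.mem_union, Set.mem_image]
        constructor
        · rintro ⟨h1, h2⟩
          match ws, h1, h2 with
          | [] :: ws, h1, h2 => exact .inl ⟨ws, ⟨by simpa using h1, by simpa using h2⟩, rfl⟩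
          | (s :: w) :: ws, h1, h2 =>
            rw [List.flatten_cons, List.cons_append, List.cons.injEq] at h2
            obtain ⟨rfl, h2⟩ := h2
            exact .inr ⟨w :: ws, ⟨by simpa using h1, by rwa [List.flatten_cons]⟩, rfl⟩
        · rintro (⟨ws, ⟨h1, h2⟩, rfl⟩ | ⟨ws, ⟨h1, h2⟩, rfl⟩)
          · exact ⟨by simpa using h1, by simpa using h2⟩
          · cases ws with
            | nil => simp at h1
            | cons w ws => exact ⟨by simpa using h1, by simpa using h2⟩
      -- The first piece is empty, or it starts with the first entry of the list.
      rw [this, Set.encard_union_eq, Function.Injective.encard_image List.cons_injective,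
        Set.InjOn.encard_image, iht, ihn]
      · rw [← Nat.cast_add]
        congr 1
        have := Nat.choose_succ_succ (τ.length + n + 1) n
        simp only [List.length_cons]
        rw [show τ.length + 1 + (n + 1) = (τ.length + n + 1).succ by omega, this]
        congr 2; omega
      · rintro (_ | ⟨w, ws⟩) ⟨h1, -⟩ (_ | ⟨w', ws'⟩) ⟨h2, -⟩ h
        · rfl
        · simp at h1
        · simp at h2
        · simpa using h
      · rw [Set.disjoint_left]
        rintro _ ⟨w, -, rfl⟩ ⟨w', ⟨hw, -⟩, h⟩
        cases w' with
        | nil => simp at hw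
        | cons w' ws' => simp at h

theorem finite_cuts (n : ℕ) (τ : List T) :
    {ws : List (List T) | ws.length = n ∧ ws.flatten = τ}.Finite := by
  cases n with
  | zero =>
    refine (Set.finite_singleton []).subset fun ws h => ?_
    simpa using h.1
  | succ n => exact Set.finite_of_encard_eq_coe (encard_cuts n τ)

end List

/-! ### Walks on the integers and their excursions -/

namespace Walk

/-- The steps of a labelled walk on `ℤ`: the cursor stays in place while a letter is written, or it
moves up or down by one. -/
inductive Step (α : Type u) : Type u
  | flat (a : α)
  | up
  | down

variable {α : Type u}

/-- The increment of the height. -/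
def Step.ht : Step α → ℤ
  | .flat _ => 0
  | .up => 1
  | .down => -1

@[simp] theorem Step.ht_flat (a : α) : (Step.flat a).ht = 0 := rfl
@[simp] theorem Step.ht_up : (Step.up : Step α).ht = 1 := rfl
@[simp] theorem Step.ht_down : (Step.down : Step α).ht = -1 := rfl

/-- Exchange of up and down. -/
def Step.mirror : Step α → Step α
  | .flat a => .flat a
  | .up => .down
  | .down => .up

@[simp] theorem Step.mirror_flat (a : α) : (Step.flat a).mirror = .flat a := rfl
@[simp] theorem Step.mirror_up : (Step.up : Step α).mirror = .down := rfl
@[simp] theorem Step.mirror_down : (Step.down : Step α).mirror = .up := rfl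
@[simp] theorem Step.mirror_mirror (s : Step α) : s.mirror.mirror = s := by cases s <;> rfl

@[simp] theorem Step.ht_mirror (s : Step α) : s.mirror.ht = -s.ht := by cases s <;> simp

/-- The final height of a walk that starts at height `0`. -/
def height (w : List (Step α)) : ℤ := (w.map Step.ht).sum

@[simp] theorem height_nil : height ([] : List (Step α)) = 0 := rfl
@[simp] theorem height_cons (s : Step α) (w) : height (s :: w) = s.ht + height w := by simp [height]
@[simp] theorem height_append (u w : List (Step α)) : height (u ++ w) = height u + height w := by
  simp [height]

/-- The mirror image of a walk. -/
def mirror (w : List (Step α)) : List (Step α) := w.map Step.mirror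

@[simp] theorem mirror_nil : mirror ([] : List (Step α)) = [] := rfl
@[simp] theorem mirror_cons (s : Step α) (w) : mirror (s :: w) = s.mirror :: mirror w := rfl
@[simp] theorem mirror_append (u w : List (Step α)) : mirror (u ++ w) = mirror u ++ mirror w := by
  simp [mirror]
@[simp] theorem mirror_mirror (w : List (Step α)) : mirror (mirror w) = w := by
  induction w <;> simp [*]
@[simp] theorem height_mirror (w : List (Step α)) : height (mirror w) = -height w := by
  induction w with
  | nil => simp
  | cons s w ih => simp [ih]; ring
@[simp] theorem length_mirror (w : List (Step α)) : (mirror w).length = w.length := by simp [mirror]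

/-- The walk, started at height `h`, visits no negative height after the start. -/
def NonNeg : ℤ → List (Step α) → Prop
  | _, [] => True
  | h, s :: w => 0 ≤ h + s.ht ∧ NonNeg (h + s.ht) w

@[simp] theorem nonNeg_nil (h : ℤ) : NonNeg h ([] : List (Step α)) := trivial
@[simp] theorem nonNeg_cons (h : ℤ) (s : Step α) (w) :
    NonNeg h (s :: w) ↔ 0 ≤ h + s.ht ∧ NonNeg (h + s.ht) w := Iff.rfl

theorem nonNeg_append (h : ℤ) (u w : List (Step α)) :
    NonNeg h (u ++ w) ↔ NonNeg h u ∧ NonNeg (h + height u) w := by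
  induction u generalizing h with
  | nil => simp
  | cons s u ih => simp [ih, and_assoc, add_assoc]

theorem NonNeg.mono {h h' : ℤ} (hh : h ≤ h') {w : List (Step α)} (hw : NonNeg h w) :
    NonNeg h' w := by
  induction w generalizing h h' with
  | nil => trivial
  | cons s w ih => exact ⟨by have := hw.1; omega, ih (by omega) hw.2⟩

theorem NonNeg.le {h : ℤ} (h0 : 0 ≤ h) {w : List (Step α)} (hw : NonNeg h w) :
    0 ≤ h + height w := by
  induction w generalizing h with
  | nil => simpa
  | cons s w ih => simpa [add_assoc] using ih hw.1 hw.2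

/-- The walk ends at height `0` and never goes below it. -/
def IsDyck (w : List (Step α)) : Prop := NonNeg 0 w ∧ height w = 0

theorem isDyck_nil : IsDyck ([] : List (Step α)) := ⟨trivial, rfl⟩

theorem IsDyck.append {u w : List (Step α)} (hu : IsDyck u) (hw : IsDyck w) : IsDyck (u ++ w) :=
  ⟨(nonNeg_append _ _ _).2 ⟨hu.1, by simpa [hu.2] using hw.1⟩, by simp [hu.2, hw.2]⟩

theorem isDyck_flat (a : α) : IsDyck [Step.flat a] := ⟨by simp, by simp⟩

theorem IsDyck.excursion {v : List (Step α)} (hv : IsDyck v) :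
    IsDyck (Step.up :: (v ++ [Step.down])) := by
  refine ⟨⟨by simp, (nonNeg_append _ _ _).2 ⟨hv.1.mono (by simp), ?_⟩⟩, by simp [hv.2]⟩
  simp [hv.2]

theorem IsDyck.of_append {u w : List (Step α)} (hu : IsDyck u) (h : IsDyck (u ++ w)) :
    IsDyck w := by
  refine ⟨?_, by simpa [hu.2] using h.2⟩
  simpa [hu.2] using ((nonNeg_append _ _ _).1 h.1).2

variable (α) in
/-- The walks that end at height `0` and never go below it. -/
abbrev Dyck : Type u := {w : List (Step α) // IsDyck w}

/-- Decomposition of a walk at its first visit to height `-1`. -/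
theorem exists_first_passage (w : List (Step α)) (hw : height w < 0) :
    ∃ v r, IsDyck v ∧ w = v ++ Step.down :: r := by
  induction hn : w.length using Nat.strong_induction_on generalizing w with
  | _ n ih =>
    match w with
    | [] => simp at hw
    | .down :: r => exact ⟨[], r, isDyck_nil, rfl⟩
    | .flat a :: w =>
      obtain ⟨v, r, hv, rfl⟩ := ih w.length (by simp [← hn]) w (by simpa using hw) rfl
      exact ⟨[.flat a] ++ v, r, (isDyck_flat a).append hv, by simp⟩
    | .up :: w =>
      simp only [height_cons, Step.ht_up] at hw
      obtain ⟨v, r, hv, rfl⟩ := ih w.length (by simp [← hn]) w (by omega) rfl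
      have hr : height r < 0 := by simp [hv.2] at hw; omega
      obtain ⟨v', r', hv', rfl⟩ := ih r.length (by simp [← hn]; omega) r hr rfl
      exact ⟨(.up :: (v ++ [.down])) ++ v', r', hv.excursion.append hv', by simp⟩

/-- The first step to height `-1` determines the nonnegative part before it. -/
theorem first_passage_unique {v v' r r' : List (Step α)} (hv : IsDyck v) (hv' : IsDyck v')
    (h : v ++ Step.down :: r = v' ++ Step.down :: r') : v = v' ∧ r = r' := by
  have key : ∀ {u u' s s' : List (Step α)}, IsDyck u → IsDyck u' →
      ∀ c, u' = u ++ c → Step.down :: s = c ++ Step.down :: s' → c = [] := by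
    intro u u' s s' hu hu' c hc hs
    cases c with
    | nil => rfl
    | cons x c =>
      exfalso
      simp only [List.cons_append, List.cons.injEq] at hs
      have h1 := hu'.1
      rw [hc, nonNeg_append, ← hs.1] at h1
      have := h1.2.1
      simp [hu.2] at this
  rcases List.append_eq_append_iff.1 h with ⟨c, h1, h2⟩ | ⟨c, h1, h2⟩
  · obtain rfl := key hv hv' c h1 h2
    simp_all
  · obtain rfl := key hv' hv c h1 h2
    simp_all

/-- The walk described by a letter or an excursion to positive heights. -/
def tok : α ⊕ Dyck α → List (Step α)
  | .inl a => [.flat a]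
  | .inr v => .up :: (v.1 ++ [.down])

/-- The walk described by a sequence of letters and excursions. -/
def asm (τ : List (α ⊕ Dyck α)) : List (Step α) := τ.flatMap tok

@[simp] theorem asm_nil : asm ([] : List (α ⊕ Dyck α)) = [] := rfl
@[simp] theorem asm_inl (a : α) (τ) : asm (.inl a :: τ) = .flat a :: asm τ := rfl
@[simp] theorem asm_inr (v : Dyck α) (τ) :
    asm (.inr v :: τ) = .up :: (v.1 ++ .down :: asm τ) := by simp [asm, tok]
@[simp] theorem asm_append (σ τ : List (α ⊕ Dyck α)) : asm (σ ++ τ) = asm σ ++ asm τ := by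
  simp [asm]

theorem isDyck_asm (τ : List (α ⊕ Dyck α)) : IsDyck (asm τ) := by
  induction τ with
  | nil => exact isDyck_nil
  | cons s τ ih =>
    cases s with
    | inl a => exact (isDyck_flat a).append ih
    | inr v => simpa using v.2.excursion.append ih

theorem asm_injective : Function.Injective (asm (α := α)) := by
  intro τ
  induction τ with
  | nil =>
    rintro (_ | ⟨_ | _, _⟩) h
    · rfl
    · simp at h
    · simp at h
  | cons s τ ih =>
    rintro (_ | ⟨s', τ'⟩) h
    · cases s <;> simp at h
    · cases s <;> cases s' <;> simp at h
      · rw [h.1, ih h.2]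
      · obtain ⟨h1, h2⟩ := first_passage_unique (Subtype.prop _) (Subtype.prop _) h
        rw [ih h2, Subtype.ext h1]

theorem exists_asm {w : List (Step α)} (hw : IsDyck w) : ∃ τ, asm τ = w := by
  induction hn : w.length using Nat.strong_induction_on generalizing w with
  | _ n ih =>
    match w with
    | [] => exact ⟨[], rfl⟩
    | .down :: r => have := hw.1.1; simp at this
    | .flat a :: w =>
      obtain ⟨τ, rfl⟩ := ih w.length (by simp [← hn])
        (IsDyck.of_append (u := [.flat a]) (isDyck_flat a) hw) rfl
      exact ⟨.inl a :: τ, rfl⟩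
    | .up :: w =>
      obtain ⟨v, r, hv, rfl⟩ := exists_first_passage w (by
        have := hw.2; simp at this; omega)
      obtain ⟨τ, rfl⟩ := ih r.length (by simp [← hn]; omega)
        (IsDyck.of_append hv.excursion (by simpa using hw)) rfl
      exact ⟨.inr ⟨v, hv⟩ :: τ, by simp⟩

/-- Walks that stay nonnegative and return to `0` are sequences of letters and excursions. -/
def dyckEquiv : List (α ⊕ Dyck α) ≃ Dyck α :=
  Equiv.ofBijective (fun τ => ⟨asm τ, isDyck_asm τ⟩)
    ⟨fun _ _ h => asm_injective (congrArg Subtype.val h),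
      fun w => (exists_asm w.2).imp fun _ h => Subtype.ext h⟩

@[simp] theorem dyckEquiv_coe (τ : List (α ⊕ Dyck α)) : (dyckEquiv τ).1 = asm τ := rfl

/-- The walk described by a letter, a positive excursion, or a negative excursion (given by its
mirror image). -/
def tokZ : α ⊕ (Dyck α ⊕ Dyck α) → List (Step α)
  | .inl a => [.flat a]
  | .inr (.inl v) => .up :: (v.1 ++ [.down])
  | .inr (.inr v) => .down :: (mirror v.1 ++ [.up])

/-- The walk described by a sequence of letters, positive and negative excursions. -/
def asmZ (τ : List (α ⊕ (Dyck α ⊕ Dyck α))) : List (Step α) := τ.flatMap tokZ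

@[simp] theorem asmZ_nil : asmZ ([] : List (α ⊕ (Dyck α ⊕ Dyck α))) = [] := rfl
@[simp] theorem asmZ_inl (a : α) (τ) : asmZ (.inl a :: τ) = .flat a :: asmZ τ := rfl
@[simp] theorem asmZ_inr_inl (v : Dyck α) (τ) :
    asmZ (.inr (.inl v) :: τ) = .up :: (v.1 ++ .down :: asmZ τ) := by simp [asmZ, tokZ]
@[simp] theorem asmZ_inr_inr (v : Dyck α) (τ) :
    asmZ (.inr (.inr v) :: τ) = .down :: (mirror v.1 ++ .up :: asmZ τ) := by simp [asmZ, tokZ]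

theorem height_asmZ (τ : List (α ⊕ (Dyck α ⊕ Dyck α))) : height (asmZ τ) = 0 := by
  induction τ with
  | nil => rfl
  | cons s τ ih =>
    rcases s with a | v | v
    · simp [ih]
    all_goals simp [ih, v.2.2]

theorem asmZ_injective : Function.Injective (asmZ (α := α)) := by
  intro τ
  induction τ with
  | nil =>
    rintro (_ | ⟨_ | _ | _, _⟩) h
    · rfl
    all_goals simp at h
  | cons s τ ih =>
    rintro (_ | ⟨s', τ'⟩) h
    · rcases s with a | v | v <;> simp at h
    · rcases s with a | v | v <;> rcases s' with a' | v' | v' <;> simp at h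
      · rw [h.1, ih h.2]
      · obtain ⟨h1, h2⟩ := first_passage_unique v.2 v'.2 h
        rw [ih h2, Subtype.ext h1]
      · have h' := congrArg mirror h
        simp only [mirror_append, mirror_mirror, mirror_cons, Step.mirror_up] at h'
        obtain ⟨h1, h2⟩ := first_passage_unique v.2 v'.2 h'
        rw [ih (by simpa using congrArg mirror h2), Subtype.ext h1]

theorem exists_asmZ {w : List (Step α)} (hw : height w = 0) : ∃ τ, asmZ τ = w := by
  induction hn : w.length using Nat.strong_induction_on generalizing w with
  | _ n ih =>
    match w with
    | [] => exact ⟨[], rfl⟩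
    | .flat a :: w =>
      obtain ⟨τ, rfl⟩ := ih w.length (by simp [← hn]) (by simpa using hw) rfl
      exact ⟨.inl a :: τ, rfl⟩
    | .up :: w =>
      simp only [height_cons, Step.ht_up] at hw
      obtain ⟨v, r, hv, rfl⟩ := exists_first_passage w (by omega)
      obtain ⟨τ, rfl⟩ := ih r.length (by simp [← hn]; omega)
        (by simp [hv.2] at hw; omega) rfl
      exact ⟨.inr (.inl ⟨v, hv⟩) :: τ, by simp⟩
    | .down :: w =>
      simp only [height_cons, Step.ht_down] at hw
      obtain ⟨v, r, hv, hr⟩ := exists_first_passage (mirror w) (by simp; omega)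
      obtain rfl : w = mirror v ++ .up :: mirror r := by
        simpa using congrArg mirror hr
      obtain ⟨τ, hτ⟩ := ih (mirror r).length (by simp [← hn]; omega)
        (by simp [hv.2] at hw ⊢; omega) rfl
      exact ⟨.inr (.inr ⟨v, hv⟩) :: τ, by simp [hτ]⟩

/-- Closed walks are sequences of letters, positive and negative excursions. -/
def closedEquiv : List (α ⊕ (Dyck α ⊕ Dyck α)) ≃ {w : List (Step α) // height w = 0} :=
  Equiv.ofBijective (fun τ => ⟨asmZ τ, height_asmZ τ⟩)
    ⟨fun _ _ h => asmZ_injective (congrArg Subtype.val h),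
      fun w => (exists_asmZ w.2).imp fun _ h => Subtype.ext h⟩

@[simp] theorem closedEquiv_coe (τ : List (α ⊕ (Dyck α ⊕ Dyck α))) :
    (closedEquiv τ).1 = asmZ τ := rfl

/-- The concatenation of the walks of a list. -/
def join (ws : List (Dyck α)) : List (Step α) := ws.flatMap Subtype.val

@[simp] theorem join_nil : join ([] : List (Dyck α)) = [] := rfl
@[simp] theorem join_cons (v : Dyck α) (ws) : join (v :: ws) = v.1 ++ join ws := rfl

theorem isDyck_join (ws : List (Dyck α)) : IsDyck (join ws) := by
  induction ws with
  | nil => exact isDyck_nil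
  | cons v ws ih => exact v.2.append ih

/-! ### The letters written at a position -/

/-- The letters written at the position `j` relative to the start of the walk. -/
def lettersAt : ℤ → List (Step α) → List α
  | _, [] => []
  | j, .flat a :: w => if j = 0 then a :: lettersAt j w else lettersAt j w
  | j, .up :: w => lettersAt (j - 1) w
  | j, .down :: w => lettersAt (j + 1) w

@[simp] theorem lettersAt_nil (j : ℤ) : lettersAt j ([] : List (Step α)) = [] := rfl
@[simp] theorem lettersAt_flat (j : ℤ) (a : α) (w) :
    lettersAt j (.flat a :: w) = if j = 0 then a :: lettersAt j w else lettersAt j w := rfl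
@[simp] theorem lettersAt_up (j : ℤ) (w : List (Step α)) :
    lettersAt j (.up :: w) = lettersAt (j - 1) w := rfl
@[simp] theorem lettersAt_down (j : ℤ) (w : List (Step α)) :
    lettersAt j (.down :: w) = lettersAt (j + 1) w := rfl

theorem lettersAt_append (j : ℤ) (u w : List (Step α)) :
    lettersAt j (u ++ w) = lettersAt j u ++ lettersAt (j - height u) w := by
  induction u generalizing j with
  | nil => simp
  | cons s u ih =>
    cases s with
    | flat a => by_cases hj : j = 0 <;> simp [hj, ih]
    | up => simp [ih, sub_sub]
    | down =>
      simp only [List.cons_append, lettersAt_down, ih, height_cons, Step.ht_down]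
      congr 2; ring

theorem lettersAt_mirror (j : ℤ) (w : List (Step α)) :
    lettersAt j (mirror w) = lettersAt (-j) w := by
  induction w generalizing j with
  | nil => rfl
  | cons s w ih =>
    cases s with
    | flat a => by_cases hj : j = 0 <;> simp [hj, ih]
    | up => simp only [mirror_cons, Step.mirror_up, lettersAt_down, lettersAt_up, ih]; congr 1; ring
    | down =>
      simp only [mirror_cons, Step.mirror_down, lettersAt_down, lettersAt_up, ih]; congr 1; ring

theorem NonNeg.lettersAt_eq_nil {h j : ℤ} (h0 : 0 ≤ h) (hj : j < -h) {w : List (Step α)}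
    (hw : NonNeg h w) : lettersAt j w = [] := by
  induction w generalizing h j with
  | nil => rfl
  | cons s w ih =>
    cases s with
    | flat a =>
      rw [lettersAt_flat, if_neg (by omega)]
      exact ih h0 hj (by simpa using hw.2)
    | up => exact ih (h := h + 1) (by omega) (by omega) hw.2
    | down => exact ih (h := h + -1) hw.1 (by omega) hw.2

theorem IsDyck.lettersAt_eq_nil {j : ℤ} (hj : j < 0) {w : List (Step α)} (hw : IsDyck w) :
    lettersAt j w = [] := hw.1.lettersAt_eq_nil le_rfl (by omega)

open List in
/-- An excursion writes nothing at position `0`, and its interior is shifted up by one. -/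
theorem lettersAt_asm (j : ℤ) (τ : List (α ⊕ Dyck α)) :
    lettersAt j (asm τ) = if j = 0 then τ.lefts else lettersAt (j - 1) (join τ.rights) := by
  induction τ with
  | nil => simp
  | cons s τ ih =>
    cases s with
    | inl a => (by_cases hj : j = 0 <;> simp [hj, ih]); simp_all
    | inr v =>
      by_cases hj : j = 0
      · subst hj
        simp [lettersAt_append, v.2.2, ih, v.2.lettersAt_eq_nil (show (-1 : ℤ) < 0 by simp)]
      · simp [lettersAt_append, v.2.2, ih, hj]

open List in
/-- Excursions below `0` are mirrored, so that positions change sign. -/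
theorem lettersAt_asmZ (j : ℤ) (τ : List (α ⊕ (Dyck α ⊕ Dyck α))) :
    lettersAt j (asmZ τ) = if j = 0 then τ.lefts else
      lettersAt (j - 1) (join τ.rights.lefts) ++ lettersAt (-j - 1) (join τ.rights.rights) := by
  induction τ with
  | nil => simp
  | cons s τ ih =>
    rcases s with a | v | v
    · (by_cases hj : j = 0 <;> simp [hj, ih]); simp_all
    · by_cases hj : j = 0
      · subst hj
        simp [lettersAt_append, v.2.2, ih, v.2.lettersAt_eq_nil (show (-1 : ℤ) < 0 by simp)]
      · simp [lettersAt_append, v.2.2, ih, hj]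
    · have e1 : j + 1 + -1 = j := by ring
      have e2 : -(j + 1) = -j - 1 := by ring
      by_cases hj : j = 0
      · subst hj
        simp [lettersAt_append, lettersAt_mirror, v.2.2, ih,
          v.2.lettersAt_eq_nil (show (-1 : ℤ) < 0 by simp)]
      · simp only [asmZ_inr_inr, lettersAt_down, lettersAt_append, lettersAt_mirror, height_mirror,
          v.2.2, lettersAt_up, ih, hj, if_false, e2, rights_inr, lefts_inr, join_cons, neg_zero,
          sub_zero, add_sub_cancel_right]
        rcases lt_or_gt_of_ne hj with h | h
        · rw [(isDyck_join τ.rights.lefts).lettersAt_eq_nil (show j - 1 < 0 by omega)]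
          simp
        · rw [v.2.lettersAt_eq_nil (show -j - 1 < 0 by omega),
            (isDyck_join τ.rights.rights).lettersAt_eq_nil (show -j - 1 < 0 by omega)]
          simp

section balanced

variable {D : Type*} [Group D] (φ : α → D)

/-- The product of the values of the letters of a word. -/
def value (l : List α) : D := (l.map φ).prod

@[simp] theorem value_nil : value φ [] = 1 := rfl
@[simp] theorem value_cons (a : α) (l) : value φ (a :: l) = φ a * value φ l := by simp [value]
@[simp] theorem value_append (k l : List α) : value φ (k ++ l) = value φ k * value φ l := by
  simp [value]

/-- At every position, the product of the letters written there is trivial. -/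
def Balanced (w : List (Step α)) : Prop := ∀ j, value φ (lettersAt j w) = 1

open List in
/-- A nonnegative walk is balanced iff its letters at `0` and the concatenation of its excursions are. -/
theorem balanced_asm (τ : List (α ⊕ Dyck α)) :
    Balanced φ (asm τ) ↔ value φ τ.lefts = 1 ∧ Balanced φ (join τ.rights) := by
  simp only [Balanced, lettersAt_asm]
  constructor
  · intro h
    refine ⟨by simpa using h 0, fun j => ?_⟩
    by_cases hj : j = -1
    · rw [(isDyck_join _).lettersAt_eq_nil (by omega)]; rfl
    · have := h (j + 1)
      rwa [if_neg (by omega), add_sub_cancel_right] at this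
  · rintro ⟨h1, h2⟩ j
    split_ifs
    exacts [h1, h2 _]

open List in
/-- The excursions above and below the start use disjoint sets of positions. -/
theorem balanced_asmZ (τ : List (α ⊕ (Dyck α ⊕ Dyck α))) :
    Balanced φ (asmZ τ) ↔ value φ τ.lefts = 1 ∧ Balanced φ (join τ.rights.lefts) ∧
      Balanced φ (join τ.rights.rights) := by
  simp only [Balanced, lettersAt_asmZ]
  constructor
  · intro h
    refine ⟨by simpa using h 0, fun j => ?_, fun j => ?_⟩
    all_goals
      by_cases hj : j < 0
      · rw [(isDyck_join _).lettersAt_eq_nil hj]; rfl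
    · have := h (j + 1)
      rw [if_neg (by omega), (isDyck_join τ.rights.rights).lettersAt_eq_nil
        (show -(j + 1) - 1 < 0 by omega)] at this
      simpa using this
    · have := h (-j - 1)
      rw [if_neg (by omega), (isDyck_join τ.rights.lefts).lettersAt_eq_nil
        (show -j - 1 - 1 < 0 by omega)] at this
      simpa using this
  · rintro ⟨h1, h2, h3⟩ j
    split_ifs
    · exact h1
    · rw [value_append, h2, h3, one_mul]

end balanced

section weight

variable {R : Type v} [CommSemiring R] (μ : α → R) (ξ : R)

/-- The product of the weights of the letters of a word. -/
def letterWeight (l : List α) : R := (l.map μ).prod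

@[simp] theorem letterWeight_nil : letterWeight μ [] = 1 := rfl
@[simp] theorem letterWeight_cons (a : α) (l) :
    letterWeight μ (a :: l) = μ a * letterWeight μ l := by simp [letterWeight]

/-- The weight of a step: `ξ` for the moves of the cursor. -/
def stepWeight : Step α → R
  | .flat a => μ a
  | .up => ξ
  | .down => ξ

/-- The product of the weights of the steps of a walk. -/
def weight (w : List (Step α)) : R := (w.map (stepWeight μ ξ)).prod

@[simp] theorem weight_nil : weight μ ξ [] = 1 := rfl
@[simp] theorem weight_flat (a : α) (w) : weight μ ξ (.flat a :: w) = μ a * weight μ ξ w := by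
  simp [weight, stepWeight]
@[simp] theorem weight_up (w) : weight μ ξ (.up :: w) = ξ * weight μ ξ w := by
  simp [weight, stepWeight]
@[simp] theorem weight_down (w) : weight μ ξ (.down :: w) = ξ * weight μ ξ w := by
  simp [weight, stepWeight]
@[simp] theorem weight_append (u w) : weight μ ξ (u ++ w) = weight μ ξ u * weight μ ξ w := by
  simp [weight]
@[simp] theorem weight_mirror (w) : weight μ ξ (mirror w) = weight μ ξ w := by
  induction w with
  | nil => rfl
  | cons s w ih => cases s <;> simp [ih]

open List in
theorem weight_asm (τ : List (α ⊕ Dyck α)) :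
    weight μ ξ (asm τ) = letterWeight μ τ.lefts * ((ξ ^ 2) ^ τ.rights.length
      * weight μ ξ (join τ.rights)) := by
  induction τ with
  | nil => simp
  | cons s τ ih => cases s <;> simp [ih] <;> ring

open List in
theorem weight_asmZ (τ : List (α ⊕ (Dyck α ⊕ Dyck α))) :
    weight μ ξ (asmZ τ) = letterWeight μ τ.lefts * (((ξ ^ 2) ^ τ.rights.lefts.length
      * weight μ ξ (join τ.rights.lefts)) * ((ξ ^ 2) ^ τ.rights.rights.length
      * weight μ ξ (join τ.rights.rights))) := by
  induction τ with
  | nil => simp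
  | cons s τ ih => rcases s with a | v | v <;> simp [ih] <;> ring

end weight

end Walk

/-! ### The equations for walks with balanced letters -/

namespace Walk

section balanced

open Classical in
/-- The weight of a walk if it is balanced, and `0` otherwise. -/
def balWeight {α : Type u} {D : Type*} [Group D] (φ : α → D) {R : Type v} [CommSemiring R]
    (μ : α → R) (ξ : R) (w : List (Step α)) : R :=
  if Balanced φ w then weight μ ξ w else 0

open Classical in
/-- The weight of a word if its value is trivial, and `0` otherwise. -/
def trivWeight {α : Type u} {D : Type*} [Group D] (φ : α → D) {R : Type v} [CommSemiring R]
    (μ : α → R) (l : List α) : R :=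
  if value φ l = 1 then letterWeight μ l else 0

variable {α : Type u} {D : Type*} [Group D] (φ : α → D)
  {R : Type v} [CommSemiring R] (μ : α → R) (ξ : R)

open List in
theorem balWeight_asm (τ : List (α ⊕ Dyck α)) : balWeight φ μ ξ (asm τ) =
    trivWeight φ μ τ.lefts * ((ξ ^ 2) ^ τ.rights.length * balWeight φ μ ξ (join τ.rights)) := by
  simp only [balWeight, trivWeight, balanced_asm, weight_asm]
  by_cases h1 : value φ τ.lefts = 1 <;> by_cases h2 : Balanced φ (join τ.rights) <;>
    simp [balanced_asm, h1, h2]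

open List in
theorem balWeight_asmZ (τ : List (α ⊕ (Dyck α ⊕ Dyck α))) : balWeight φ μ ξ (asmZ τ) =
    trivWeight φ μ τ.lefts * (((ξ ^ 2) ^ τ.rights.lefts.length
      * balWeight φ μ ξ (join τ.rights.lefts)) * ((ξ ^ 2) ^ τ.rights.rights.length
      * balWeight φ μ ξ (join τ.rights.rights))) := by
  simp only [balWeight, trivWeight, balanced_asmZ, weight_asmZ]
  by_cases h1 : value φ τ.lefts = 1 <;> by_cases h2 : Balanced φ (join τ.rights.lefts) <;>
    by_cases h3 : Balanced φ (join τ.rights.rights) <;>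
    simp [balanced_asmZ, h1, h2, h3]

variable [TopologicalSpace R]

/-- The generating function of the `(n + 1)`-tuples of words whose concatenation has trivial
value; the binomial coefficient counts the ways of cutting a word into `n + 1` pieces. -/
def lampSeries (n : ℕ) : R :=
  ∑' l : List α, ((l.length + n).choose n : R) * trivWeight φ μ l

/-- The generating function of the `c`-tuples of nonnegative walks from `0` to `0` whose
concatenation is balanced. -/
def halfSeries (c : ℕ) : R :=
  ∑' ws : {ws : List (Dyck α) // ws.length = c}, balWeight φ μ ξ (join ws.1)

/-- The generating function of the balanced closed walks. -/
def closedSeries : R :=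
  ∑' w : {w : List (Step α) // height w = 0}, balWeight φ μ ξ w.1

/-- The only `0`-tuple of walks is the empty one. -/
theorem halfSeries_zero [T2Space R] : halfSeries φ μ ξ 0 = 1 := by
  have : Unique {ws : List (Dyck α) // ws.length = 0} :=
    ⟨⟨⟨[], rfl⟩⟩, fun ws => Subtype.ext (List.length_eq_zero_iff.1 ws.2)⟩
  rw [halfSeries, tsum_eq_single default fun b hb => (hb (Subsingleton.elim _ _)).elim]
  have h : (default : {ws : List (Dyck α) // ws.length = 0}).1 = [] :=
    List.length_eq_zero_iff.1 (default : {ws : List (Dyck α) // ws.length = 0}).2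
  rw [h]
  simp [balWeight, Balanced]

/-- Pieces of a nonnegative walk, cut at height `0`, correspond to pieces of its sequence of
letters and excursions. -/
theorem encard_cut_fibre (c : ℕ) (τ : List (α ⊕ Dyck α)) :
    ((fun ws : {ws : List (Dyck α) // ws.length = c + 1} =>
      (ws.1.map dyckEquiv.symm).flatten) ⁻¹' {τ}).encard = ((τ.length + c).choose c : ℕ) := by
  rw [← List.encard_cuts c τ]
  have hinj : Function.Injective fun ws : {ws : List (Dyck α) // ws.length = c + 1} =>
      ws.1.map dyckEquiv.symm :=
    (List.map_injective_iff.2 dyckEquiv.symm.injective).comp Subtype.val_injective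
  rw [← hinj.encard_image]
  congr 1
  ext ws
  constructor
  · rintro ⟨ws, hws, rfl⟩
    exact ⟨by simpa using ws.2, hws⟩
  · rintro ⟨h1, h2⟩
    refine ⟨⟨ws.map dyckEquiv, by simpa using h1⟩, ?_, by simp⟩
    simpa using h2

theorem asm_flatten (ws : List (Dyck α)) : asm (ws.map dyckEquiv.symm).flatten = join ws := by
  induction ws with
  | nil => rfl
  | cons v ws ih =>
    rw [List.map_cons, List.flatten_cons, asm_append, ih, ← dyckEquiv_coe,
      Equiv.apply_symm_apply, join_cons]

theorem finite_join (c : ℕ) (w : List (Step α)) :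
    ((fun ws : {ws : List (Dyck α) // ws.length = c} => join ws.1) ⁻¹' {w}).Finite := by
  refine Set.Finite.of_finite_image (f := fun ws => ws.1.map Subtype.val)
    ((List.finite_cuts c w).subset ?_)
    ((List.map_injective_iff.2 Subtype.val_injective).comp Subtype.val_injective).injOn
  rintro _ ⟨ws, hws, rfl⟩
  exact ⟨by simpa using ws.2, by rw [← List.flatMap_def]; exact hws⟩

section summable

variable [LocSummable.{u} R] {φ μ ξ}

theorem summable_letterWeight (hs : Summable (weight μ ξ)) : Summable (letterWeight μ) := by
  have h := LocSummable.of_injective hs (e := fun l : List α => l.map Step.flat)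
    (List.map_injective_iff.2 fun a b h => by simpa using h)
  refine h.congr fun l => ?_
  induction l with
  | nil => rfl
  | cons a l ih => simp [ih]

variable (φ)

theorem summable_lamp (hs : Summable (weight μ ξ)) (n : ℕ) :
    Summable fun l : List α => ((l.length + n).choose n : R) * trivWeight φ μ l := by
  classical
  have h := LocSummable.pull (id : List α → List α)
    (fun l => if value φ l = 1 then (l.length + n).choose n else 0)
    (fun k => (Set.finite_singleton k).preimage Function.injective_id.injOn)
    (summable_letterWeight hs)
  refine h.congr fun l => ?_
  rw [trivWeight]
  split_ifs <;> simp

theorem summable_half (hs : Summable (weight μ ξ)) (c : ℕ) :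
    Summable fun ws : {ws : List (Dyck α) // ws.length = c} => balWeight φ μ ξ (join ws.1) := by
  classical
  have h := LocSummable.pull (fun ws : {ws : List (Dyck α) // ws.length = c} => join ws.1)
    (fun ws => if Balanced φ (join ws.1) then 1 else 0) (finite_join c) hs
  refine h.congr fun l => ?_
  rw [balWeight]
  split_ifs <;> simp

theorem summable_closed (hs : Summable (weight μ ξ)) :
    Summable fun w : {w : List (Step α) // height w = 0} => balWeight φ μ ξ w.1 := by
  classical
  exact (LocSummable.ite (LocSummable.of_injective hs Subtype.val_injective)
    fun w : {w : List (Step α) // height w = 0} => Balanced φ w.1)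

end summable

/-- Sorting pairs by the length of the second entry. -/
def sigmaLength (A X : Type*) : (Σ b : ℕ, A × {r : List X // r.length = b}) ≃ A × List X where
  toFun p := (p.2.1, p.2.2.1)
  invFun p := ⟨p.2.length, p.1, p.2, rfl⟩
  left_inv := by rintro ⟨_, a, r, rfl⟩; rfl
  right_inv _ := rfl

/-- Sorting triples by the lengths of the second and the third entry. -/
def sigmaLengths (A X Y : Type*) : (Σ b : ℕ × ℕ, A × ({r : List X // r.length = b.1} ×
    {r : List Y // r.length = b.2})) ≃ A × (List X × List Y) where
  toFun p := (p.2.1, p.2.2.1.1, p.2.2.2.1)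
  invFun p := ⟨(p.2.1.length, p.2.2.length), p.1, ⟨p.2.1, rfl⟩, ⟨p.2.2, rfl⟩⟩
  left_inv := by rintro ⟨⟨b, c⟩, a, ⟨r, h⟩, ⟨r', h'⟩⟩; dsimp at h h'; subst h h'; rfl
  right_inv _ := rfl

/-- Interleaving `k` letters with `b` excursions and cutting the result into `c + 1` pieces, or
cutting the sequence of `b` excursions first and inserting the letters and cuts together. -/
theorem choose_mul_choose_add (k b c : ℕ) :
    (k + b).choose k * (k + b + c).choose c = (b + c).choose c * (k + (b + c)).choose (b + c) := by
  have h := Nat.choose_mul (n := k + b + c) (k := b + c) (s := c)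
  rw [show k + b + c - c = k + b by omega, show b + c - c = b by omega] at h
  rw [← Nat.choose_symm_add (a := k) (b := b)] at h
  rw [← add_assoc, mul_comm, ← h (by omega), mul_comm]

variable [IsTopologicalSemiring R] [T3Space R] [LocSummable.{u} R]
variable {μ ξ}

/-- Cutting nonnegative walks at height `0` turns the last step of a `(c + 1)`-tuple of walks into
the first floor (a word cut into pieces) and a `b`-tuple of walks one level above. -/
theorem hasSum_halfSeries (hs : Summable (weight μ ξ)) (c : ℕ) :
    HasSum (fun b : ℕ => (ξ ^ 2) ^ b * ((b + c).choose c : R) * lampSeries φ μ (b + c)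
      * halfSeries φ μ ξ b) (halfSeries φ μ ξ (c + 1)) := by
  have h1 : HasSum (fun ws : {ws : List (Dyck α) // ws.length = c + 1} =>
      balWeight φ μ ξ (asm (ws.1.map dyckEquiv.symm).flatten)) (halfSeries φ μ ξ (c + 1)) := by
    simp only [asm_flatten]
    exact (summable_half φ hs (c + 1)).hasSum
  have h2 := HasSum.of_fibres (g := fun τ => balWeight φ μ ξ (asm τ)) (encard_cut_fibre c) h1
  have h3 := HasSum.of_fibres (e := fun τ : List (α ⊕ Dyck α) => (τ.lefts, τ.rights))
    (N := fun p => (p.1.length + p.2.length).choose p.1.length)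
    (g := fun p => ((p.1.length + p.2.length + c).choose c : R) *
      (trivWeight φ μ p.1 * ((ξ ^ 2) ^ p.2.length * balWeight φ μ ξ (join p.2))))
    (s := halfSeries φ μ ξ (c + 1)) (fun p => by
      rw [← List.encard_interleavings]
      congr 1
      ext τ
      simp [Prod.ext_iff]) (by
      refine h2.congr_fun fun τ => ?_
      simp only [List.length_lefts_add_rights, balWeight_asm])
  refine ((sigmaLength _ _).hasSum_iff.2 h3).sigma fun b => ?_
  have h5 := LocSummable.mul (summable_lamp φ hs (b + c)) (summable_half φ hs b)
  have h6 := (summable_lamp φ hs (b + c)).hasSum.mul (summable_half φ hs b).hasSum h5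
  have h4 := h6.mul_left ((ξ ^ 2) ^ b * ((b + c).choose c : R))
  rw [← mul_assoc] at h4
  refine h4.congr_fun fun p => ?_
  obtain ⟨l, r, rfl⟩ := p
  have := congrArg (Nat.cast (R := R)) (choose_mul_choose_add l.length r.length c)
  push_cast at this
  simp only [Function.comp_apply, sigmaLength, Equiv.coe_fn_mk]
  rw [← mul_assoc, this]
  ring

/-- Cutting closed walks at their visits to `0`. -/
theorem hasSum_closedSeries (hs : Summable (weight μ ξ)) :
    HasSum (fun p : ℕ × ℕ => (ξ ^ 2) ^ (p.1 + p.2) * ((p.1 + p.2).choose p.1 : R)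
      * lampSeries φ μ (p.1 + p.2) * halfSeries φ μ ξ p.2 * halfSeries φ μ ξ p.1)
      (closedSeries φ μ ξ) := by
  have h1 : HasSum (fun τ : List (α ⊕ (Dyck α ⊕ Dyck α)) => balWeight φ μ ξ (asmZ τ))
      (closedSeries φ μ ξ) := by
    have h0 := (summable_closed φ hs).hasSum
    rw [← closedEquiv.hasSum_iff] at h0
    exact h0.congr_fun fun τ => rfl
  have h2 := HasSum.of_fibres
    (e := fun τ : List (α ⊕ (Dyck α ⊕ Dyck α)) => (τ.lefts, τ.rights))
    (N := fun p => (p.1.length + p.2.length).choose p.1.length)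
    (g := fun p => trivWeight φ μ p.1 * (((ξ ^ 2) ^ p.2.lefts.length
      * balWeight φ μ ξ (join p.2.lefts)) * ((ξ ^ 2) ^ p.2.rights.length
      * balWeight φ μ ξ (join p.2.rights))))
    (s := closedSeries φ μ ξ) (fun p => by
      rw [← List.encard_interleavings]
      congr 1
      ext τ
      simp [Prod.ext_iff]) (by
      refine h1.congr_fun fun τ => ?_
      simp only [balWeight_asmZ])
  have h3 := HasSum.of_fibres
    (e := fun p : List α × List (Dyck α ⊕ Dyck α) => (p.1, p.2.lefts, p.2.rights))
    (N := fun p => (p.2.1.length + p.2.2.length).choose p.2.1.length)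
    (g := fun p => ((p.1.length + (p.2.1.length + p.2.2.length)).choose p.1.length : R) *
      (trivWeight φ μ p.1 * (((ξ ^ 2) ^ p.2.1.length
      * balWeight φ μ ξ (join p.2.1)) * ((ξ ^ 2) ^ p.2.2.length
      * balWeight φ μ ξ (join p.2.2)))))
    (s := closedSeries φ μ ξ) (fun p => by
      rw [← List.encard_interleavings]
      refine Eq.trans ?_ ((Prod.mk_right_injective p.1).encard_image _)
      congr 1
      ext ⟨l, r⟩
      simp only [Set.mem_preimage, Set.mem_singleton_iff, Prod.ext_iff, Set.mem_image,
        Set.mem_ofPred_eq]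
      constructor
      · rintro ⟨h1, h2, h3⟩
        exact ⟨r, ⟨h2, h3⟩, h1.symm, rfl⟩
      · rintro ⟨r', ⟨h2, h3⟩, h1, rfl⟩
        exact ⟨h1.symm, h2, h3⟩) (by
      refine h2.congr_fun fun τ => ?_
      simp only [List.length_lefts_add_rights])
  refine ((sigmaLengths _ _ _).hasSum_iff.2 h3).sigma fun b => ?_
  have h5 := LocSummable.mul (summable_half φ hs b.1) (summable_half φ hs b.2)
  have h6 := (summable_half φ hs b.1).hasSum.mul (summable_half φ hs b.2).hasSum h5
  have h7 := LocSummable.mul (summable_lamp φ hs (b.1 + b.2)) h5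
  have h8 := (summable_lamp φ hs (b.1 + b.2)).hasSum.mul h6 h7
  have h4 := h8.mul_left ((ξ ^ 2) ^ (b.1 + b.2) * ((b.1 + b.2).choose b.1 : R))
  have e : (ξ ^ 2) ^ (b.1 + b.2) * ((b.1 + b.2).choose b.1 : R)
      * lampSeries φ μ (b.1 + b.2) * halfSeries φ μ ξ b.2 * halfSeries φ μ ξ b.1
      = (ξ ^ 2) ^ (b.1 + b.2) * ((b.1 + b.2).choose b.1 : R)
      * (lampSeries φ μ (b.1 + b.2) * (halfSeries φ μ ξ b.1 * halfSeries φ μ ξ b.2)) := by ring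
  rw [e]
  refine h4.congr_fun fun p => ?_
  obtain ⟨b, c⟩ := b
  obtain ⟨l, ⟨r, h⟩, ⟨r', h'⟩⟩ := p
  dsimp only at h h'
  subst h h'
  simp only [Function.comp_apply, sigmaLengths, Equiv.coe_fn_mk]
  rw [Nat.choose_symm_add (a := l.length), pow_add]
  ring

end balanced

end Walk

/-! ### Series over chains -/

section order

variable {S : Type v} [CommSemiring S] {ι : Type*}

theorem coeff_eq_zero_of_X_pow_dvd {f : S⟦X⟧} {d n : ℕ} (h : PowerSeries.X ^ d ∣ f) (hn : n < d) :
    PowerSeries.coeff n f = 0 :=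
  PowerSeries.X_pow_dvd_iff.1 h n hn

variable [TopologicalSpace S]

/-- A family of power series whose orders tend to infinity is summable. -/
theorem summable_of_X_pow_dvd {f : ι → S⟦X⟧} (d : ι → ℕ) (hd : ∀ n, {i | d i ≤ n}.Finite)
    (h : ∀ i, PowerSeries.X ^ d i ∣ f i) : Summable f := by
  refine (PowerSeries.WithPiTopology.summable_iff_summable_coeff _).2 fun n => ?_
  refine summable_of_hasFiniteSupport ((hd n).subset fun i hi => ?_)
  by_contra hlt
  exact hi (coeff_eq_zero_of_X_pow_dvd (h i) (not_le.1 hlt))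

/-- A coefficient of a sum of series of increasing orders is a finite sum. -/
theorem HasSum.coeff_eq_sum [T2Space S] {f : ι → S⟦X⟧} {s : S⟦X⟧} (hs : HasSum f s)
    (d : ι → ℕ) (h : ∀ i, PowerSeries.X ^ d i ∣ f i) (n : ℕ) (F : Finset ι)
    (hF : ∀ i, d i ≤ n → i ∈ F) :
    PowerSeries.coeff n s = ∑ i ∈ F, PowerSeries.coeff n (f i) := by
  refine ((PowerSeries.WithPiTopology.hasSum_iff_hasSum_coeff _).1 hs n).unique
    (hasSum_sum_of_ne_finset_zero fun i hi => ?_)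
  exact coeff_eq_zero_of_X_pow_dvd (h i) (not_le.1 fun hle => hi (hF i hle))

end order

theorem finite_pnat_le (n : ℕ) : {b : ℕ+ | (b : ℕ) ≤ n}.Finite :=
  (Set.finite_Iic n).preimage PNat.coe_injective.injOn

theorem finite_list_pnat_sum_le (n : ℕ) :
    {l : List ℕ+ | (l.map ((↑) : ℕ+ → ℕ)).sum ≤ n}.Finite := by
  induction n using Nat.strong_induction_on with
  | _ n ih =>
    refine ((Set.finite_singleton []).union ((finite_pnat_le n).biUnion (t := fun b =>
      (List.cons b) '' {l | (l.map ((↑) : ℕ+ → ℕ)).sum ≤ n - b}) fun b hb => ?_)).subset ?_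
    · exact (ih (n - b) (by have := b.pos; have : (b : ℕ) ≤ n := hb; omega)).image _
    · rintro (_ | ⟨b, l⟩) hl
      · exact .inl rfl
      · simp only [Set.mem_ofPred_eq, List.map_cons, List.sum_cons] at hl
        refine .inr (Set.mem_biUnion (x := b) (by simp; omega) ⟨l, ?_, rfl⟩)
        simp only [Set.mem_ofPred_eq]
        omega

theorem HasSum.of_pnat {R : Type*} [AddCommMonoid R] [TopologicalSpace R] [ContinuousAdd R]
    {g : ℕ → R} {s : R} (h : HasSum (fun n : ℕ+ => g n) s) : HasSum g (g 0 + s) := by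
  refine HasSum.zero_add ?_
  rw [← Equiv.pnatEquivNat.symm.hasSum_iff] at h
  exact h.congr_fun fun n => by simp

/-- A sum over pairs of natural numbers, split according to which of the indices vanish. -/
theorem HasSum.eq_split {R : Type*} [AddCommMonoid R] [TopologicalSpace R] [ContinuousAdd R]
    [T3Space R] {f : ℕ × ℕ → R} {F U V W : R} (hf : HasSum f F)
    (hrow : ∀ c, Summable fun d : ℕ+ => f (c, d))
    (hU : HasSum (fun q : ℕ+ × ℕ+ => f (q.1, q.2)) U)
    (hV : HasSum (fun d : ℕ+ => f (d, 0)) V) (hW : HasSum (fun d : ℕ+ => f (0, d)) W) :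
    F = f (0, 0) + W + (V + U) := by
  have h1 : ∀ c, HasSum (fun d => f (c, d)) (f (c, 0) + ∑' d : ℕ+, f (c, d)) := fun c =>
    HasSum.of_pnat (g := fun d => f (c, d)) (hrow c).hasSum
  have h2 := hf.prod_fiberwise h1
  have h3 := hU.prod_fiberwise fun c => (hrow c).hasSum
  have h4 := hV.add h3
  have h5 := HasSum.of_pnat (g := fun c => f (c, 0) + ∑' d : ℕ+, f (c, d)) h4
  rw [h2.unique h5, hW.tsum_eq]

section chain

variable {S : Type v} [CommSemiring S]

theorem chainTerm_cons {R : Type*} [CommSemiring R] (z : R) (P : ℕ+ → R) (d b : ℕ+)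
    (l : List ℕ+) : chainTerm z P d (b :: l) =
      z ^ (b : ℕ) * ((((b : ℕ) + d - 1).choose ((d : ℕ) - 1) : ℕ) : R) * P (b + d)
        * chainTerm z P b l := by
  have h : (b :: l).getLastD d = l.getLastD b := List.getLastD_cons
  rw [chainTerm, chainTerm, h, List.zipWith_cons_cons, List.prod_cons, add_comm d b,
    add_comm (d : ℕ) b]
  ring

theorem X_pow_dvd_chainTerm {z : S⟦X⟧} (hz : PowerSeries.X ∣ z) (P : ℕ+ → S⟦X⟧) (d : ℕ+)
    (l : List ℕ+) : PowerSeries.X ^ (l.map ((↑) : ℕ+ → ℕ)).sum ∣ chainTerm z P d l := by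
  induction l generalizing d with
  | nil => simp
  | cons b l ih =>
    rw [chainTerm_cons, List.map_cons, List.sum_cons, pow_add]
    refine mul_dvd_mul ?_ (ih b)
    exact ((pow_dvd_pow_of_dvd hz _).mul_right _).mul_right _

variable [TopologicalSpace S] {z : S⟦X⟧}

theorem summable_chainTerm (hz : PowerSeries.X ∣ z) (P : ℕ+ → S⟦X⟧) (d : ℕ+) :
    Summable (chainTerm z P d) :=
  summable_of_X_pow_dvd _ finite_list_pnat_sum_le (X_pow_dvd_chainTerm hz P d)

theorem summable_pow_mul (hz : PowerSeries.X ∣ z) (K : ℕ+ → S⟦X⟧) :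
    Summable fun b : ℕ+ => z ^ (b : ℕ) * K b :=
  summable_of_X_pow_dvd (fun b : ℕ+ => (b : ℕ)) finite_pnat_le
    fun _ => (pow_dvd_pow_of_dvd hz _).mul_right _

/-- A list is empty or has a first entry and a tail. -/
def listEquivOption (A : Type*) : List A ≃ Unit ⊕ (Σ _ : A, List A) where
  toFun
    | [] => .inl ()
    | a :: l => .inr ⟨a, l⟩
  invFun
    | .inl _ => []
    | .inr p => p.1 :: p.2
  left_inv l := by cases l <;> rfl
  right_inv p := by rcases p with _ | ⟨a, l⟩ <;> rfl

variable [IsTopologicalSemiring S] [T3Space S]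

/-- The recursion for the series over chains, by splitting off the first element of a chain. -/
theorem hasSum_chain (hz : PowerSeries.X ∣ z) (P : ℕ+ → S⟦X⟧) (d : ℕ+) :
    ∃ s, HasSum (fun b : ℕ+ => z ^ (b : ℕ) * ((((b : ℕ) + d - 1).choose ((d : ℕ) - 1) : ℕ) : S⟦X⟧)
      * P (b + d) * chainSeries z P b) s ∧ chainSeries z P d = P d + s := by
  have hsum : Summable fun p : (Σ _ : ℕ+, List ℕ+) => chainTerm z P d (p.1 :: p.2) := by
    refine summable_of_X_pow_dvd (fun p => ((p.1 :: p.2).map ((↑) : ℕ+ → ℕ)).sum)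
      (fun n => ?_) fun p => X_pow_dvd_chainTerm hz P d _
    refine (finite_list_pnat_sum_le n).preimage (f := fun p : (Σ _ : ℕ+, List ℕ+) => p.1 :: p.2) ?_
    rintro ⟨a, l⟩ - ⟨a', l'⟩ - h
    simp_all
  refine ⟨∑' p : (Σ _ : ℕ+, List ℕ+), chainTerm z P d (p.1 :: p.2), ?_, ?_⟩
  · refine hsum.hasSum.sigma fun b => ?_
    simp only [chainTerm_cons]
    exact (summable_chainTerm hz P b).hasSum.mul_left _
  · have h1 : HasSum (fun p : Unit ⊕ (Σ _ : ℕ+, List ℕ+) =>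
        chainTerm z P d ((listEquivOption ℕ+).symm p))
        (P d + ∑' p : (Σ _ : ℕ+, List ℕ+), chainTerm z P d (p.1 :: p.2)) := by
      refine HasSum.sum (f := fun p : Unit ⊕ (Σ _ : ℕ+, List ℕ+) =>
        chainTerm z P d ((listEquivOption ℕ+).symm p)) ?_ ?_
      · have := hasSum_unique fun _ : Unit => P d
        refine this.congr_fun fun _ => ?_
        simp [listEquivOption, chainTerm]
      · exact hsum.hasSum
    have h2 := (Equiv.hasSum_iff (f := chainTerm z P d) (listEquivOption ℕ+).symm).1 h1
    exact h2.tsum_eq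

/-- The recursion determines the series over chains: multiplication by `z` shifts coefficients. -/
theorem chainSeries_eq (hz : PowerSeries.X ∣ z) (P : ℕ+ → S⟦X⟧) (T : ℕ+ → S⟦X⟧)
    (hT : ∀ d : ℕ+, ∃ s, HasSum (fun b : ℕ+ => z ^ (b : ℕ)
      * ((((b : ℕ) + d - 1).choose ((d : ℕ) - 1) : ℕ) : S⟦X⟧) * P (b + d) * T b) s ∧ T d = P d + s)
    (d : ℕ+) : chainSeries z P d = T d := by
  suffices h : ∀ (n : ℕ) (d : ℕ+),
      PowerSeries.coeff n (chainSeries z P d) = PowerSeries.coeff n (T d) from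
    PowerSeries.ext fun n => h n d
  intro n
  induction n using Nat.strong_induction_on with
  | _ n ih =>
    intro d
    obtain ⟨s, hs, h1⟩ := hasSum_chain hz P d
    obtain ⟨s', hs', h2⟩ := hT d
    have hdvd : ∀ (T : ℕ+ → S⟦X⟧) (b : ℕ+), PowerSeries.X ^ (b : ℕ) ∣ z ^ (b : ℕ)
        * ((((b : ℕ) + d - 1).choose ((d : ℕ) - 1) : ℕ) : S⟦X⟧) * P (b + d) * T b := fun T b =>
      (((pow_dvd_pow_of_dvd hz _).mul_right _).mul_right _).mul_right _
    rw [h1, h2, map_add, map_add]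
    congr 1
    rw [hs.coeff_eq_sum (fun b => (b : ℕ)) (hdvd _) n (finite_pnat_le n).toFinset (by simp),
      hs'.coeff_eq_sum (fun b => (b : ℕ)) (hdvd _) n (finite_pnat_le n).toFinset (by simp)]
    refine Finset.sum_congr rfl fun b _ => ?_
    rw [PowerSeries.coeff_mul, PowerSeries.coeff_mul]
    refine Finset.sum_congr rfl fun p hp => ?_
    rw [Finset.HasAntidiagonal.mem_antidiagonal] at hp
    rcases Nat.lt_or_ge p.2 n with hlt | hge
    · rw [ih _ hlt]
    · have h0 : PowerSeries.coeff p.1 (z ^ (b : ℕ)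
          * ((((b : ℕ) + d - 1).choose ((d : ℕ) - 1) : ℕ) : S⟦X⟧) * P (b + d)) = 0 :=
        coeff_eq_zero_of_X_pow_dvd (((pow_dvd_pow_of_dvd hz _).mul_right _).mul_right _)
          (by have := b.pos; omega)
      rw [h0, zero_mul, zero_mul]

end chain

namespace Walk

variable {α : Type u} {D : Type*} [Group D] (φ : α → D) {S : Type v} [CommSemiring S]
  [TopologicalSpace S] [IsTopologicalSemiring S] [T3Space S] [LocSummable.{u} S]
  {μ : α → S⟦X⟧} {ξ z : S⟦X⟧} {P : ℕ+ → S⟦X⟧}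

/-- Both sides satisfy the recursion that determines the series over chains; the term for `b = 0`
in `hasSum_halfSeries` is the inhomogeneous one. -/
theorem halfSeries_eq_chainSeries (hs : Summable (weight μ ξ)) (hz : PowerSeries.X ∣ z)
    (hξ : ξ ^ 2 = z) (hP : ∀ n, P n = lampSeries φ μ ((n : ℕ) - 1)) (d : ℕ+) :
    chainSeries z P d = halfSeries φ μ ξ d := by
  subst hξ
  refine chainSeries_eq hz P (fun d : ℕ+ => halfSeries φ μ ξ d) (fun d => ?_) d
  have h1 := hasSum_halfSeries φ hs ((d : ℕ) - 1)
  have h2 := summable_pow_mul hz fun b : ℕ+ => ((((b : ℕ) + d - 1).choose ((d : ℕ) - 1) : ℕ) : S⟦X⟧)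
    * P (b + d) * halfSeries φ μ ξ b
  simp only [← mul_assoc] at h2
  refine ⟨_, h2.hasSum, ?_⟩
  have h3 := h1.unique (HasSum.of_pnat (h2.hasSum.congr_fun fun b => ?_))
  · rw [Nat.sub_add_cancel d.pos] at h3
    rw [h3]
    congr 1
    simp [hP, halfSeries_zero]
  · have := d.pos
    rw [hP, PNat.add_coe, Nat.add_sub_assoc this]

/-- The terms of `hasSum_closedSeries` with both indices positive give `U`; by symmetry, those with
exactly one positive index give `V` twice. -/
theorem closedSeries_eq (hs : Summable (weight μ ξ)) (hz : PowerSeries.X ∣ z)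
    (hξ : ξ ^ 2 = z) (hP : ∀ n, P n = lampSeries φ μ ((n : ℕ) - 1)) :
    ∃ U V, HasSum (fun q : ℕ+ × ℕ+ => z ^ ((q.1 : ℕ) + q.2)
        * ((((q.1 : ℕ) + (q.2 : ℕ)).choose (q.1 : ℕ) : ℕ) : S⟦X⟧) * P (q.1 + q.2 + 1)
        * chainSeries z P q.2 * chainSeries z P q.1) U ∧
      HasSum (fun d : ℕ+ => z ^ (d : ℕ) * P (d + 1) * chainSeries z P d) V ∧
      closedSeries φ μ ξ = U + 2 * V + P 1 := by
  have h1 := hasSum_closedSeries φ hs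
  simp only [hξ] at h1
  have hU : Summable (fun q : ℕ+ × ℕ+ => z ^ ((q.1 : ℕ) + q.2)
        * ((((q.1 : ℕ) + (q.2 : ℕ)).choose (q.1 : ℕ) : ℕ) : S⟦X⟧) * P (q.1 + q.2 + 1)
        * chainSeries z P q.2 * chainSeries z P q.1) := by
    refine summable_of_X_pow_dvd (fun q => (q.1 : ℕ) + q.2) (fun n => ?_) fun q =>
      ((((pow_dvd_pow_of_dvd hz _).mul_right _).mul_right _).mul_right _).mul_right _
    refine ((finite_pnat_le n).prod (finite_pnat_le n)).subset fun q hq => ?_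
    simp only [Set.mem_ofPred_eq] at hq
    constructor <;> simp only [Set.mem_ofPred_eq] <;> omega
  have hV : Summable (fun d : ℕ+ => z ^ (d : ℕ) * P (d + 1) * chainSeries z P d) := by
    have := summable_pow_mul hz fun d => P (d + 1) * chainSeries z P d
    simpa only [mul_assoc] using this
  refine ⟨_, _, hU.hasSum, hV.hasSum, ?_⟩
  have hh := halfSeries_eq_chainSeries φ hs hz hξ hP
  have h0 := halfSeries_zero φ μ ξ
  rw [h1.eq_split (fun c => ?_) (hU.hasSum.congr_fun fun q => ?_) (hV.hasSum.congr_fun fun d => ?_)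
    (hV.hasSum.congr_fun fun d => ?_)]
  · simp only [hP, h0]
    simp
    ring
  · have := summable_pow_mul hz fun d : ℕ+ => z ^ c * ((c + (d : ℕ)).choose c : S⟦X⟧)
      * lampSeries φ μ (c + d) * halfSeries φ μ ξ d * halfSeries φ μ ξ c
    refine this.congr fun d => ?_
    ring
  · simp [hh, hP]
  · simp [hh, hP, h0]
  · simp [hh, hP, h0]

end Walk

/-! ### Counting with letters of several lengths -/

/-- Loops can be counted in any alphabet that is in bijection with `A ∪ A⁻¹`. -/
theorem loopCount_eq_ncard {Γ L : Type*} [Group Γ] {A : Set Γ} {ℓ : L → Γ}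
    (hinj : Function.Injective ℓ) (hrange : Set.range ℓ = A ∪ A⁻¹) (n : ℕ) :
    loopCount A n = {w : List L | (w.map ℓ).prod = 1 ∧ w.length = n}.ncard := by
  rw [loopCount, ← Set.ncard_image_of_injective _ (List.map_injective_iff.2 hinj)]
  congr 1
  ext w
  simp only [Set.mem_ofPred_eq, Set.mem_image, IsWordOver]
  constructor
  · rintro ⟨h1, h2, h3⟩
    rw [← hrange] at h2
    obtain ⟨w, rfl⟩ : w ∈ Set.range (List.map ℓ) := by rwa [Set.range_list_map]
    exact ⟨w, ⟨h3, by simpa using h1⟩, rfl⟩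
  · rintro ⟨w, ⟨h1, h2⟩, rfl⟩
    refine ⟨by simpa using h2, fun g hg => ?_, h1⟩
    obtain ⟨s, -, rfl⟩ := List.mem_map.1 hg
    rw [← hrange]
    exact ⟨s, rfl⟩

theorem hasSum_monomials_mul {X : Type*} (N : ℕ → ℕ) (p : X → Prop) [DecidablePred p] (d : X → ℕ)
    (h : ∀ n, {x | p x ∧ d x = n}.Finite) :
    HasSum (fun x => (N (d x) : ℕ⟦X⟧) * if p x then (PowerSeries.X : ℕ⟦X⟧) ^ d x else 0)
      (PowerSeries.mk fun n => N n * {x | p x ∧ d x = n}.ncard) := by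
  refine (PowerSeries.WithPiTopology.hasSum_iff_hasSum_coeff _).2 fun n => ?_
  have h1 := (PowerSeries.WithPiTopology.hasSum_iff_hasSum_coeff _).1 (hasSum_monomials p d h) n
  rw [PowerSeries.coeff_mk] at h1 ⊢
  refine (h1.mul_left (N n)).congr_fun fun x => ?_
  rw [← map_natCast (PowerSeries.C (R := ℕ)), PowerSeries.coeff_C_mul]
  by_cases hp : p x
  · by_cases hd : d x = n
    · simp [hp, hd]
    · simp [hp, PowerSeries.coeff_X_pow, Ne.symm hd]
  · simp [hp]

theorem hasSum_monomials₂_mul {X : Type*} (N : ℕ → ℕ) (p : X → Prop) [DecidablePred p]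
    (d e : X → ℕ) (h : ∀ n m, {x | p x ∧ d x = n ∧ e x = m}.Finite) :
    HasSum (fun x => (N (e x) : ℕ⟦X⟧⟦X⟧) *
        if p x then NavasBrin.x ^ d x * NavasBrin.y ^ e x else 0)
      (PowerSeries.mk fun m => PowerSeries.mk fun n =>
        N m * {x | p x ∧ d x = n ∧ e x = m}.ncard) := by
  refine (PowerSeries.WithPiTopology.hasSum_iff_hasSum_coeff _).2 fun m => ?_
  have h1 := (PowerSeries.WithPiTopology.hasSum_iff_hasSum_coeff _).1 (hasSum_monomials₂ p d e h) m
  have h2 := h1.mul_left (N m : ℕ⟦X⟧)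
  have e1 : (PowerSeries.coeff m) (PowerSeries.mk fun m => PowerSeries.mk fun n =>
      N m * {x | p x ∧ d x = n ∧ e x = m}.ncard) = (N m : ℕ⟦X⟧) * (PowerSeries.coeff m)
      (PowerSeries.mk fun m => PowerSeries.mk fun n => {x | p x ∧ d x = n ∧ e x = m}.ncard) := by
    ext n
    rw [← map_natCast (PowerSeries.C (R := ℕ)), PowerSeries.coeff_C_mul]
    simp
  rw [e1]
  refine h2.congr_fun fun x => ?_
  rw [← map_natCast (PowerSeries.C (R := ℕ⟦X⟧)), PowerSeries.coeff_C_mul]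
  by_cases hp : p x
  · by_cases hd : e x = m
    · simp [hp, hd]
    · have : PowerSeries.coeff m (NavasBrin.x ^ d x * NavasBrin.y ^ e x) = 0 := by
        rw [NavasBrin.x, NavasBrin.y, ← map_pow, PowerSeries.coeff_C_mul,
          PowerSeries.coeff_X_pow, if_neg (Ne.symm hd), mul_zero]
      simp [hp, this]
  · simp [hp]

namespace Walk

/-- A step is one of the two moves or given by a letter. -/
def stepEquivOption {α : Type*} : Step α ≃ Option (Option α) where
  toFun
    | .flat a => some (some a)
    | .up => none
    | .down => some none
  invFun
    | some (some a) => .flat a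
    | none => .up
    | some none => .down
  left_inv := by rintro (_ | _ | _) <;> rfl
  right_inv := by rintro (_ | _ | _) <;> rfl

instance finite_step {α : Type*} [Finite α] : Finite (Step α) := .of_equiv _ stepEquivOption.symm

theorem card_step {α : Type*} [Finite α] : Nat.card (Step α) = Nat.card α + 2 := by
  rw [Nat.card_congr stepEquivOption, Finite.card_option, Finite.card_option]

variable {α : Type u} {D : Type*} [Group D] (φ : α → D)

open Classical in
/-- The sum over closed walks may be extended by zero to all walks. -/
theorem closedSeries_eq_of_hasSum {R : Type v} [CommSemiring R] [TopologicalSpace R] [T2Space R]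
    {μ : α → R} {ξ F : R}
    (h : HasSum (fun w => if height w = 0 ∧ Balanced φ w then weight μ ξ w else 0) F) :
    closedSeries φ μ ξ = F := by
  rw [closedSeries, ← h.tsum_eq]
  refine (tsum_subtype {w : List (Step α) | height w = 0} (balWeight φ μ ξ)).trans
    (tsum_congr fun w => ?_)
  by_cases h1 : height w = 0 <;> by_cases h2 : Balanced φ w <;> simp [balWeight, h1, h2]

section degree

variable (deg : α → ℕ)

/-- The total length of a word whose letters have lengths. -/
def letterDeg (l : List α) : ℕ := (l.map deg).sum

@[simp] theorem letterDeg_nil : letterDeg deg [] = 0 := rfl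
@[simp] theorem letterDeg_cons (a : α) (l) : letterDeg deg (a :: l) = deg a + letterDeg deg l := by
  simp [letterDeg]

/-- The length of a step: moves of the cursor have length `1`. -/
def stepDeg : Step α → ℕ
  | .flat a => deg a
  | .up => 1
  | .down => 1

/-- The total length of a walk whose letters have lengths. -/
def walkDeg (w : List (Step α)) : ℕ := (w.map (stepDeg deg)).sum

@[simp] theorem walkDeg_nil : walkDeg deg [] = 0 := rfl
@[simp] theorem walkDeg_cons (s : Step α) (w) :
    walkDeg deg (s :: w) = stepDeg deg s + walkDeg deg w := by
  simp [walkDeg]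

/-- The weight of a letter of length `n` is `xⁿ y`: the variable `y` counts letters. -/
def degWeight (a : α) : ℕ⟦X⟧⟦X⟧ := NavasBrin.x ^ deg a * NavasBrin.y

theorem letterWeight_deg (l : List α) : letterWeight (degWeight deg) l
    = NavasBrin.x ^ letterDeg deg l * NavasBrin.y ^ l.length := by
  induction l with
  | nil => simp
  | cons a l ih => rw [letterWeight_cons, ih, letterDeg_cons, degWeight, List.length_cons]; ring

theorem weight_deg (w : List (Step α)) : weight (degWeight deg) (NavasBrin.x * NavasBrin.y) w
    = NavasBrin.x ^ walkDeg deg w * NavasBrin.y ^ w.length := by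
  induction w with
  | nil => simp
  | cons s w ih => cases s <;> simp [ih, degWeight, stepDeg] <;> ring

variable {deg}

theorem finite_walkDeg_le (hdeg : ∀ n, {a | deg a ≤ n}.Finite) (n m : ℕ) :
    {w : List (Step α) | walkDeg deg w ≤ n ∧ w.length = m}.Finite := by
  have hstep : {s : Step α | stepDeg deg s ≤ n}.Finite := by
    refine (((hdeg n).image Step.flat).union (Set.toFinite {.up, .down})).subset ?_
    rintro (a | _ | _) hs
    · exact .inl ⟨a, hs, rfl⟩
    · exact .inr (by simp)
    · exact .inr (by simp)
  induction m with
  | zero => exact (Set.finite_singleton []).subset fun w hw => by simpa using hw.2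
  | succ m ih =>
    refine (hstep.biUnion fun s _ => ih.image (List.cons s)).subset ?_
    rintro (_ | ⟨s, w⟩) ⟨h1, h2⟩
    · simp at h2
    · rw [walkDeg_cons] at h1
      exact Set.mem_biUnion (x := s) (by simp; omega) ⟨w, ⟨by omega, by simpa using h2⟩, rfl⟩

theorem letterDeg_eq_walkDeg (l : List α) : letterDeg deg l = walkDeg deg (l.map Step.flat) := by
  induction l with
  | nil => rfl
  | cons a l ih => simp [ih, stepDeg]

theorem finite_letterDeg_le (hdeg : ∀ n, {a | deg a ≤ n}.Finite) (n m : ℕ) :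
    {l : List α | letterDeg deg l ≤ n ∧ l.length = m}.Finite := by
  refine Set.Finite.of_finite_image (f := List.map Step.flat)
    ((finite_walkDeg_le hdeg n m).subset ?_)
    (List.map_injective_iff.2 fun a b h => by simpa using h).injOn
  rintro _ ⟨l, ⟨h1, h2⟩, rfl⟩
  exact ⟨by rwa [← letterDeg_eq_walkDeg], by simpa using h2⟩

theorem summable_weight_deg (hdeg : ∀ n, {a | deg a ≤ n}.Finite) :
    Summable (weight (degWeight deg) (NavasBrin.x * NavasBrin.y)) := by
  have h := hasSum_monomials₂ (fun _ : List (Step α) => True) (walkDeg deg) List.length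
    fun n m => (finite_walkDeg_le hdeg n m).subset fun w hw => ⟨hw.2.1.le, hw.2.2⟩
  refine h.summable.congr fun w => ?_
  simp [weight_deg]

variable (deg)

/-- The number of words with `k` letters and total length `n` that have trivial value. -/
def trivCount (k n : ℕ) : ℕ :=
  {l : List α | value φ l = 1 ∧ letterDeg deg l = n ∧ l.length = k}.ncard

/-- The number of balanced closed walks with `m` steps and total length `n`. -/
def closedCount (n m : ℕ) : ℕ :=
  {w : List (Step α) | (height w = 0 ∧ Balanced φ w) ∧ walkDeg deg w = n ∧ w.length = m}.ncard

variable {deg}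

theorem closedSeries_deg (hdeg : ∀ n, {a | deg a ≤ n}.Finite) :
    closedSeries φ (degWeight deg) (NavasBrin.x * NavasBrin.y)
      = PowerSeries.mk fun m => PowerSeries.mk fun n => closedCount φ deg n m := by
  classical
  refine closedSeries_eq_of_hasSum φ ?_
  have h := hasSum_monomials₂ (fun w : List (Step α) => height w = 0 ∧ Balanced φ w)
    (walkDeg deg) List.length
    fun n m => (finite_walkDeg_le hdeg n m).subset fun w hw => ⟨hw.2.1.le, hw.2.2⟩
  refine h.congr_fun fun w => ?_
  rw [weight_deg]

theorem lampSeries_deg (hdeg : ∀ n, {a | deg a ≤ n}.Finite) (n : ℕ) :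
    lampSeries φ (degWeight deg) n = PowerSeries.mk fun k => PowerSeries.mk fun i =>
      (k + n).choose n * trivCount φ deg k i := by
  classical
  have h := hasSum_monomials₂_mul (fun k => (k + n).choose n) (fun l : List α => value φ l = 1)
    (letterDeg deg) List.length
    fun n m => (finite_letterDeg_le hdeg n m).subset fun w hw => ⟨hw.2.1.le, hw.2.2⟩
  rw [lampSeries]
  refine Eq.trans (tsum_congr fun l => ?_) h.tsum_eq
  rw [trivWeight, letterWeight_deg]

theorem sq_xy : (NavasBrin.x * NavasBrin.y) ^ 2 = NavasBrin.x ^ 2 * NavasBrin.y ^ 2 := mul_pow _ _ _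

theorem X_dvd_xy : (PowerSeries.X : ℕ⟦X⟧⟦X⟧) ∣ NavasBrin.x ^ 2 * NavasBrin.y ^ 2 :=
  Dvd.dvd.mul_left (dvd_pow_self _ two_ne_zero) _

end degree

end Walk

/-! ### The wreath product with `ℤ` -/

namespace WreathZ

open Walk

variable {G : Type u} [Group G] (S : Set G)

/-- The letters of words over `S ∪ S⁻¹`. -/
abbrev Letter : Type u := {g : G // g ∈ S ∪ S⁻¹}

variable {S}

/-- The element of `G ≀ ℤ` that a step of a walk with letters in `S ∪ S⁻¹` stands for. -/
def ofStep : Step (Letter S) → WreathZ G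
  | .flat g => lamp g.1
  | .up => step G
  | .down => (step G)⁻¹

theorem lamp_inv (g : G) : lamp g⁻¹ = (lamp g)⁻¹ := by
  refine Subtype.ext (RegularWreathProduct.ext (funext fun x => ?_) ?_)
  · change (Pi.mulSingle 1 g⁻¹ : Multiplicative ℤ → G) x
      = ((Pi.mulSingle 1 g : Multiplicative ℤ → G) (1 * x))⁻¹
    rw [one_mul, Pi.mulSingle_inv]
    rfl
  · change (1 : Multiplicative ℤ) = 1⁻¹
    simp

theorem ofStep_right (s : Step (Letter S)) :
    (ofStep s).1.right = Multiplicative.ofAdd s.ht := by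
  cases s <;> rfl

theorem ofStep_injective : Function.Injective (ofStep (S := S)) := by
  intro s s' h
  have h1 : s.ht = s'.ht := by
    have := congrArg (fun g : WreathZ G => Multiplicative.toAdd g.1.right) h
    simpa only [ofStep_right, toAdd_ofAdd] using this
  cases s <;> cases s' <;> simp at h1 <;> try rfl
  rename_i a b
  have h2 := congrFun (congrArg (fun g : WreathZ G => g.1.left) h) 1
  have h3 : (a : G) = b := by
    simpa [ofStep, lamp] using h2
  rw [Subtype.ext h3]

theorem range_ofStep : Set.range (ofStep (S := S)) = gens S ∪ (gens S)⁻¹ := by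
  ext g
  constructor
  · rintro ⟨s | _ | _, rfl⟩
    · rcases s with ⟨g, hg | hg⟩
      · exact .inl (.inr ⟨g, hg, rfl⟩)
      · exact .inr (.inr ⟨g⁻¹, hg, lamp_inv g⟩)
    · exact .inl (.inl rfl)
    · exact .inr (.inl (inv_inv _))
  · rintro ((h | ⟨g, hg, rfl⟩) | (h | ⟨g', hg, h⟩))
    · exact ⟨.up, h.symm⟩
    · exact ⟨.flat ⟨g, .inl hg⟩, rfl⟩
    · exact ⟨.down, by rw [ofStep, ← (h : g⁻¹ = step G), inv_inv]⟩
    · refine ⟨.flat ⟨g'⁻¹, .inr (by simpa using hg)⟩, ?_⟩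
      rw [ofStep, lamp_inv, h, inv_inv]

/-- The lamp at position `j` shows the product of the letters written there. -/
theorem prod_ofStep (w : List (Step (Letter S))) :
    ((w.map ofStep).prod).1.right = Multiplicative.ofAdd (height w) ∧
    ∀ j : ℤ, ((w.map ofStep).prod).1.left (Multiplicative.ofAdd j)
      = value Subtype.val (lettersAt j w) := by
  induction w with
  | nil => exact ⟨rfl, fun _ => rfl⟩
  | cons s w ih =>
    obtain ⟨ih1, ih2⟩ := ih
    have hmul : ((s :: w).map ofStep).prod.1 = (ofStep s).1 * ((w.map ofStep).prod).1 := by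
      rw [List.map_cons, List.prod_cons]; rfl
    constructor
    · rw [hmul, RegularWreathProduct.mul_right, ih1, ofStep_right, height_cons, ofAdd_add]
    · intro j
      have h : ((s :: w).map ofStep).prod.1.left (Multiplicative.ofAdd j)
          = (ofStep s).1.left (Multiplicative.ofAdd j)
            * value Subtype.val (lettersAt (j - s.ht) w) := by
        rw [hmul, RegularWreathProduct.mul_left, ← ih2, ofStep_right]
        have e : (Multiplicative.ofAdd s.ht)⁻¹ * Multiplicative.ofAdd j
            = Multiplicative.ofAdd (j - s.ht) := by
          rw [← ofAdd_neg, ← ofAdd_add, neg_add_eq_sub]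
        rw [← e]
        rfl
      rw [h]
      cases s with
      | flat a =>
        by_cases hj : j = 0
        · subst hj
          simp [ofStep, lamp]
        · simp [ofStep, lamp, hj]
      | up => simp [ofStep, step]
      | down =>
        have : ((step G)⁻¹ : WreathZ G).1.left (Multiplicative.ofAdd j) = 1 := by
          change ((1 : Multiplicative ℤ → G) _)⁻¹ = 1
          simp
        rw [ofStep, this]
        simp

/-- The loops in `G ≀ ℤ` are the closed walks that are balanced. -/
theorem prod_ofStep_eq_one (w : List (Step (Letter S))) :
    (w.map ofStep).prod = 1 ↔ height w = 0 ∧ Balanced Subtype.val w := by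
  obtain ⟨h1, h2⟩ := prod_ofStep w
  constructor
  · intro h
    rw [h] at h1 h2
    exact ⟨(Multiplicative.ofAdd.injective h1).symm, fun j => (h2 j).symm⟩
  · rintro ⟨h3, h4⟩
    refine Subtype.ext (RegularWreathProduct.ext (funext fun x => ?_) ?_)
    · exact (h2 x.toAdd).trans (h4 x.toAdd)
    · rw [h1, h3]; rfl

theorem loopCount_gens (n : ℕ) : loopCount (gens S) n =
    {w : List (Step (Letter S)) | (height w = 0 ∧ Balanced Subtype.val w) ∧ w.length = n}.ncard := by
  simp only [loopCount_eq_ncard ofStep_injective range_ofStep, prod_ofStep_eq_one]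

theorem loopCount_base (n : ℕ) : loopCount S n =
    {l : List (Letter S) | value Subtype.val l = 1 ∧ l.length = n}.ncard :=
  loopCount_eq_ncard Subtype.val_injective Subtype.range_coe n

theorem weight_X {α : Type*} (w : List (Step α)) :
    weight (fun _ => (PowerSeries.X : ℕ⟦X⟧)) PowerSeries.X w = PowerSeries.X ^ w.length := by
  induction w with
  | nil => simp
  | cons s w ih => cases s <;> simp [ih, pow_succ, mul_comm]

theorem letterWeight_X {α : Type*} (l : List α) :
    letterWeight (fun _ => (PowerSeries.X : ℕ⟦X⟧)) l = PowerSeries.X ^ l.length := by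
  simp [letterWeight]

variable [hS : Finite (Letter S)]

theorem finite_words {L : Type*} [Finite L] (p : List L → Prop) (n : ℕ) :
    {w : List L | p w ∧ w.length = n}.Finite :=
  (List.finite_length_eq L n).subset fun _ h => h.2

theorem summable_weight_X :
    Summable (weight (fun _ : Letter S => (PowerSeries.X : ℕ⟦X⟧)) PowerSeries.X) := by
  have h := hasSum_monomials (fun _ : List (Step (Letter S)) => True) List.length
    fun n => finite_words _ n
  refine h.summable.congr fun w => ?_
  simp [weight_X]

variable (S)

theorem loopSeries_gens : loopSeries (gens S)
    = closedSeries (Subtype.val : Letter S → G) (fun _ => PowerSeries.X) PowerSeries.X := by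
  classical
  symm
  refine closedSeries_eq_of_hasSum _ ?_
  have h := hasSum_monomials
    (fun w : List (Step (Letter S)) => height w = 0 ∧ Balanced Subtype.val w) List.length
    fun n => finite_words _ n
  simp only [← loopCount_gens] at h
  refine h.congr_fun fun w => ?_
  rw [weight_X]

/-- The index shift: `P_n` counts words cut into `n` pieces, `lampSeries n` those cut into
`n + 1` pieces. -/
theorem serP_eq_lampSeries (n : ℕ+) : serP S n
    = lampSeries (Subtype.val : Letter S → G) (fun _ => PowerSeries.X) ((n : ℕ) - 1) := by
  classical
  have h := hasSum_monomials_mul (fun j => (j + ((n : ℕ) - 1)).choose ((n : ℕ) - 1))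
    (fun l : List (Letter S) => value Subtype.val l = 1) List.length
    fun n => finite_words _ n
  simp only [← loopCount_base] at h
  have h1 : serP S n = PowerSeries.mk fun j =>
      (j + ((n : ℕ) - 1)).choose ((n : ℕ) - 1) * loopCount S j := by
    rw [serP, tupleSeries]
    simp only [Nat.add_sub_assoc n.pos]
  rw [h1, ← h.tsum_eq, lampSeries]
  refine tsum_congr fun l => ?_
  rw [trivWeight, letterWeight_X]

/-- The system of equations for the cogrowth series of `G ≀ ℤ`. -/
theorem equations :
    (∀ d : ℕ+, Summable (chainTerm (PowerSeries.X ^ 2) (serP S) d)) ∧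
    (∃ U V : ℕ⟦X⟧,
      HasSum (fun q : ℕ+ × ℕ+ =>
        PowerSeries.X ^ (2 * (q.1 : ℕ) + 2 * (q.2 : ℕ))
          * ((((q.1 : ℕ) + (q.2 : ℕ)).choose (q.1 : ℕ) : ℕ) : ℕ⟦X⟧)
          * serP S (q.1 + q.2 + 1)
          * serOmega S q.2 * serOmega S q.1) U ∧
      HasSum (fun d : ℕ+ =>
        PowerSeries.X ^ (2 * (d : ℕ)) * serP S (d + 1) * serOmega S d) V ∧
      loopSeries (gens S) = U + 2 * V + serP S 1) ∧
    (∀ d : ℕ+, ∃ R : ℕ⟦X⟧,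
      HasSum (fun b : ℕ+ =>
        PowerSeries.X ^ (2 * (b : ℕ))
          * ((((b : ℕ) + (d : ℕ) - 1).choose ((d : ℕ) - 1) : ℕ) : ℕ⟦X⟧)
          * serP S (b + d) * serOmega S b) R ∧
      serOmega S d = serP S d + R) := by
  have hz : (PowerSeries.X : ℕ⟦X⟧) ∣ PowerSeries.X ^ 2 := dvd_pow_self _ two_ne_zero
  have h := closedSeries_eq (Subtype.val : Letter S → G) summable_weight_X hz rfl
    (serP_eq_lampSeries S)
  simp only [← loopSeries_gens, ← pow_mul, mul_add] at h
  refine ⟨summable_chainTerm hz _, h, fun d => ?_⟩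
  have h2 := hasSum_chain hz (serP S) d
  simp only [← pow_mul] at h2
  exact h2

end WreathZ

/-! ### Words in the Navas–Brin group -/

namespace NavasBrin

open Walk (Step Dyck asm NonNeg IsDyck lettersAt Balanced value)

/-- The generator, or inverse of a generator, that a step of a walk with letters `a^{±1}`
stands for: up and down are `t` and `t⁻¹`. -/
def ofStep : Step Bool → NavasBrin
  | .flat b => if b then a else a⁻¹
  | .up => t
  | .down => t⁻¹

/-- The permutation of `ℤ → ℤ` by which a step acts; `t` acts as the shift. -/
def permOfStep : Step Bool → Equiv.Perm (ℤ → ℤ)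
  | .flat b => if b then towerGen 0 else (towerGen 0)⁻¹
  | .up => coordShift
  | .down => coordShift⁻¹

/-- The permutation by which a word acts. -/
def permOf (w : List (Step Bool)) : Equiv.Perm (ℤ → ℤ) := (w.map permOfStep).prod

@[simp] theorem permOf_nil : permOf [] = 1 := rfl
@[simp] theorem permOf_cons (s : Step Bool) (w) : permOf (s :: w) = permOfStep s * permOf w := by
  simp [permOf]
@[simp] theorem permOf_append (u w : List (Step Bool)) :
    permOf (u ++ w) = permOf u * permOf w := by
  simp [permOf]

/-- The action of the Navas–Brin group on `ℤ → ℤ`, with `t` acting as the shift. -/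
def toPerm : NavasBrin →* Equiv.Perm (ℤ → ℤ) :=
  SemidirectProduct.lift InfWreath.subtype (zpowersHom _ coordShift) (by
    intro g
    ext1 n
    simp only [MonoidHom.comp_apply, MulEquiv.coe_toMonoidHom, MulAut.conj_apply,
      Subgroup.coe_subtype]
    rfl)

theorem toPerm_ofStep (s : Step Bool) : toPerm (ofStep s) = permOfStep s := by
  have ha : toPerm a = towerGen 0 := by simp [toPerm, a]
  have ht : toPerm t = coordShift := by simp [toPerm, t]
  rcases s with (_ | _) | _ | _ <;> simp [ofStep, permOfStep, ha, ht]

theorem toPerm_prod (w : List (Step Bool)) : toPerm (w.map ofStep).prod = permOf w := by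
  rw [map_list_prod, List.map_map, permOf]
  congr 2
  funext s
  exact toPerm_ofStep s

theorem ofStep_right (s : Step Bool) : (ofStep s).right = Multiplicative.ofAdd s.ht := by
  rcases s with (_ | _) | _ | _ <;> simp [ofStep, a, t]

theorem height_map (w : List (Step Bool)) : height (w.map ofStep) = Walk.height w := by
  induction w with
  | nil => rfl
  | cons s w ih =>
    rw [height] at ih ⊢
    rw [List.map_cons, List.prod_cons, SemidirectProduct.mul_right, toAdd_mul, ih, ofStep_right]
    simp

/-- An element of the semidirect product is trivial iff its image in `ℤ` and its action are. -/
theorem prod_eq_one_iff (w : List (Step Bool)) :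
    (w.map ofStep).prod = 1 ↔ Walk.height w = 0 ∧ permOf w = 1 := by
  rw [← height_map, ← toPerm_prod, height]
  constructor
  · intro h; simp [h]
  · rintro ⟨h1, h2⟩
    have h3 : (w.map ofStep).prod.right = 1 := h1
    have h4 : (w.map ofStep).prod = SemidirectProduct.inl (w.map ofStep).prod.left := by
      ext1 <;> simp [h3]
    rw [h4, toPerm, SemidirectProduct.lift_inl] at h2
    rw [h4, show (w.map ofStep).prod.left = 1 from Subtype.ext h2, map_one]

theorem towerGen_apply_of_zero {i : ℤ} {f : ℤ → ℤ} (h : ∀ j < i, f j = 0) :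
    towerGen i f = Function.update f i (f i + 1) := if_pos h

theorem towerGen_inv_apply_of_zero {i : ℤ} {f : ℤ → ℤ} (h : ∀ j < i, f j = 0) :
    (towerGen i)⁻¹ f = Function.update f i (f i - 1) := if_pos h

theorem towerGen_zero_ne_inv : towerGen 0 ≠ (towerGen 0)⁻¹ := by
  intro h
  have h1 := congrFun (congrArg (fun g : Equiv.Perm (ℤ → ℤ) => g 0) h) 0
  rw [towerGen_apply_of_zero (by simp), towerGen_inv_apply_of_zero (by simp)] at h1
  simp at h1

theorem a_ne_inv : a ≠ a⁻¹ := by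
  intro h
  have := congrArg toPerm h
  rw [map_inv, show toPerm a = towerGen 0 from toPerm_ofStep (.flat true)] at this
  exact towerGen_zero_ne_inv this

theorem ofStep_injective : Function.Injective ofStep := by
  intro s s' h
  have h1 : s.ht = s'.ht := by
    have := congrArg (fun g : NavasBrin => Multiplicative.toAdd g.right) h
    simpa only [ofStep_right, toAdd_ofAdd] using this
  cases s <;> cases s' <;> simp at h1 <;> try rfl
  rename_i b b'
  have h2 := a_ne_inv
  cases b <;> cases b' <;> simp [ofStep] at h ⊢
  · exact h2 h.symm
  · exact h2 h

theorem range_ofStep : Set.range ofStep = {a, t} ∪ ({a, t} : Set NavasBrin)⁻¹ := by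
  ext g
  constructor
  · rintro ⟨(_ | _) | _ | _, rfl⟩ <;> simp [ofStep]
  · rintro ((rfl | rfl) | (h | h))
    · exact ⟨.flat true, rfl⟩
    · exact ⟨.up, rfl⟩
    · exact ⟨.flat false, by simp only [ofStep]; rw [← (h : g⁻¹ = a)]; simp⟩
    · exact ⟨.down, by simp only [ofStep]; rw [← (h : g⁻¹ = t)]; simp⟩

theorem isWord_iff (w : List NavasBrin) : IsWord w ↔ ∃ u : List (Step Bool), u.map ofStep = w := by
  change _ ↔ w ∈ Set.range (List.map ofStep)
  rw [Set.range_list_map, range_ofStep]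
  rfl

theorem _root_.Walk.nonNeg_iff_take {α : Type*} {h : ℤ} (h0 : 0 ≤ h) (w : List (Step α)) :
    NonNeg h w ↔ ∀ i ≤ w.length, 0 ≤ h + Walk.height (w.take i) := by
  induction w generalizing h with
  | nil => simpa
  | cons s w ih =>
    constructor
    · rintro ⟨h1, h2⟩ (_ | i) hi
      · simpa
      · simpa [add_assoc] using (ih h1).1 h2 i (by simpa using hi)
    · intro H
      have h1 : 0 ≤ h + s.ht := by simpa using H 1 (by simp)
      refine ⟨h1, (ih h1).2 fun i hi => ?_⟩
      simpa [add_assoc] using H (i + 1) (by simpa using hi)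

theorem neverBelow_map_iff (w : List (Step Bool)) : NeverBelow (w.map ofStep) ↔ NonNeg 0 w := by
  rw [Walk.nonNeg_iff_take le_rfl, NeverBelow]
  simp only [← List.map_take, height_map, List.length_map, zero_add]

/-- The number of steps of a walk, started at height `h`, that end at height `0`. -/
def zeroCount : ℤ → List (Step Bool) → ℕ
  | _, [] => 0
  | h, s :: w => (if h + s.ht = 0 then 1 else 0) + zeroCount (h + s.ht) w

theorem zeroCount_eq_sum (h : ℤ) (w : List (Step Bool)) : zeroCount h w =
    ∑ i ∈ Finset.range w.length, if h + Walk.height (w.take (i + 1)) = 0 then 1 else 0 := by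
  induction w generalizing h with
  | nil => rfl
  | cons s w ih =>
    rw [List.length_cons, Finset.sum_range_succ', zeroCount, ih, add_comm]
    simp [add_assoc]

theorem zeroSteps_map (w : List (Step Bool)) : zeroSteps (w.map ofStep) = zeroCount 0 w := by
  rw [zeroCount_eq_sum, zeroSteps, ← Finset.card_filter, ← Set.ncard_coe_finset]
  congr 1
  ext i
  simp [← List.map_take, height_map]

theorem zeroCount_append (h : ℤ) (u w : List (Step Bool)) :
    zeroCount h (u ++ w) = zeroCount h u + zeroCount (h + Walk.height u) w := by
  induction u generalizing h with
  | nil => simp [zeroCount]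
  | cons s u ih => simp [zeroCount, ih, add_assoc]

theorem zeroCount_eq_zero {h : ℤ} {w : List (Step Bool)} (hw : NonNeg h w) :
    zeroCount (h + 1) w = 0 := by
  induction w generalizing h with
  | nil => rfl
  | cons s w ih =>
    rw [zeroCount, if_neg (by have := hw.1; omega), add_right_comm, ih hw.2]

/-- A step ends at height `0` iff it is a letter at height `0` or the last step of an excursion. -/
theorem zeroCount_asm (τ : List (Bool ⊕ Dyck Bool)) : zeroCount 0 (asm τ) = τ.length := by
  induction τ with
  | nil => rfl
  | cons s τ ih =>
    cases s with
    | inl b => simp [zeroCount, ih, add_comm]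
    | inr v =>
      simp [zeroCount, zeroCount_append, v.2.2, ih, add_comm]
      simpa using zeroCount_eq_zero v.2.1

/-- The walk, started at height `h`, has no flat step at height `0`. -/
def FlatFree : ℤ → List (Step Bool) → Prop
  | _, [] => True
  | h, s :: w => ((∃ b, s = .flat b) → h ≠ 0) ∧ FlatFree (h + s.ht) w

theorem ofStep_eq_a_iff (s : Step Bool) :
    (ofStep s = a ∨ ofStep s = a⁻¹) ↔ ∃ b, s = .flat b := by
  constructor
  · rintro (h | h)
    · exact ⟨true, ofStep_injective h⟩
    · exact ⟨false, ofStep_injective h⟩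
  · rintro ⟨_ | _, rfl⟩ <;> simp [ofStep]

theorem noFlatStep_map_iff (w : List (Step Bool)) :
    NoFlatStep (w.map ofStep) ↔ FlatFree 0 w := by
  have key : ∀ h : ℤ, (∀ (i : ℕ) (hi : i < w.length), (∃ b, w[i] = .flat b) →
      h + Walk.height (w.take (i + 1)) ≠ 0) ↔ FlatFree h w := by
    induction w with
    | nil => intro h; simp [FlatFree]
    | cons s w ih =>
      intro h
      rw [FlatFree, ← ih]
      constructor
      · intro H
        refine ⟨?_, fun i hi hb => ?_⟩
        · rintro ⟨b, rfl⟩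
          simpa using H 0 (by simp) ⟨b, rfl⟩
        · simpa [add_assoc] using H (i + 1) (by simpa using hi) (by simpa using hb)
      · rintro ⟨h1, h2⟩ (_ | i) hi hb
        · obtain ⟨b, hb⟩ := hb
          simp only [List.getElem_cons_zero] at hb
          simpa [hb] using h1 ⟨b, hb⟩
        · simpa [add_assoc] using h2 i (by simpa using hi) (by simpa using hb)
  rw [← key 0, NoFlatStep]
  simp only [← List.map_take, height_map, List.length_map, zero_add, List.getElem_map,
    ofStep_eq_a_iff]

theorem flatFree_append (h : ℤ) (u w : List (Step Bool)) :
    FlatFree h (u ++ w) ↔ FlatFree h u ∧ FlatFree (h + Walk.height u) w := by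
  induction u generalizing h with
  | nil => simp [FlatFree]
  | cons s u ih => simp [FlatFree, ih, and_assoc, add_assoc]

theorem flatFree_of_nonNeg {h : ℤ} (h0 : 0 ≤ h) {w : List (Step Bool)} (hw : NonNeg h w) :
    FlatFree (h + 1) w := by
  induction w generalizing h with
  | nil => trivial
  | cons s w ih =>
    refine ⟨fun _ => by omega, ?_⟩
    rw [add_right_comm]
    exact ih hw.1 hw.2

theorem flatFree_asm_iff (τ : List (Bool ⊕ Dyck Bool)) :
    FlatFree 0 (asm τ) ↔ ∃ l : List (Dyck Bool), τ = l.map Sum.inr := by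
  induction τ with
  | nil => exact ⟨fun _ => ⟨[], rfl⟩, fun _ => trivial⟩
  | cons s τ ih =>
    cases s with
    | inl b =>
      refine ⟨fun h => (h.1 ⟨b, rfl⟩ rfl).elim, ?_⟩
      rintro ⟨_ | _, h⟩ <;> simp at h
    | inr v =>
      have h1 : FlatFree 1 v.1 := by simpa using flatFree_of_nonNeg le_rfl v.2.1
      have h2 : FlatFree 0 (asm (.inr v :: τ)) ↔ FlatFree 0 (asm τ) := by
        simp [FlatFree, flatFree_append, v.2.2, h1]
      rw [h2, ih]
      constructor
      · rintro ⟨l, rfl⟩; exact ⟨v :: l, rfl⟩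
      · rintro ⟨_ | ⟨v', l⟩, h⟩
        · simp at h
        · exact ⟨l, by simpa using (List.cons.inj h).2⟩

/-! ### Excursions act as lamps -/

/-- The permutations that fix all sequences with a nonzero coordinate before `c` and leave all
coordinates before `c` unchanged. -/
def tailSubgroup (c : ℤ) : Subgroup (Equiv.Perm (ℤ → ℤ)) where
  carrier := {g | (∀ f, (∃ i < c, f i ≠ 0) → g f = f) ∧ ∀ f, ∀ i < c, g f i = f i}
  one_mem' := by simp
  mul_mem' := by
    rintro g h ⟨hg1, hg2⟩ ⟨hh1, hh2⟩
    refine ⟨fun f hf => ?_, fun f i hi => ?_⟩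
    · rw [Equiv.Perm.mul_apply, hh1 f hf, hg1 f hf]
    · rw [Equiv.Perm.mul_apply, hg2 _ i hi, hh2 f i hi]
  inv_mem' := by
    rintro g ⟨hg1, hg2⟩
    refine ⟨fun f hf => ?_, fun f i hi => ?_⟩
    · rw [Equiv.Perm.inv_eq_iff_eq, hg1 f hf]
    · have h := hg2 (g⁻¹ f) i hi
      rw [show g (g⁻¹ f) = f from g.apply_symm_apply f] at h
      exact h.symm

theorem tailSubgroup_anti {c d : ℤ} (h : c ≤ d) : tailSubgroup d ≤ tailSubgroup c := by
  rintro g ⟨h1, h2⟩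
  exact ⟨fun f ⟨i, hi, hf⟩ => h1 f ⟨i, by omega, hf⟩, fun f i hi => h2 f i (by omega)⟩

theorem towerGen_mem (i : ℤ) : towerGen i ∈ tailSubgroup i := by
  refine ⟨fun f ⟨j, hj, hf⟩ => if_neg fun h => hf (h j hj), fun f j hj => ?_⟩
  by_cases h : ∀ j < i, f j = 0
  · rw [towerGen_apply_of_zero h, Function.update_of_ne hj.ne]
  · exact congrFun (if_neg h) j

theorem shift_conj_mem {c : ℤ} {g : Equiv.Perm (ℤ → ℤ)} (hg : g ∈ tailSubgroup c) :
    coordShift * g * coordShift⁻¹ ∈ tailSubgroup (c + 1) := by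
  have hs : ∀ f : ℤ → ℤ, ∀ i, (coordShift⁻¹ f) i = f (i + 1) := fun _ _ => rfl
  have hs' : ∀ f : ℤ → ℤ, ∀ i, (coordShift f) i = f (i - 1) := fun _ _ => rfl
  refine ⟨fun f ⟨j, hj, hf⟩ => ?_, fun f j hj => ?_⟩
  · rw [Equiv.Perm.mul_apply, Equiv.Perm.mul_apply,
      hg.1 _ ⟨j - 1, by omega, by rwa [hs, sub_add_cancel]⟩]
    exact coordShift.apply_symm_apply f
  · rw [Equiv.Perm.mul_apply, Equiv.Perm.mul_apply, hs', hg.2 _ _ (by omega), hs, sub_add_cancel]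

theorem shift_zpow_conj (i : ℤ) :
    coordShift ^ i * towerGen 0 * (coordShift ^ i)⁻¹ = towerGen i := by
  induction i using Int.induction_on with
  | zero => simp
  | succ n ih =>
    have h : coordShift ^ ((n : ℤ) + 1) = coordShift * coordShift ^ (n : ℤ) := by
      rw [add_comm, zpow_one_add]
    rw [← coordShift_conj, ← ih, h]
    group
  | pred n ih =>
    have h := coordShift_conj (-n - 1)
    rw [sub_add_cancel, ← ih, mul_inv_eq_iff_eq_mul] at h
    have h2 : towerGen (-n - 1) = coordShift⁻¹ * (coordShift ^ (-n : ℤ) * towerGen 0 *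
      (coordShift ^ (-n : ℤ))⁻¹) * coordShift := by
      rw [mul_assoc, ← h]; group
    rw [h2, sub_eq_neg_add, zpow_add, zpow_neg_one]
    group

/-- A letter `a` at height `h ≥ 0` acts as `a_h`, which fixes all coordinates before `0`. -/
theorem permOf_mem_of_nonNeg {h : ℤ} (h0 : 0 ≤ h) {w : List (Step Bool)} (hw : NonNeg h w) :
    coordShift ^ h * permOf w * (coordShift ^ (h + Walk.height w))⁻¹ ∈ tailSubgroup 0 := by
  induction w generalizing h with
  | nil => simp [one_mem]
  | cons s w ih =>
    have h1 := ih hw.1 hw.2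
    rw [permOf_cons, Walk.height_cons, ← add_assoc]
    cases s with
    | flat b =>
      have h2 : coordShift ^ h * permOfStep (.flat b) * (coordShift ^ h)⁻¹ ∈ tailSubgroup 0 := by
        have h3 := tailSubgroup_anti h0 (towerGen_mem h)
        rw [← shift_zpow_conj] at h3
        cases b
        · have h4 := inv_mem h3
          rw [mul_inv_rev, mul_inv_rev, inv_inv, ← mul_assoc] at h4
          exact h4
        · exact h3
      have h5 := mul_mem h2 h1
      simp only [Step.ht, add_zero] at h5 ⊢
      convert h5 using 1
      group
    | up =>
      convert h1 using 1
      rw [show h + (Step.up : Step Bool).ht = h + 1 from rfl, zpow_add_one]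
      simp [permOfStep, mul_assoc]
    | down =>
      convert h1 using 1
      rw [show h + (Step.down : Step Bool).ht = h - 1 from rfl, zpow_sub_one]
      simp [permOfStep, mul_assoc]

/-- The element `t v t⁻¹` of the infinite wreath product given by an excursion `v`. -/
def lamp (v : Dyck Bool) : Equiv.Perm (ℤ → ℤ) := coordShift * permOf v.1 * coordShift⁻¹

theorem permOf_dyck_mem {w : List (Step Bool)} (hw : IsDyck w) : permOf w ∈ tailSubgroup 0 := by
  simpa [hw.2] using permOf_mem_of_nonNeg le_rfl hw.1

theorem lamp_mem (v : Dyck Bool) : lamp v ∈ tailSubgroup 1 :=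
  shift_conj_mem (permOf_dyck_mem v.2)

theorem value_lamp_mem (l : List (Dyck Bool)) : value lamp l ∈ tailSubgroup 1 := by
  induction l with
  | nil => exact one_mem _
  | cons v l ih => rw [Walk.value_cons]; exact mul_mem (lamp_mem v) ih

theorem value_lamp (l : List (Dyck Bool)) :
    value lamp l = coordShift * permOf (Walk.join l) * coordShift⁻¹ := by
  induction l with
  | nil => simp
  | cons v l ih => rw [Walk.value_cons, ih, lamp, Walk.join_cons, permOf_append]; group

/-- The action of a step of the outer walk, whose cursor is moved by `a` and whose letters are
excursions. -/
def outerStep : Step (Dyck Bool) → Equiv.Perm (ℤ → ℤ)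
  | .flat v => lamp v
  | .up => towerGen 0
  | .down => (towerGen 0)⁻¹

/-- `a` moves the cursor, recorded by coordinate `0`, and excursions act on the higher coordinates
when the cursor is at `0`. -/
theorem outerStep_prod_apply (W : List (Step (Dyck Bool))) (p : ℤ → ℤ) (hp : ∀ i ≤ 0, p i = 0)
    (n : ℤ) : (W.map outerStep).prod (Function.update p 0 n)
      = Function.update (value lamp (lettersAt (n + Walk.height W) W) p) 0 (n + Walk.height W) := by
  induction W with
  | nil => simp
  | cons s W ih =>
    rw [List.map_cons, List.prod_cons, Equiv.Perm.mul_apply, ih]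
    have hv : ∀ j, ∀ i ≤ 0, value lamp (lettersAt j W) p i = 0 := fun j i hi => by
      rw [(value_lamp_mem _).2 p i (by omega), hp i hi]
    have hz : ∀ j m, ∀ i < 0, Function.update (value lamp (lettersAt j W) p) 0 m i = 0 :=
      fun j m i hi => by rw [Function.update_of_ne hi.ne, hv j i hi.le]
    cases s with
    | flat v =>
      rw [Walk.height_cons, Step.ht, zero_add, Walk.lettersAt_flat, outerStep]
      by_cases h : n + Walk.height W = 0
      · have e : ∀ q : ℤ → ℤ, q 0 = 0 → Function.update q 0 0 = q := fun q hq => by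
          rw [Function.update_eq_self_iff, hq]
        rw [h, if_pos rfl, Walk.value_cons, Equiv.Perm.mul_apply, e _ (hv 0 0 le_rfl), e]
        rw [(lamp_mem v).2 _ 0 one_pos, hv 0 0 le_rfl]
      · rw [if_neg h, (lamp_mem v).1 _ ⟨0, one_pos, by simpa using h⟩]
    | up =>
      have e1 : n + (1 + Walk.height W) = n + Walk.height W + 1 := by ring
      rw [outerStep, towerGen_apply_of_zero (hz _ _), Walk.height_cons, Step.ht, Walk.lettersAt_up,
        e1, add_sub_cancel_right, Function.update_self, Function.update_idem]
    | down =>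
      have e1 : n + (-1 + Walk.height W) = n + Walk.height W - 1 := by ring
      rw [outerStep, towerGen_inv_apply_of_zero (hz _ _), Walk.height_cons, Step.ht,
        Walk.lettersAt_down, e1, sub_add_cancel, Function.update_self, Function.update_idem]

theorem outerStep_prod_mem (W : List (Step (Dyck Bool))) :
    (W.map outerStep).prod ∈ tailSubgroup 0 := by
  induction W with
  | nil => exact one_mem _
  | cons s W ih =>
    rw [List.map_cons, List.prod_cons]
    refine mul_mem ?_ ih
    cases s with
    | flat v => exact tailSubgroup_anti zero_le_one (lamp_mem v)
    | up => exact towerGen_mem 0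
    | down => exact inv_mem (towerGen_mem 0)

/-- A word that never goes below `0` acts trivially iff the cursor, recorded by coordinate `0`,
returns and at each of its positions the product of the excursions is trivial. -/
theorem outerStep_prod_eq_one (W : List (Step (Dyck Bool))) :
    (W.map outerStep).prod = 1 ↔ Walk.height W = 0 ∧ Balanced lamp W := by
  constructor
  · intro h
    have h1 := outerStep_prod_apply W
    rw [h] at h1
    have h0 : Walk.height W = 0 := by
      have := congrFun (h1 0 (by simp) 0) 0
      simpa using this.symm
    refine ⟨h0, fun j => ?_⟩
    ext1 f
    by_cases hf : ∀ i ≤ 0, f i = 0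
    · have h2 := h1 f hf j
      rw [h0, add_zero] at h2
      funext i
      by_cases hi : i = 0
      · subst hi
        exact (value_lamp_mem _).2 f 0 one_pos
      · have := congrFun h2 i
        simpa [Function.update_of_ne hi] using this.symm
    · push Not at hf
      obtain ⟨i, hi, hf⟩ := hf
      exact (value_lamp_mem _).1 f ⟨i, by omega, hf⟩
  · rintro ⟨h0, h1⟩
    ext1 f
    by_cases hf : ∀ i < 0, f i = 0
    · have h2 := outerStep_prod_apply W (Function.update f 0 0) (fun i hi => by
        by_cases h : i = 0
        · simp [h]
        · rw [Function.update_of_ne h, hf i (by omega)]) (f 0)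
      rw [h1, h0] at h2
      simpa using h2
    · push Not at hf
      exact (outerStep_prod_mem W).1 f hf

end NavasBrin

/-! ### The generating functions of the Navas–Brin group -/

theorem ncard_cuts_succ {X : Type*} (n m : ℕ) {T : Set (List X)} (hT : T.Finite)
    (hm : ∀ l ∈ T, l.length = m) :
    {ws : Fin (n + 1) → List X | (List.ofFn ws).flatten ∈ T}.ncard
      = (m + n).choose n * T.ncard := by
  classical
  have hN : ∀ τ : List X, ((fun ws : Fin (n + 1) → List X => (List.ofFn ws).flatten) ⁻¹' {τ}).encard
      = ((τ.length + n).choose n : ℕ) := fun τ => by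
    rw [← List.encard_cuts n τ, ← List.ofFn_injective.encard_image]
    congr 1
    ext ws
    constructor
    · rintro ⟨ws, h, rfl⟩
      exact ⟨List.length_ofFn, h⟩
    · rintro ⟨h1, h2⟩
      have h3 : List.ofFn (fun i : Fin (n + 1) => ws.get (i.cast h1.symm)) = ws := by
        refine List.ext_getElem (by simp [h1]) fun i _ _ => by rw [List.getElem_ofFn]; rfl
      exact ⟨_, by rw [Set.mem_preimage, h3]; exact h2, h3⟩
  have hfin : {ws : Fin (n + 1) → List X | (List.ofFn ws).flatten ∈ T}.Finite :=
    hT.preimage' fun τ _ => Set.finite_of_encard_eq_coe (hN τ)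
  have h1 := HasSum.of_fibres (g := fun τ => if τ ∈ T then 1 else 0) hN
    (hasSum_ite_ncard (fun ws : Fin (n + 1) → List X => (List.ofFn ws).flatten ∈ T) hfin)
  have h2 := (hasSum_ite_ncard (fun τ => τ ∈ T) hT).mul_left ((m + n).choose n)
  refine h1.unique (h2.congr_fun fun τ => ?_)
  by_cases h : τ ∈ T
  · simp [h, hm τ h]
  · simp [h]

/-- Cutting the members of a finite set of lists of length `m` into `n` pieces. -/
theorem ncard_cuts {X : Type*} {n : ℕ} (hn : 0 < n) (m : ℕ) {T : Set (List X)} (hT : T.Finite)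
    (hm : ∀ l ∈ T, l.length = m) :
    {ws : Fin n → List X | (List.ofFn ws).flatten ∈ T}.ncard
      = (m + (n - 1)).choose (n - 1) * T.ncard := by
  cases n with
  | zero => simp at hn
  | succ n => exact ncard_cuts_succ n m hT hm

namespace NavasBrin

open Walk (Step Dyck asm NonNeg IsDyck lettersAt Balanced value letterDeg walkDeg trivCount
  closedCount)

/-- The steps of the outer walk are the letters `a^{±1}` and the excursions. -/
def tokEquiv : Step (Dyck Bool) ≃ Bool ⊕ Dyck Bool where
  toFun
    | .flat v => .inr v
    | .up => .inl true
    | .down => .inl false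
  invFun
    | .inl true => .up
    | .inl false => .down
    | .inr v => .flat v
  left_inv s := by cases s <;> rfl
  right_inv s := by rcases s with (_ | _) | _ <;> rfl

/-- The length of the excursion `t v t⁻¹`. -/
def excDeg (v : Dyck Bool) : ℕ := v.1.length + 2

/-- The word described by an outer walk. -/
def expand (W : List (Step (Dyck Bool))) : List (Step Bool) := asm (W.map tokEquiv)

theorem isDyck_expand (W : List (Step (Dyck Bool))) : IsDyck (expand W) := Walk.isDyck_asm _

theorem expand_injective : Function.Injective expand :=
  Walk.asm_injective.comp (List.map_injective_iff.2 tokEquiv.injective)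

theorem exists_expand {w : List (Step Bool)} (hw : IsDyck w) : ∃ W, expand W = w := by
  obtain ⟨τ, rfl⟩ := Walk.exists_asm hw
  exact ⟨τ.map tokEquiv.symm, by simp [expand]⟩

theorem permOf_expand (W : List (Step (Dyck Bool))) :
    permOf (expand W) = (W.map outerStep).prod := by
  induction W with
  | nil => rfl
  | cons s W ih =>
    rw [expand] at ih
    rcases s with v | _ | _ <;>
      simp [expand, tokEquiv, outerStep, permOfStep, lamp] at ih ⊢ <;> simp [ih, mul_assoc]

theorem length_expand (W : List (Step (Dyck Bool))) :
    (expand W).length = walkDeg excDeg W := by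
  induction W with
  | nil => rfl
  | cons s W ih =>
    rw [expand] at ih
    rcases s with v | _ | _ <;>
      simp [expand, tokEquiv, Walk.stepDeg, excDeg] at ih ⊢ <;> omega

theorem zeroCount_expand (W : List (Step (Dyck Bool))) : zeroCount 0 (expand W) = W.length := by
  rw [expand, zeroCount_asm, List.length_map]

theorem prod_expand_eq_one (W : List (Step (Dyck Bool))) :
    ((expand W).map ofStep).prod = 1 ↔ Walk.height W = 0 ∧ Balanced lamp W := by
  rw [prod_eq_one_iff, permOf_expand, outerStep_prod_eq_one]
  simp [(isDyck_expand W).2]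

theorem finite_excDeg (n : ℕ) : {v : Dyck Bool | excDeg v ≤ n}.Finite := by
  refine Set.Finite.of_finite_image (f := Subtype.val)
    ((List.finite_length_le (Step Bool) n).subset ?_) Subtype.val_injective.injOn
  rintro _ ⟨v, hv, rfl⟩
  exact (Nat.le_add_right _ 2).trans hv

/-- `G(x, y)` counts balanced closed walks of the cursor, whose steps are the letters at height `0`
and whose letters are the excursions; each of them contributes one step that ends at height `0`. -/
theorem coeff_serG (n m : ℕ) : PowerSeries.coeff n (PowerSeries.coeff m serG)
    = closedCount lamp excDeg n m := by
  rw [serG, PowerSeries.coeff_mk, PowerSeries.coeff_mk, closedCount,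
    ← Set.ncard_image_of_injective _
      ((List.map_injective_iff.2 ofStep_injective).comp expand_injective)]
  congr 1
  ext w
  simp only [Set.mem_ofPred_eq, Set.mem_image, Function.comp_apply]
  constructor
  · rintro ⟨h1, h2, h3, h4, h5⟩
    obtain ⟨w, rfl⟩ := (isWord_iff w).1 h1
    obtain ⟨W, rfl⟩ := exists_expand ⟨(neverBelow_map_iff w).1 h3, ((prod_eq_one_iff w).1 h2).1⟩
    refine ⟨W, ⟨(prod_expand_eq_one W).1 h2, ?_, ?_⟩, rfl⟩
    · rw [← length_expand, ← h4, List.length_map]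
    · rw [← zeroCount_expand, ← h5, zeroSteps_map]
  · rintro ⟨W, ⟨h1, h2, h3⟩, rfl⟩
    exact ⟨(isWord_iff _).2 ⟨_, rfl⟩, (prod_expand_eq_one W).2 h1,
      (neverBelow_map_iff _).2 (isDyck_expand W).1, by rw [List.length_map, length_expand, h2],
      by rw [zeroSteps_map, zeroCount_expand, h3]⟩

theorem serG_eq : serG = Walk.closedSeries lamp (Walk.degWeight excDeg) (x * y) := by
  rw [Walk.closedSeries_deg lamp finite_excDeg]
  ext m n
  rw [coeff_serG]
  simp

/-- The word described by a sequence of excursions. -/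
def flatFreeWord (l : List (Dyck Bool)) : List NavasBrin := (asm (l.map Sum.inr)).map ofStep

theorem flatFreeWord_injective : Function.Injective flatFreeWord :=
  (List.map_injective_iff.2 ofStep_injective).comp
    (Walk.asm_injective.comp (List.map_injective_iff.2 Sum.inr_injective))

theorem flatFreeWord_append (k l : List (Dyck Bool)) :
    flatFreeWord (k ++ l) = flatFreeWord k ++ flatFreeWord l := by
  simp [flatFreeWord]

theorem length_flatFreeWord (l : List (Dyck Bool)) :
    (flatFreeWord l).length = letterDeg excDeg l := by
  induction l with
  | nil => rfl
  | cons v l ih => simp [flatFreeWord, excDeg] at ih ⊢; omega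

theorem zeroSteps_flatFreeWord (l : List (Dyck Bool)) : zeroSteps (flatFreeWord l) = l.length := by
  rw [flatFreeWord, zeroSteps_map, zeroCount_asm, List.length_map]

theorem prod_flatFreeWord_eq_one (l : List (Dyck Bool)) :
    (flatFreeWord l).prod = 1 ↔ value lamp l = 1 := by
  have h : permOf (asm (l.map Sum.inr)) = value lamp l := by
    induction l with
    | nil => rfl
    | cons v l ih => simp [ih, lamp, permOfStep, mul_assoc]
  rw [flatFreeWord, prod_eq_one_iff, h]
  simp [(Walk.isDyck_asm _).2]

theorem exists_flatFreeWord_iff (w : List NavasBrin) :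
    (∃ l, flatFreeWord l = w) ↔ IsWord w ∧ height w = 0 ∧ NeverBelow w ∧ NoFlatStep w := by
  constructor
  · rintro ⟨l, rfl⟩
    refine ⟨(isWord_iff _).2 ⟨_, rfl⟩, ?_, (neverBelow_map_iff _).2 (Walk.isDyck_asm _).1,
      (noFlatStep_map_iff _).2 ((flatFree_asm_iff _).2 ⟨l, rfl⟩)⟩
    rw [flatFreeWord, height_map, (Walk.isDyck_asm _).2]
  · rintro ⟨h1, h2, h3, h4⟩
    obtain ⟨w, rfl⟩ := (isWord_iff w).1 h1
    obtain ⟨τ, rfl⟩ := Walk.exists_asm ⟨(neverBelow_map_iff w).1 h3, by rwa [← height_map]⟩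
    obtain ⟨l, rfl⟩ := (flatFree_asm_iff τ).1 ((noFlatStep_map_iff _).1 h4)
    exact ⟨l, rfl⟩

/-- `J_k` counts `k`-tuples of excursions with trivial product. -/
theorem coeff_serJ (k n : ℕ) : PowerSeries.coeff n (serJ k) = trivCount lamp excDeg k n := by
  rw [serJ, PowerSeries.coeff_mk, trivCount,
    ← Set.ncard_image_of_injective _ flatFreeWord_injective]
  congr 1
  ext w
  simp only [Set.mem_ofPred_eq, Set.mem_image]
  constructor
  · rintro ⟨h1, h2, h3, h4, h5, h6⟩
    obtain ⟨l, rfl⟩ := (exists_flatFreeWord_iff w).2 ⟨h1, by simp [height, h2], h3, h4⟩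
    exact ⟨l, ⟨(prod_flatFreeWord_eq_one l).1 h2, by rw [← length_flatFreeWord, h6],
      by rw [← zeroSteps_flatFreeWord, h5]⟩, rfl⟩
  · rintro ⟨l, ⟨h1, h2, h3⟩, rfl⟩
    obtain ⟨h4, -, h5, h6⟩ := (exists_flatFreeWord_iff _).1 ⟨l, rfl⟩
    exact ⟨h4, (prod_flatFreeWord_eq_one l).2 h1, h5, h6, by rw [zeroSteps_flatFreeWord, h3],
      by rw [length_flatFreeWord, h2]⟩

theorem coeff_serH (n : ℕ+) (k m : ℕ) : PowerSeries.coeff k (PowerSeries.coeff m (serH n))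
    = (m + ((n : ℕ) - 1)).choose ((n : ℕ) - 1) * trivCount lamp excDeg m k := by
  rw [serH, PowerSeries.coeff_mk, PowerSeries.coeff_mk]
  rw [trivCount, ← ncard_cuts n.pos m
    ((Walk.finite_letterDeg_le finite_excDeg k m).subset fun l hl => ⟨hl.2.1.le, hl.2.2⟩)
    fun l hl => hl.2.2]
  have hinj : Function.Injective fun (l : Fin n → List (Dyck Bool)) i =>
      flatFreeWord (l i) := flatFreeWord_injective.comp_left
  rw [← Set.ncard_image_of_injective _ hinj]
  have hflat : ∀ ls : List (List (Dyck Bool)),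
      (ls.map flatFreeWord).flatten = flatFreeWord ls.flatten := fun ls => by
    induction ls with
    | nil => rfl
    | cons l ls ih => simp [ih, flatFreeWord_append]
  have hprod : ∀ l : Fin n → List (Dyck Bool),
      (List.ofFn fun i => flatFreeWord (l i)).flatten = flatFreeWord (List.ofFn l).flatten := by
    intro l
    rw [← hflat, List.map_ofFn]
    rfl
  have hlen : ∀ l : Fin n → List (Dyck Bool),
      ∑ i, (flatFreeWord (l i)).length = letterDeg excDeg (List.ofFn l).flatten := by
    intro l
    rw [← length_flatFreeWord, ← hprod, List.length_flatten, List.map_ofFn, List.sum_ofFn]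
    rfl
  have hzero : ∀ l : Fin n → List (Dyck Bool),
      ∑ i, zeroSteps (flatFreeWord (l i)) = (List.ofFn l).flatten.length := by
    intro l
    rw [List.length_flatten, List.map_ofFn, List.sum_ofFn]
    simp only [zeroSteps_flatFreeWord]
    rfl
  congr 1
  ext w
  simp only [Set.mem_ofPred_eq, Set.mem_image]
  constructor
  · rintro ⟨h1, h2, h3, h4⟩
    choose l hl using fun i => (exists_flatFreeWord_iff (w i)).2 (h1 i)
    obtain rfl : (fun i => flatFreeWord (l i)) = w := funext hl
    refine ⟨l, ⟨?_, ?_, ?_⟩, rfl⟩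
    · rw [← prod_flatFreeWord_eq_one, ← hprod]; exact h2
    · rw [← hlen]; exact h3
    · rw [← hzero]; exact h4
  · rintro ⟨l, ⟨h1, h2, h3⟩, rfl⟩
    refine ⟨fun i => (exists_flatFreeWord_iff _).1 ⟨l i, rfl⟩, ?_, ?_, ?_⟩
    · rw [← prod_flatFreeWord_eq_one, ← hprod] at h1; exact h1
    · rw [← hlen] at h2; exact h2
    · rw [← hzero] at h3; exact h3

theorem serH_eq (n : ℕ+) :
    serH n = Walk.lampSeries lamp (Walk.degWeight excDeg) ((n : ℕ) - 1) := by
  rw [Walk.lampSeries_deg lamp finite_excDeg]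
  ext m k
  rw [coeff_serH]
  simp

/-- The system of equations that expresses `G` and `Λ_d` in terms of the `H_n`. -/
theorem equations :
    (∀ d : ℕ+, Summable (chainTerm (x ^ 2 * y ^ 2) serH d)) ∧
    (∃ U V : ℕ⟦X⟧⟦X⟧,
      HasSum (fun q : ℕ+ × ℕ+ =>
        x ^ (2 * (q.1 : ℕ) + 2 * (q.2 : ℕ)) * y ^ (2 * (q.1 : ℕ) + 2 * (q.2 : ℕ))
          * ((((q.1 : ℕ) + (q.2 : ℕ)).choose (q.1 : ℕ) : ℕ) : ℕ⟦X⟧⟦X⟧)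
          * serH (q.1 + q.2 + 1) * serLambda q.2 * serLambda q.1) U ∧
      HasSum (fun d : ℕ+ =>
        x ^ (2 * (d : ℕ)) * y ^ (2 * (d : ℕ)) * serH (d + 1) * serLambda d) V ∧
      serG = U + 2 * V + serH 1) ∧
    (∀ d : ℕ+, ∃ R : ℕ⟦X⟧⟦X⟧,
      HasSum (fun b : ℕ+ =>
        x ^ (2 * (b : ℕ)) * y ^ (2 * (b : ℕ))
          * ((((b : ℕ) + (d : ℕ) - 1).choose ((d : ℕ) - 1) : ℕ) : ℕ⟦X⟧⟦X⟧)
          * serH (b + d) * serLambda b) R ∧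
      serLambda d = serH d + R) := by
  have h := Walk.closedSeries_eq lamp (Walk.summable_weight_deg finite_excDeg) Walk.X_dvd_xy
    Walk.sq_xy serH_eq
  simp only [← serG_eq, mul_pow, ← pow_mul, mul_add] at h
  refine ⟨summable_chainTerm Walk.X_dvd_xy _, h, fun d => ?_⟩
  have h2 := hasSum_chain Walk.X_dvd_xy serH d
  simp only [mul_pow, ← pow_mul] at h2
  exact h2

theorem hasSum_serH (n : ℕ+) :
    HasSum (fun k : ℕ => y ^ k * (((k + (n : ℕ) - 1).choose ((n : ℕ) - 1) : ℕ) : ℕ⟦X⟧⟦X⟧)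
      * PowerSeries.C (serJ k)) (serH n) := by
  refine (PowerSeries.WithPiTopology.hasSum_iff_hasSum_coeff _).2 fun m => ?_
  have h1 : ∀ k : ℕ, PowerSeries.coeff m (y ^ k
      * (((k + (n : ℕ) - 1).choose ((n : ℕ) - 1) : ℕ) : ℕ⟦X⟧⟦X⟧) * PowerSeries.C (serJ k))
      = if k = m then (((k + (n : ℕ) - 1).choose ((n : ℕ) - 1) : ℕ) : ℕ⟦X⟧) * serJ k else 0 := by
    intro k
    rw [← map_natCast (PowerSeries.C (R := ℕ⟦X⟧)), mul_assoc, ← map_mul, mul_comm,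
      PowerSeries.coeff_C_mul, y, PowerSeries.coeff_X_pow]
    by_cases h : k = m
    · simp [h]
    · simp [h, Ne.symm h]
  have h2 : PowerSeries.coeff m (serH n)
      = (((m + (n : ℕ) - 1).choose ((n : ℕ) - 1) : ℕ) : ℕ⟦X⟧) * serJ m := by
    ext k
    rw [coeff_serH, ← map_natCast (PowerSeries.C (R := ℕ)), PowerSeries.coeff_C_mul, coeff_serJ,
      Nat.add_sub_assoc n.pos]
    rfl
  rw [h2]
  have h3 := hasSum_single (f := fun k => if k = m then
    (((k + (n : ℕ) - 1).choose ((n : ℕ) - 1) : ℕ) : ℕ⟦X⟧) * serJ k else 0) m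
    fun k hk => if_neg hk
  rw [if_pos rfl] at h3
  exact h3.congr_fun h1

theorem serJ_zero : serJ 0 = 1 := by
  ext n
  rw [coeff_serJ, trivCount, PowerSeries.coeff_one]
  by_cases h : n = 0
  · have : {l : List (Dyck Bool) | value lamp l = 1 ∧ letterDeg excDeg l = n ∧ l.length = 0}
        = {[]} := by
      ext l
      simp only [Set.mem_ofPred_eq, Set.mem_singleton_iff, List.length_eq_zero_iff]
      exact ⟨fun h => h.2.2, by rintro rfl; simp [h]⟩
    rw [this, if_pos h, Set.ncard_singleton]
  · have : {l : List (Dyck Bool) | value lamp l = 1 ∧ letterDeg excDeg l = n ∧ l.length = 0}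
        = ∅ := by
      ext l
      simp only [Set.mem_ofPred_eq, Set.mem_empty_iff_false, iff_false, List.length_eq_zero_iff]
      rintro ⟨-, h2, rfl⟩
      exact h h2.symm
    rw [this, if_neg h, Set.ncard_empty]

theorem letterDeg_excDeg (l : List (Dyck Bool)) :
    letterDeg excDeg l = 2 * l.length + (Walk.join l).length := by
  induction l with
  | nil => rfl
  | cons v l ih => simp [ih, excDeg]; ring

/-- A `k`-tuple of excursions that multiplies to the identity comes from a loop that is cut into
`k` pieces at height `0`. -/
theorem hasSum_serJ (k : ℕ+) :
    HasSum (fun m : ℕ =>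
      PowerSeries.X ^ (2 * (k : ℕ)) * (((m + (k : ℕ) - 1).choose ((k : ℕ) - 1) : ℕ) : ℕ⟦X⟧)
        * PowerSeries.coeff m serG) (serJ k) := by
  classical
  obtain ⟨c, rfl⟩ : ∃ j : ℕ, k = j.succPNat := ⟨k.natPred, (PNat.succPNat_natPred k).symm⟩
  rw [Nat.succPNat_coe]
  have h1 := hasSum_monomials (fun l : List (Dyck Bool) => value lamp l = 1 ∧ l.length = c + 1)
    (letterDeg excDeg) fun n => (Walk.finite_letterDeg_le finite_excDeg n (c + 1)).subset
      fun l hl => ⟨hl.2.le, hl.1.2⟩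
  have e1 : (PowerSeries.mk fun n => {l : List (Dyck Bool) |
      (value lamp l = 1 ∧ l.length = c + 1) ∧ letterDeg excDeg l = n}.ncard) = serJ (c + 1) := by
    ext n
    rw [coeff_serJ, PowerSeries.coeff_mk, trivCount]
    congr 1
    ext l
    simp only [Set.mem_ofPred_eq]
    tauto
  rw [e1] at h1
  have h2 : HasSum (fun l : {l : List (Dyck Bool) // l.length = c + 1} =>
      if permOf (asm (l.1.map Walk.dyckEquiv.symm).flatten) = 1 then (PowerSeries.X : ℕ⟦X⟧) ^
        (2 * (c + 1) + (asm (l.1.map Walk.dyckEquiv.symm).flatten).length) else 0)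
      (serJ (c + 1)) := by
    rw [← hasSum_subtype_iff_of_support_subset (s := {l | l.length = c + 1})] at h1
    · refine h1.congr_fun fun l => ?_
      have hl : l.1.length = c + 1 := l.2
      have hv : value lamp l.1 = 1 ↔ permOf (Walk.join l.1) = 1 := by
        rw [value_lamp, mul_inv_eq_one, mul_eq_left]
      simp only [Function.comp_apply, Walk.asm_flatten, letterDeg_excDeg, hl, hv, and_true]
    · intro l hl
      by_contra h
      exact hl (if_neg fun h' => h h'.2)
  have h3 := HasSum.of_fibres (g := fun τ => if permOf (asm τ) = 1 then (PowerSeries.X : ℕ⟦X⟧) ^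
        (2 * (c + 1) + (asm τ).length) else 0) (Walk.encard_cut_fibre c) h2
  have hL : ∀ W, tokEquiv.listEquivOfEquiv W = W.map tokEquiv := fun _ => rfl
  have h4 := (Equiv.listEquivOfEquiv tokEquiv).hasSum_iff.2 h3
  have hE : ∀ W, asm (W.map tokEquiv) = expand W := fun _ => rfl
  simp only [Function.comp_def, hL, List.length_map, hE] at h4
  have h5 := (Equiv.sigmaFiberEquiv (List.length (α := Step (Dyck Bool)))).hasSum_iff.2 h4
  refine h5.sigma fun m => ?_
  have h6 := hasSum_monomials
    (fun W : List (Step (Dyck Bool)) => (Walk.height W = 0 ∧ Balanced lamp W) ∧ W.length = m)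
    (walkDeg excDeg) fun n => (Walk.finite_walkDeg_le finite_excDeg n m).subset
      fun l hl => ⟨hl.2.le, hl.1.2⟩
  have e2 : (PowerSeries.mk fun n => {W : List (Step (Dyck Bool)) |
      ((Walk.height W = 0 ∧ Balanced lamp W) ∧ W.length = m) ∧ walkDeg excDeg W = n}.ncard)
      = PowerSeries.coeff m serG := by
    ext n
    rw [coeff_serG, PowerSeries.coeff_mk, closedCount]
    congr 1
    ext l
    simp only [Set.mem_ofPred_eq]
    tauto
  rw [e2, ← hasSum_subtype_iff_of_support_subset (s := {W | W.length = m})] at h6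
  · refine (h6.mul_left _).congr_fun fun W => ?_
    obtain ⟨W, rfl⟩ := W
    have h7 := prod_expand_eq_one W
    rw [prod_eq_one_iff] at h7
    simp only [(isDyck_expand W).2, true_and] at h7
    simp only [Function.comp_apply, Equiv.sigmaFiberEquiv, Equiv.coe_fn_mk, ← h7, and_true,
      ← length_expand]
    split_ifs
    · rw [pow_add]
      simp only [Nat.succ_eq_add_one, Nat.add_succ_sub_one, Nat.add_one_sub_one]
      ring
    · simp
  · intro l hl
    by_contra h
    exact hl (if_neg fun h' => h h'.2)

end NavasBrin

/-! ### Rotations of loops -/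

namespace NavasBrin

open Walk (Step NonNeg)

open Classical in
/-- The number of rotations of a word that do not go below `0`. -/
def goodRotations (u : List (Step Bool)) : ℕ :=
  u.length.count fun k => NonNeg 0 (u.rotate k)

theorem goodRotations_rotate (u : List (Step Bool)) (k : ℕ) :
    goodRotations (u.rotate k) = goodRotations u := by
  classical
  rw [goodRotations, goodRotations, List.length_rotate]
  have hp : Function.Periodic (fun k => NonNeg 0 (u.rotate k)) u.length := fun k => by
    beta_reduce
    rw [add_comm, ← List.rotate_rotate, List.rotate_length]
  rw [← Nat.filter_Ico_card_eq_of_periodic k _ _ hp, Nat.count_eq_card_filter_range]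
  refine Finset.card_bij (fun j _ => k + j) ?_ (fun _ _ _ _ h => Nat.add_left_cancel h) ?_
  · intro j hj
    rw [Finset.mem_filter, Finset.mem_range, List.rotate_rotate] at hj
    exact Finset.mem_filter.2 ⟨Finset.mem_Ico.2 ⟨by omega, by omega⟩, hj.2⟩
  · intro j hj
    rw [Finset.mem_filter, Finset.mem_Ico] at hj
    obtain ⟨i, rfl⟩ := Nat.exists_eq_add_of_le hj.1.1
    exact ⟨i, by rw [Finset.mem_filter, Finset.mem_range, List.rotate_rotate]; exact
      ⟨by omega, hj.2⟩, rfl⟩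

/-- A rotation of a nonnegative loop starts at its lowest point iff it starts at height `0`. -/
theorem nonNeg_rotate_iff {v : List (Step Bool)} (h0 : Walk.height v = 0) (hv : NonNeg 0 v) {k : ℕ}
    (hk : k ≤ v.length) : NonNeg 0 (v.rotate k) ↔ Walk.height (v.take k) = 0 := by
  rw [List.rotate_eq_drop_append_take hk]
  have e := List.take_append_drop k v
  have h1 : Walk.height (v.take k) + Walk.height (v.drop k) = 0 := by
    rw [← Walk.height_append, e, h0]
  rw [← e, Walk.nonNeg_append, zero_add] at hv
  rw [Walk.nonNeg_append, zero_add]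
  constructor
  · rintro ⟨h2, h3⟩
    have h4 := Walk.NonNeg.le le_rfl h2
    have h5 := Walk.NonNeg.le le_rfl hv.1
    omega
  · intro h2
    rw [h2] at hv
    rw [show Walk.height (v.drop k) = 0 by omega]
    exact ⟨hv.2, hv.1⟩

/-- The good rotations of a loop that never goes below `0` start at its returns to `0`. -/
theorem goodRotations_of_nonNeg {v : List (Step Bool)} (h0 : Walk.height v = 0)
    (hv : NonNeg 0 v) : goodRotations v = zeroCount 0 v := by
  classical
  have h1 := Finset.sum_range_succ (fun i => if Walk.height (v.take i) = 0 then 1 else 0) v.length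
  rw [Finset.sum_range_succ', List.take_length, h0] at h1
  simp only [List.take_zero, Walk.height_nil] at h1
  rw [goodRotations, Nat.count_eq_card_filter_range, Finset.card_filter, zeroCount_eq_sum]
  simp only [zero_add]
  rw [Nat.add_right_cancel h1]
  refine Finset.sum_congr rfl fun i hi => ?_
  simp only [nonNeg_rotate_iff h0 hv (Finset.mem_range.1 hi).le]

/-- A rotation that starts at a lowest point does not go below `0`. -/
theorem goodRotations_pos {u : List (Step Bool)} (h0 : Walk.height u = 0) (hu : u ≠ []) :
    0 < goodRotations u := by
  classical
  obtain ⟨k, hk, hmin⟩ := Finset.exists_min_image (Finset.range u.length)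
    (fun k => Walk.height (u.take k)) ⟨0, by simpa using List.length_pos_iff.2 hu⟩
  rw [Finset.mem_range] at hk
  have hmin' : ∀ j ≤ u.length, Walk.height (u.take k) ≤ Walk.height (u.take j) := fun j hj => by
    rcases hj.lt_or_eq with hj | rfl
    · exact hmin j (Finset.mem_range.2 hj)
    · rw [List.take_length, h0]
      simpa using hmin 0 (by simpa using by omega)
  refine (Nat.count_monotone _ hk).trans_lt' ?_
  rw [Nat.count_succ, if_pos]
  · omega
  rw [List.rotate_eq_drop_append_take hk.le, Walk.nonNeg_append, zero_add]
  have h1 : Walk.height (u.take k) + Walk.height (u.drop k) = 0 := by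
    rw [← Walk.height_append, List.take_append_drop, h0]
  have h2 := hmin' 0 (Nat.zero_le _)
  rw [List.take_zero, Walk.height_nil] at h2
  rw [Walk.nonNeg_iff_take le_rfl, Walk.nonNeg_iff_take (by omega)]
  constructor
  · intro i hi
    rw [List.length_drop] at hi
    have h3 := hmin' (k + i) (by omega)
    rw [List.take_add, Walk.height_append] at h3
    omega
  · intro i hi
    rw [List.length_take] at hi
    have h3 := hmin' i (by omega)
    rw [List.take_take, min_eq_left (by omega)]
    omega

/-- The loops of length `n`. -/
def loops (n : ℕ) : Finset (List (Step Bool)) :=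
  (WreathZ.finite_words (fun w : List (Step Bool) => (w.map ofStep).prod = 1) n).toFinset

theorem mem_loops {n : ℕ} {u : List (Step Bool)} :
    u ∈ loops n ↔ (u.map ofStep).prod = 1 ∧ u.length = n := by
  simp [loops]

theorem rotate_mem_loops {n : ℕ} {u : List (Step Bool)} (hu : u ∈ loops n) (k : ℕ) :
    u.rotate k ∈ loops n := by
  rw [mem_loops] at hu ⊢
  rw [List.length_rotate, List.map_rotate]
  exact ⟨List.prod_rotate_eq_one_of_prod_eq_one hu.1 k, hu.2⟩

theorem loopCount_eq_card (n : ℕ) :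
    loopCount ({a, t} : Set NavasBrin) n = (loops n).card := by
  rw [loopCount_eq_ncard ofStep_injective range_ofStep, ← Set.ncard_coe_finset]
  congr 1
  ext u
  rw [Finset.mem_coe, mem_loops]
  rfl

open Classical in
theorem coeff_serG_eq_card (n m : ℕ) : PowerSeries.coeff n (PowerSeries.coeff m serG)
    = ((loops n).filter fun u => goodRotations u = m ∧ NonNeg 0 u).card := by
  rw [serG, PowerSeries.coeff_mk, PowerSeries.coeff_mk, ← Set.ncard_coe_finset,
    ← Set.ncard_image_of_injective _ (List.map_injective_iff.2 ofStep_injective)]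
  congr 1
  ext w
  simp only [Set.mem_ofPred_eq, Set.mem_image, Finset.coe_filter, mem_loops]
  constructor
  · rintro ⟨h1, h2, h3, h4, h5⟩
    obtain ⟨w, rfl⟩ := (isWord_iff w).1 h1
    rw [neverBelow_map_iff] at h3
    refine ⟨w, ⟨⟨h2, by simpa using h4⟩, ?_, h3⟩, rfl⟩
    rw [goodRotations_of_nonNeg ((prod_eq_one_iff w).1 h2).1 h3, ← zeroSteps_map, h5]
  · rintro ⟨w, ⟨⟨h2, h4⟩, h5, h3⟩, rfl⟩
    refine ⟨(isWord_iff _).2 ⟨w, rfl⟩, h2, (neverBelow_map_iff w).2 h3, by simpa using h4, ?_⟩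
    rw [zeroSteps_map, ← goodRotations_of_nonNeg ((prod_eq_one_iff w).1 h2).1 h3, h5]

/-- Double counting of the pairs of a loop with `m` good rotations and one of these rotations. -/
theorem mul_card_goodRotations_eq (n m : ℕ) :
    m * ((loops n).filter fun u => goodRotations u = m).card
      = n * PowerSeries.coeff n (PowerSeries.coeff m serG) := by
  classical
  set A := (loops n).filter fun u => goodRotations u = m with hA
  have hrot : ∀ k, ∀ u ∈ A, u.rotate k ∈ A := fun k u hu => by
    rw [hA, Finset.mem_filter] at hu ⊢
    exact ⟨rotate_mem_loops hu.1 k, by rw [goodRotations_rotate, hu.2]⟩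
  have h1 : ∑ u ∈ A, ∑ k ∈ Finset.range n, (if NonNeg 0 (u.rotate k) then 1 else 0)
      = m * A.card := by
    rw [mul_comm, ← smul_eq_mul, ← Finset.sum_const]
    refine Finset.sum_congr rfl fun u hu => ?_
    rw [hA, Finset.mem_filter, mem_loops] at hu
    rw [← Finset.card_filter, ← Nat.count_eq_card_filter_range, ← hu.1.2, ← hu.2, goodRotations]
  rw [← h1, Finset.sum_comm, ← smul_eq_mul, ← Finset.card_range n, ← Finset.sum_const]
  simp only [Finset.card_range]
  refine Finset.sum_congr rfl fun k hk => ?_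
  rw [coeff_serG_eq_card, ← Finset.filter_filter, ← hA, Finset.card_filter]
  have hlen : ∀ u ∈ A, u.length = n := fun u hu => (mem_loops.1 (Finset.mem_filter.1 hu).1).2
  rw [Finset.mem_range] at hk
  refine Finset.sum_bij' (fun u _ => u.rotate k) (fun u _ => u.rotate (n - k))
    (hrot k) (hrot (n - k)) (fun u hu => ?_) (fun u hu => ?_) fun _ _ => rfl
  · rw [List.rotate_rotate, Nat.add_sub_cancel' hk.le, ← hlen u hu, List.rotate_length]
  · rw [List.rotate_rotate, Nat.sub_add_cancel hk.le, ← hlen u hu, List.rotate_length]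

theorem coeff_serG_eq_zero {n m : ℕ} (hn : 1 ≤ n) (hm : n < m) :
    PowerSeries.coeff n (PowerSeries.coeff m serG) = 0 := by
  classical
  have h := mul_card_goodRotations_eq n m
  rw [Finset.filter_false_of_mem, Finset.card_empty, mul_zero] at h
  · exact (Nat.mul_eq_zero.1 h.symm).resolve_left (by omega)
  · intro u hu h2
    have h3 := (mem_loops.1 hu).2
    have h4 : goodRotations u ≤ u.length := Nat.count_le _
    omega

theorem loopCount_eq_sum {n : ℕ} (hn : 1 ≤ n) : loopCount ({a, t} : Set NavasBrin) n
    = ∑ m ∈ Finset.Icc 1 n, ((loops n).filter fun u => goodRotations u = m).card := by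
  rw [loopCount_eq_card]
  refine Finset.card_eq_sum_card_fiberwise fun u hu => ?_
  have h := mem_loops.1 hu
  have h4 : goodRotations u ≤ u.length := by classical exact Nat.count_le _
  refine Finset.mem_coe.2 (Finset.mem_Icc.2 ⟨goodRotations_pos ((prod_eq_one_iff u).1 h.1).1 ?_,
    h4.trans h.2.le⟩)
  rintro rfl
  have := h.2
  simp at this
  omega

/-- The cogrowth in terms of the loops that never go below `0`, with exact division. -/
theorem loopCount_eq_sum_div {n : ℕ} (hn : 1 ≤ n) : loopCount ({a, t} : Set NavasBrin) n
    = ∑ m ∈ Finset.Icc 1 n, n * PowerSeries.coeff n (PowerSeries.coeff m serG) / m := by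
  rw [loopCount_eq_sum hn]
  refine Finset.sum_congr rfl fun m hm => ?_
  rw [← mul_card_goodRotations_eq, Nat.mul_div_cancel_left _ (Finset.mem_Icc.1 hm).1]

theorem loopCount_zero : loopCount ({a, t} : Set NavasBrin) 0 = 1 := by
  rw [loopCount_eq_card, Finset.card_eq_one]
  refine ⟨[], ?_⟩
  ext u
  rw [mem_loops, Finset.mem_singleton, List.length_eq_zero_iff]
  exact ⟨fun h => h.2, by rintro rfl; simp⟩

theorem hasSum_loopCount {n : ℕ} (hn : 1 ≤ n) :
    HasSum (fun m : ℕ+ => (n : ℚ) / ((m : ℕ) : ℚ)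
        * ((PowerSeries.coeff n (PowerSeries.coeff (m : ℕ) serG) : ℕ) : ℚ))
      (loopCount ({a, t} : Set NavasBrin) n : ℚ) := by
  have key : ∀ m : ℕ+, (n : ℚ) / ((m : ℕ) : ℚ)
      * ((PowerSeries.coeff n (PowerSeries.coeff (m : ℕ) serG) : ℕ) : ℚ)
      = (((loops n).filter fun u => goodRotations u = m).card : ℚ) := fun m => by
    have h := congrArg (Nat.cast (R := ℚ)) (mul_card_goodRotations_eq n m)
    push_cast at h
    have hm : ((m : ℕ) : ℚ) ≠ 0 := by exact_mod_cast m.ne_zero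
    field_simp
    linarith
  have h1 : HasSum (fun m : ℕ => (if 1 ≤ m then
      (((loops n).filter fun u => goodRotations u = m).card : ℚ) else 0))
      (loopCount ({a, t} : Set NavasBrin) n : ℚ) := by
    rw [loopCount_eq_sum hn, Nat.cast_sum]
    have h2 := hasSum_sum_of_ne_finset_zero (f := fun m : ℕ => (if 1 ≤ m then
      (((loops n).filter fun u => goodRotations u = m).card : ℚ) else 0)) (s := Finset.Icc 1 n) (L := .unconditional ℕ) ?_
    · convert h2 using 1
      exact Finset.sum_congr rfl fun m hm => (if_pos (Finset.mem_Icc.1 hm).1).symm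
    · intro m hm
      split_ifs with h
      · have h3 := mul_card_goodRotations_eq n m
        rw [coeff_serG_eq_zero hn (by rw [Finset.mem_Icc] at hm; omega), mul_zero] at h3
        exact_mod_cast (Nat.mul_eq_zero.1 h3).resolve_left (by omega)
      · rfl
  have hsupp : Function.support (fun m : ℕ => (if 1 ≤ m then
      (((loops n).filter fun u => goodRotations u = m).card : ℚ) else 0))
      ⊆ Set.range ((↑) : ℕ+ → ℕ) := fun m hm => by
    by_cases h : 1 ≤ m
    · exact ⟨⟨m, h⟩, rfl⟩
    · exact (hm (if_neg h)).elim
  refine ((PNat.coe_injective.hasSum_iff (fun m hm => ?_)).2 h1).congr_fun fun m => ?_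
  · by_contra h
    exact hm (hsupp h)
  · rw [key, Function.comp_apply, if_pos (show 1 ≤ (m : ℕ) from m.pos)]

end NavasBrin

/-! ### Structured programs for the random access machine -/

namespace RAM

/-- Started in `s`, the program `p` halts at cost at most `T` in a store that satisfies `Q`. -/
def Halts (p : Prog) (s : Store) (T : ℕ) (Q : Store → Prop) : Prop :=
  ∃ (s' : Store) (c : ℕ), Runs p s s' c ∧ c ≤ T ∧ Q s'

theorem Halts.imp {p : Prog} {s : Store} {T T' : ℕ} {Q Q' : Store → Prop} (h : Halts p s T Q)
    (hT : T ≤ T') (hQ : ∀ s', Q s' → Q' s') : Halts p s T' Q' := by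
  obtain ⟨s', c, h1, h2, h3⟩ := h
  exact ⟨s', c, h1, h2.trans hT, hQ _ h3⟩

theorem Halts.set {s : Store} {k : ℕ} {i e : Expr} {T : ℕ} {Q : Store → Prop}
    (hT : i.cost s + e.cost s + (i.eval s).size + (e.eval s).size + 1 ≤ T)
    (hQ : Q (s.write k (i.eval s) (e.eval s))) : Halts (.set k i e) s T Q :=
  ⟨_, _, .set s k i e, hT, hQ⟩

theorem Halts.comp {p q : Prog} {s : Store} {T T₁ T₂ : ℕ} {Q Q₁ : Store → Prop}
    (hp : Halts p s T₁ Q₁) (hq : ∀ s', Q₁ s' → Halts q s' T₂ Q) (hT : T₁ + T₂ + 1 ≤ T) :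
    Halts (.comp p q) s T Q := by
  obtain ⟨s', c, h1, h2, h3⟩ := hp
  obtain ⟨s'', c', h4, h5, h6⟩ := hq s' h3
  exact ⟨s'', _, .comp h1 h4, by omega, h6⟩

theorem Halts.cond {e : Expr} {p q : Prog} {s : Store} {T T' : ℕ} {Q : Store → Prop}
    (hp : e.eval s ≠ 0 → Halts p s T' Q) (hq : e.eval s = 0 → Halts q s T' Q)
    (hT : e.cost s + T' + 1 ≤ T) : Halts (.cond e p q) s T Q := by
  by_cases h : e.eval s = 0
  · obtain ⟨s', c, h1, h2, h3⟩ := hq h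
    exact ⟨s', _, .cond_false h h1, by omega, h3⟩
  · obtain ⟨s', c, h1, h2, h3⟩ := hp h
    exact ⟨s', _, .cond_true h h1, by omega, h3⟩

/-- A loop with the invariant `I`, indexed by the number of rounds that are done. -/
theorem Halts.loop {e : Expr} {p : Prog} {n T₁ T₂ T : ℕ} (I : ℕ → Store → Prop) {s : Store}
    (h0 : I 0 s)
    (hstep : ∀ i < n, ∀ s, I i s → e.eval s ≠ 0 ∧ Halts p s T₁ (I (i + 1)))
    (hend : ∀ s, I n s → e.eval s = 0)
    (hcost : ∀ i ≤ n, ∀ s, I i s → e.cost s ≤ T₂) (hT : (n + 1) * (T₁ + T₂ + 1) ≤ T) :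
    Halts (.loop e p) s T (I n) := by
  suffices H : ∀ j i s, i + j = n → I i s →
      Halts (.loop e p) s ((j + 1) * (T₁ + T₂ + 1)) (I n) from
    (H n 0 s (zero_add n) h0).imp hT fun _ h => h
  intro j
  induction j with
  | zero =>
    intro i s hi hs
    have h : i = n := by omega
    subst h
    exact ⟨s, _, .loop_false (hend s hs), by have := hcost i le_rfl s hs; omega, hs⟩
  | succ j ih =>
    intro i s hi hs
    obtain ⟨h1, s', c, h2, h3, h4⟩ := hstep i (by omega) s hs
    obtain ⟨s'', c', h5, h6, h7⟩ := ih (i + 1) s' (by omega) h4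
    have h8 := hcost i (by omega) s hs
    exact ⟨s'', _, .loop_true h1 h2 h5, by rw [add_mul (j + 1)]; omega, h7⟩

theorem Store.write_same (s : Store) (k i v : ℕ) :
    (s.write k i v) k = Function.update (s k) i v := Function.update_self ..

theorem Store.write_of_ne (s : Store) {k l : ℕ} (h : l ≠ k) (i v : ℕ) : (s.write k i v) l = s l :=
  Function.update_of_ne h ..

/-! ### Terms with bounded sums and products -/

/-- Binary operations. -/
inductive Op : Type
  | add | sub | mul | div

/-- The meaning of an operation. -/
def Op.fn : Op → ℕ → ℕ → ℕ
  | .add, a, b => a + b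
  | .sub, a, b => a - b
  | .mul, a, b => a * b
  | .div, a, b => a / b

/-- The expression that applies an operation. -/
def Op.expr : Op → Expr → Expr → Expr
  | .add => .add
  | .sub => .sub
  | .mul => .mul
  | .div => .div

theorem Op.eval_expr (o : Op) (s : Store) (e f : Expr) :
    (o.expr e f).eval s = o.fn (e.eval s) (f.eval s) := by
  cases o <;> rfl

theorem Op.cost_expr (o : Op) (s : Store) (e f : Expr) : (o.expr e f).cost s
    ≤ e.cost s + f.cost s + ((e.eval s).size + 1) * ((f.eval s).size + 1) := by
  have h : (e.eval s).size + (f.eval s).size + 1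
      ≤ ((e.eval s).size + 1) * ((f.eval s).size + 1) := by
    rw [add_mul, mul_add]; omega
  cases o <;> simp only [Op.expr, Expr.cost] <;> omega

/-- Every operation yields at most one bit more than its operands have together. -/
theorem Op.fn_lt (o : Op) {a b α β : ℕ} (ha : a < 2 ^ α) (hb : b < 2 ^ β) :
    o.fn a b < 2 ^ (α + β + 1) := by
  have h1 : 2 ^ α ≤ 2 ^ (α + β) := Nat.pow_le_pow_right two_pos (by omega)
  have h2 : 2 ^ β ≤ 2 ^ (α + β) := Nat.pow_le_pow_right two_pos (by omega)
  have h3 := pow_succ 2 (α + β)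
  have h4 : a * b ≤ 2 ^ (α + β) := by rw [pow_add]; exact Nat.mul_le_mul ha.le hb.le
  have h5 := Nat.div_le_self a b
  have h6 : 0 < 2 ^ (α + β) := by positivity
  cases o <;> simp only [Op.fn] <;> omega

/-- Terms over a store. Cell `0` of bank `3` bounds the range of all iterations, the other cells of
this bank hold the values of variables. -/
inductive Term : Type
  | lit (n : ℕ)
  | get (k : Fin 4) (t : Term)
  | bin (o : Op) (t u : Term)
  | ite (c t u : Term)
  | fold (o : Op) (n v : ℕ) (t : Term)

/-- The value of a term. In `ite c t u` the value of `c` is false if it is `0`; `fold o n v t`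
starts from `n` and combines, by `o`, the values of `t` when the variable `v + 1` runs from `0` to
the bound. -/
def Term.eval (s : Store) : Term → ℕ
  | .lit n => n
  | .get k t => s k (t.eval s)
  | .bin o t u => o.fn (t.eval s) (u.eval s)
  | .ite c t u => if c.eval s = 0 then u.eval s else t.eval s
  | .fold o n v t =>
    Nat.rec n (fun i acc => o.fn acc (t.eval (s.write 3 (v + 1) i))) (s 3 0)

/-- The program that leaves the value of a term in cell `r` of bank `4`, using the cells from `r`
on as temporaries. -/
def Term.compile : Term → ℕ → Prog
  | .lit n, r => .set 4 (.lit r) (.lit n)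
  | .get k t, r => .comp (t.compile r) (.set 4 (.lit r) (.get k (.get 4 (.lit r))))
  | .bin o t u, r => .comp (t.compile r) (.comp (u.compile (r + 1))
      (.set 4 (.lit r) (o.expr (.get 4 (.lit r)) (.get 4 (.lit (r + 1))))))
  | .ite c t u, r => .comp (c.compile r) (.cond (.get 4 (.lit r)) (t.compile r) (u.compile r))
  | .fold o n v t, r =>
    .comp (.set 4 (.lit r) (.lit n)) (.comp
      -- the old value of the variable is restored at the end
      (.set 4 (.lit (r + 1)) (.get 3 (.lit (v + 1)))) (.comp
      (.set 3 (.lit (v + 1)) (.lit 0)) (.comp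
      (.loop (.sub (.get 3 (.lit 0)) (.get 3 (.lit (v + 1)))) (.comp (t.compile (r + 2)) (.comp
        (.set 4 (.lit r) (o.expr (.get 4 (.lit r)) (.get 4 (.lit (r + 2)))))
        (.set 3 (.lit (v + 1)) (.add (.get 3 (.lit (v + 1))) (.lit 1))))))
      (.set 3 (.lit (v + 1)) (.get 4 (.lit (r + 1)))))))

/-- The value of a term does not depend on the temporaries. -/
theorem Term.eval_congr {s s' : Store} (h : ∀ k ≠ 4, s' k = s k) (t : Term) :
    t.eval s' = t.eval s := by
  induction t generalizing s s' with
  | lit n => rfl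
  | get k t ih => simp only [Term.eval, ih h, h k (by have := k.2; omega)]
  | bin o t u iht ihu => simp only [Term.eval, iht h, ihu h]
  | ite c t u ihc iht ihu => simp only [Term.eval, ihc h, iht h, ihu h]
  | fold o n v t ih =>
    have h1 : ∀ i, t.eval (s'.write 3 (v + 1) i) = t.eval (s.write 3 (v + 1) i) := fun i => by
      refine ih fun k hk => ?_
      by_cases hk3 : k = 3
      · subst hk3; rw [Store.write_same, Store.write_same, h 3 hk]
      · rw [Store.write_of_ne _ hk3, Store.write_of_ne _ hk3, h k hk]
    simp only [Term.eval, h1, h 3 (by decide)]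

/-- All values outside of the bank of temporaries have at most `M` bits, and iterations have at most
`M` rounds. -/
def Store.Bounded (M : ℕ) (s : Store) : Prop := (∀ k ≠ 4, ∀ i, s k i < 2 ^ M) ∧ s 3 0 ≤ M

theorem Store.Bounded.congr {M : ℕ} {s s' : Store} (hs : s.Bounded M) (h : ∀ k ≠ 4, s' k = s k) :
    s'.Bounded M :=
  ⟨fun k hk i => by rw [h k hk]; exact hs.1 k hk i, by rw [h 3 (by decide)]; exact hs.2⟩

theorem Store.Bounded.update {M : ℕ} {s s' : Store} (hs : s.Bounded M) {v i : ℕ} (hi : i ≤ M)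
    (h3 : s' 3 = Function.update (s 3) (v + 1) i) (h : ∀ k ≠ 3, k ≠ 4 → s' k = s k) :
    s'.Bounded M := by
  refine ⟨fun k hk j => ?_, ?_⟩
  · by_cases hk3 : k = 3
    · subst hk3
      rw [h3, Function.update_apply]
      split_ifs
      · exact hi.trans_lt Nat.lt_two_pow_self
      · exact hs.1 3 hk j
    · rw [h k hk3 hk]; exact hs.1 k hk j
  · rw [h3, Function.update_of_ne (by omega)]; exact hs.2

/-- The effect of a program that computes the value `x` in the temporary cell `r`. -/
def Yields (s : Store) (r x : ℕ) (s' : Store) : Prop :=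
  (∀ k ≠ 4, s' k = s k) ∧ (∀ j < r, s' 4 j = s 4 j) ∧ s' 4 r = x

/-- A term is computed in polynomial time, with a result of polynomial size. -/
def Term.Poly (t : Term) (r : ℕ) : Prop :=
  ∃ q : Polynomial ℕ, ∀ (M : ℕ) (s : Store), s.Bounded M →
    t.eval s < 2 ^ q.eval M ∧ Halts (t.compile r) s (q.eval M) (Yields s r (t.eval s))

theorem Term.poly_lit (n r : ℕ) : (Term.lit n).Poly r := by
  refine ⟨Polynomial.C (2 * r.size + 2 * n.size + n + 3), fun M s hs => ?_⟩
  rw [Polynomial.eval_C]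
  constructor
  · exact (Nat.lt_two_pow_self (n := n)).trans_le (Nat.pow_le_pow_right two_pos (by omega))
  · refine Halts.set ?_ ⟨fun k hk => Store.write_of_ne _ hk _ _, fun j hj => ?_, ?_⟩
    · simp only [Expr.cost, Expr.eval]; omega
    · rw [Store.write_same]; exact Function.update_of_ne hj.ne _ _
    · rw [Store.write_same]; exact Function.update_self _ _ _

theorem Term.poly_get (k : Fin 4) {t : Term} {r : ℕ} (ht : t.Poly r) : (Term.get k t).Poly r := by
  obtain ⟨q, hq⟩ := ht
  refine ⟨3 * q + 3 * Polynomial.X + Polynomial.C (5 * r.size + 10), fun M s hs => ?_⟩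
  have hk : (k : ℕ) ≠ 4 := by have := k.2; omega
  obtain ⟨h1, h2⟩ := hq M s hs
  have h3 := hs.1 k hk (t.eval s)
  have e : (3 * q + 3 * Polynomial.X + Polynomial.C (5 * r.size + 10)).eval M
      = 3 * q.eval M + 3 * M + (5 * r.size + 10) := by simp
  rw [e]
  constructor
  · exact h3.trans_le (Nat.pow_le_pow_right two_pos (by omega))
  · refine Halts.comp h2 (T₂ := 2 * q.eval M + 2 * M + (5 * r.size + 9)) ?_ (by omega)
    rintro s' ⟨h4, h5, h6⟩
    refine Halts.set ?_ ⟨fun l hl => ?_, fun j hj => ?_, ?_⟩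
    · have h7 := Nat.size_le.2 h1
      have h8 := Nat.size_le.2 h3
      simp only [Expr.cost, Expr.eval, h6, h4 k hk]
      omega
    · rw [Store.write_of_ne _ hl, h4 l hl]
    · rw [Store.write_same]; exact (Function.update_of_ne hj.ne _ _).trans (h5 j hj)
    · rw [Store.write_same]
      simp only [Expr.eval, Term.eval, Function.update_self, h6, h4 k hk]

theorem Term.poly_bin (o : Op) {t u : Term} {r : ℕ} (ht : t.Poly r) (hu : u.Poly (r + 1)) :
    (Term.bin o t u).Poly r := by
  obtain ⟨q, hq⟩ := ht
  obtain ⟨q', hq'⟩ := hu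
  refine ⟨5 * q + 5 * q' + (q + 1) * (q' + 1) + Polynomial.C (5 * r.size + 5 * (r + 1).size + 20),
    fun M s hs => ?_⟩
  obtain ⟨h1, h2⟩ := hq M s hs
  have h3 := (hq' M s hs).1
  have e : (5 * q + 5 * q' + (q + 1) * (q' + 1)
        + Polynomial.C (5 * r.size + 5 * (r + 1).size + 20)).eval M
      = 5 * q.eval M + 5 * q'.eval M + (q.eval M + 1) * (q'.eval M + 1)
        + (5 * r.size + 5 * (r + 1).size + 20) := by simp
  have h4 := o.fn_lt h1 h3
  rw [e]
  constructor
  · exact h4.trans_le (Nat.pow_le_pow_right two_pos (by omega))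
  · refine Halts.comp h2 (T₂ := 4 * q.eval M + 5 * q'.eval M + (q.eval M + 1) * (q'.eval M + 1)
        + (5 * r.size + 5 * (r + 1).size + 19)) ?_ (by omega)
    rintro s' ⟨h5, h6, h7⟩
    refine Halts.comp (hq' M s' (hs.congr h5)).2 (T₂ := 4 * q.eval M + 4 * q'.eval M
        + (q.eval M + 1) * (q'.eval M + 1)
        + (5 * r.size + 5 * (r + 1).size + 18)) ?_ (by omega)
    rintro s'' ⟨h8, h9, h10⟩
    rw [Term.eval_congr h5] at h10
    have h11 : s'' 4 r = t.eval s := by rw [h9 r (by omega), h7]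
    refine Halts.set ?_ ⟨fun l hl => ?_, fun j hj => ?_, ?_⟩
    · have h12 := Nat.size_le.2 h1
      have h13 := Nat.size_le.2 h3
      have h14 := Nat.size_le.2 h4
      have h15 := o.cost_expr s'' (.get 4 (.lit r)) (.get 4 (.lit (r + 1)))
      have h16 := Nat.mul_le_mul (Nat.succ_le_succ h12) (Nat.succ_le_succ h13)
      simp only [Expr.cost, Expr.eval, Op.eval_expr, h10, h11, Nat.succ_eq_add_one] at h15 h16 ⊢
      omega
    · rw [Store.write_of_ne _ hl, h8 l hl, h5 l hl]
    · rw [Store.write_same]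
      exact (Function.update_of_ne hj.ne _ _).trans ((h9 j (by omega)).trans (h6 j hj))
    · rw [Store.write_same]
      simp only [Expr.eval, Op.eval_expr, Term.eval, Function.update_self, h10, h11]

theorem Term.poly_ite {c t u : Term} {r : ℕ} (hc : c.Poly r) (ht : t.Poly r) (hu : u.Poly r) :
    (Term.ite c t u).Poly r := by
  obtain ⟨q, hq⟩ := hc
  obtain ⟨q₁, hq₁⟩ := ht
  obtain ⟨q₂, hq₂⟩ := hu
  refine ⟨2 * q + q₁ + q₂ + Polynomial.C (2 * r.size + 5), fun M s hs => ?_⟩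
  obtain ⟨h1, h2⟩ := hq M s hs
  have e : (2 * q + q₁ + q₂ + Polynomial.C (2 * r.size + 5)).eval M
      = 2 * q.eval M + q₁.eval M + q₂.eval M + (2 * r.size + 5) := by simp
  rw [e]
  constructor
  · rw [Term.eval]
    split_ifs
    · exact (hq₂ M s hs).1.trans_le (Nat.pow_le_pow_right two_pos (by omega))
    · exact (hq₁ M s hs).1.trans_le (Nat.pow_le_pow_right two_pos (by omega))
  · refine Halts.comp h2 (T₂ := q.eval M + q₁.eval M + q₂.eval M + (2 * r.size + 4)) ?_ (by omega)
    rintro s' ⟨h5, h6, h7⟩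
    refine Halts.cond (T' := q₁.eval M + q₂.eval M) (fun h => ?_) (fun h => ?_) ?_
    · refine (hq₁ M s' (hs.congr h5)).2.imp (by omega) ?_
      rintro s'' ⟨h8, h9, h10⟩
      simp only [Expr.eval, h7] at h
      refine ⟨fun l hl => by rw [h8 l hl, h5 l hl], fun j hj => by rw [h9 j hj, h6 j hj], ?_⟩
      rw [h10, Term.eval_congr h5, Term.eval, if_neg h]
    · refine (hq₂ M s' (hs.congr h5)).2.imp (by omega) ?_
      rintro s'' ⟨h8, h9, h10⟩
      simp only [Expr.eval, h7] at h
      refine ⟨fun l hl => by rw [h8 l hl, h5 l hl], fun j hj => by rw [h9 j hj, h6 j hj], ?_⟩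
      rw [h10, Term.eval_congr h5, Term.eval, if_pos h]
    · have h12 := Nat.size_le.2 h1
      simp only [Expr.cost, Expr.eval, h7]
      omega

/-- The value of an iteration after `i` rounds. -/
def foldVal (o : Op) (n v : ℕ) (t : Term) (s : Store) (i : ℕ) : ℕ :=
  Nat.rec n (fun i acc => o.fn acc (t.eval (s.write 3 (v + 1) i))) i

theorem bounded_write {M : ℕ} {s : Store} (hs : s.Bounded M) (v : ℕ) {i : ℕ} (hi : i ≤ M) :
    (s.write 3 (v + 1) i).Bounded M :=
  hs.update hi (Store.write_same _ _ _ _) fun _ hk _ => Store.write_of_ne _ hk _ _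

theorem foldVal_lt (o : Op) (n v : ℕ) {t : Term} {s : Store} {M Q : ℕ} (hs : s.Bounded M)
    (ht : ∀ s : Store, s.Bounded M → t.eval s < 2 ^ Q) {i : ℕ} (hi : i ≤ M) :
    foldVal o n v t s i < 2 ^ (n + i * (Q + 1)) := by
  induction i with
  | zero => simpa [foldVal] using Nat.lt_two_pow_self
  | succ i ih =>
    have h := o.fn_lt (ih (by omega)) (ht _ (bounded_write hs v (i := i) (by omega)))
    refine h.trans_le (Nat.pow_le_pow_right two_pos ?_)
    rw [add_mul i]
    omega

theorem Term.poly_fold (o : Op) (n v : ℕ) {t : Term} {r : ℕ} (ht : t.Poly (r + 2)) :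
    (Term.fold o n v t).Poly r := by
  obtain ⟨q, hq⟩ := ht
  set A := Polynomial.C n + Polynomial.X * (q + 1) with hA
  -- `A` bounds the bits of the partial results, `2 * W` the cost of a round or an assignment.
  set K := 9 * r.size + 9 * (r + 1).size + 9 * (r + 2).size + 9 * (v + 1).size + 9 * n.size + 50
    with hK
  set W := 3 * A + 5 * q + 9 * Polynomial.X + (A + 1) * (q + 1) + Polynomial.C K with hW
  refine ⟨(Polynomial.X + 3) * (2 * W), fun M s hs => ?_⟩
  have eA : A.eval M = n + M * (q.eval M + 1) := by simp [hA]
  have eW : W.eval M = 3 * A.eval M + 5 * q.eval M + 9 * M + (A.eval M + 1) * (q.eval M + 1) + K := by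
    simp [hW]
  have e : ((Polynomial.X + 3) * (2 * W)).eval M = (M + 3) * (2 * W.eval M) := by simp
  rw [e]
  generalize W.eval M = w at eW ⊢
  generalize A.eval M = α at eA eW
  have hval : ∀ i ≤ M, foldVal o n v t s i < 2 ^ α := fun i hi =>
    (foldVal_lt o n v hs (fun s hs => (hq M s hs).1) hi).trans_le
      (Nat.pow_le_pow_right two_pos (by
        rw [eA]; exact Nat.add_le_add_left (Nat.mul_le_mul_right _ hi) _))
  have hN := hs.2
  have hw : (M + 3) * (2 * w) = (M + 1) * (2 * w) + 4 * w := by ring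
  have h2M : 2 * w ≤ (M + 1) * (2 * w) := Nat.le_mul_of_pos_left _ (by omega)
  have h1M : 2 ^ α ≤ 2 ^ ((M + 3) * (2 * w)) := Nat.pow_le_pow_right two_pos (by omega)
  refine ⟨(hval _ hN).trans_le h1M, ?_⟩
  have hsz3 : ∀ j, (s 3 j).size ≤ M := fun j => Nat.size_le.2 (hs.1 3 (by decide) j)
  let I : ℕ → Store → Prop := fun i s' => (∀ k ≠ 3, k ≠ 4 → s' k = s k) ∧
    s' 3 = Function.update (s 3) (v + 1) i ∧ (∀ j < r, s' 4 j = s 4 j) ∧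
    s' 4 r = foldVal o n v t s i ∧ s' 4 (r + 1) = s 3 (v + 1)
  have hI0 : ∀ i s', I i s' → s' 3 0 = s 3 0 := fun i s' h => by
    rw [h.2.1, Function.update_of_ne (by omega)]
  have hI1 : ∀ i s', I i s' → s' 3 (v + 1) = i := fun i s' h => by
    rw [h.2.1, Function.update_self]
  have hsize : ∀ i ≤ M, i.size ≤ M := fun i hi =>
    Nat.size_le.2 (Nat.lt_two_pow_self.trans_le (Nat.pow_le_pow_right two_pos hi))
  have hsz1 : Nat.size 1 = 1 := by simp
  have hsz0 : Nat.size 0 = 0 := by simp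
  -- the initial assignments
  refine Halts.comp (T₁ := w - 1) (Q₁ := fun s' => (∀ k ≠ 4, s' k = s k) ∧
    (∀ j < r, s' 4 j = s 4 j) ∧ s' 4 r = n) (Halts.set ?_ ⟨?_, ?_, ?_⟩)
    (T₂ := (M + 1) * (2 * w) + 3 * w) ?_ (by omega)
  · simp only [Expr.cost, Expr.eval]; omega
  · exact fun k hk => Store.write_of_ne _ hk _ _
  · intro j hj; rw [Store.write_same]; exact Function.update_of_ne hj.ne _ _
  · rw [Store.write_same]; exact Function.update_self _ _ _
  rintro s₁ ⟨a1, a2, a3⟩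
  refine Halts.comp (T₁ := w - 1) (Q₁ := fun s' => (∀ k ≠ 4, s' k = s k) ∧
    (∀ j < r, s' 4 j = s 4 j) ∧ s' 4 r = n ∧ s' 4 (r + 1) = s 3 (v + 1))
    (Halts.set ?_ ⟨?_, ?_, ?_, ?_⟩) (T₂ := (M + 1) * (2 * w) + 2 * w) ?_ (by omega)
  · have := hsz3 (v + 1)
    simp only [Expr.cost, Expr.eval, a1 3 (by decide)]; omega
  · exact fun k hk => (Store.write_of_ne _ hk _ _).trans (a1 k hk)
  · intro j hj
    rw [Store.write_same]
    exact (Function.update_of_ne (by simp only [Expr.eval]; omega) _ _).trans (a2 j hj)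
  · rw [Store.write_same]
    exact (Function.update_of_ne (by simp only [Expr.eval]; omega) _ _).trans a3
  · rw [Store.write_same]
    simp only [Expr.eval, Function.update_self, a1 3 (by decide)]
  rintro s₂ ⟨b1, b2, b3, b4⟩
  refine Halts.comp (T₁ := w - 1) (Q₁ := I 0)
    (Halts.set ?_ ⟨?_, ?_, ?_, ?_, ?_⟩) (T₂ := (M + 1) * (2 * w) + w) ?_ (by omega)
  · simp only [Expr.cost, Expr.eval]; omega
  · exact fun k hk hk4 => (Store.write_of_ne _ hk _ _).trans (b1 k hk4)
  · rw [Store.write_same, b1 3 (by decide)]; rfl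
  · intro j hj; rw [Store.write_of_ne _ (by decide), b2 j hj]
  · rw [Store.write_of_ne _ (by decide), b3]; rfl
  · rw [Store.write_of_ne _ (by decide), b4]
  intro s₃ hs₃
  refine Halts.comp (T₁ := (M + 1) * (2 * w)) (Q₁ := I (s 3 0)) (T₂ := w - 1) ?_ ?_ (by omega)
  · refine Halts.loop (T₁ := w) (T₂ := w - 1) I hs₃ ?_ ?_ ?_ ?_
    · intro i hi s' hs'
      refine ⟨?_, ?_⟩
      · simp only [Expr.eval, hI0 i s' hs', hI1 i s' hs']; omega
      have hb : s'.Bounded M := hs.update (by omega) hs'.2.1 hs'.1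
      obtain ⟨h1, h2⟩ := hq M s' hb
      have hev : t.eval s' = t.eval (s.write 3 (v + 1) i) := by
        refine Term.eval_congr (fun k hk => ?_) t
        by_cases hk3 : k = 3
        · subst hk3; rw [hs'.2.1, Store.write_same]
        · rw [Store.write_of_ne _ hk3, hs'.1 k hk3 hk]
      refine Halts.comp h2 (T₂ := w - q.eval M - 1) ?_ (by omega)
      rintro s₄ ⟨c1, c2, c3⟩
      have c4 : s₄ 4 r = foldVal o n v t s i := by rw [c2 r (by omega), hs'.2.2.2.1]
      refine Halts.comp (T₁ := 3 * α + 3 * q.eval M + (α + 1) * (q.eval M + 1) + 5 * r.size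
        + 5 * (r + 2).size + 10) (Q₁ := fun s' => (∀ k ≠ 3, k ≠ 4 → s' k = s k) ∧
          s' 3 = Function.update (s 3) (v + 1) i ∧ (∀ j < r, s' 4 j = s 4 j) ∧
          s' 4 r = foldVal o n v t s (i + 1) ∧ s' 4 (r + 1) = s 3 (v + 1))
        (Halts.set ?_ ⟨?_, ?_, ?_, ?_, ?_⟩)
        (T₂ := 4 * M + 6 * (v + 1).size + 20) ?_ (by omega)
      · have h12 := Nat.size_le.2 (hval i (by omega))
        have h13 := Nat.size_le.2 h1
        have h14 := Nat.size_le.2 (hval (i + 1) (by omega))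
        have h15 := o.cost_expr s₄ (.get 4 (.lit r)) (.get 4 (.lit (r + 2)))
        have h16 := Nat.mul_le_mul (Nat.succ_le_succ h12) (Nat.succ_le_succ h13)
        have h17 : o.fn (foldVal o n v t s i) (t.eval s') = foldVal o n v t s (i + 1) := by
          rw [hev]; rfl
        simp only [Expr.cost, Expr.eval, Op.eval_expr, c3, c4, Nat.succ_eq_add_one, h17]
          at h15 h16 ⊢
        omega
      · exact fun k hk hk4 => (Store.write_of_ne _ hk4 _ _).trans ((c1 k hk4).trans (hs'.1 k hk hk4))
      · rw [Store.write_of_ne _ (by decide), c1 3 (by decide), hs'.2.1]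
      · intro j hj
        rw [Store.write_same]
        exact (Function.update_of_ne hj.ne _ _).trans ((c2 j (by omega)).trans (hs'.2.2.1 j hj))
      · rw [Store.write_same]
        simp only [Expr.eval, Op.eval_expr, Function.update_self, c3, c4, hev]
        rfl
      · rw [Store.write_same]
        exact (Function.update_of_ne (by simp only [Expr.eval]; omega) _ _).trans
          ((c2 _ (by omega)).trans hs'.2.2.2.2)
      rintro s₅ ⟨d1, d2, d3, d4, d5⟩
      have d6 : s₅ 3 (v + 1) = i := by rw [d2, Function.update_self]
      refine Halts.set ?_ ⟨?_, ?_, ?_, ?_, ?_⟩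
      · have h12 := hsize i (by omega)
        have h13 := hsize (i + 1) (by omega)
        simp only [Expr.cost, Expr.eval, d6]
        omega
      · exact fun k hk hk4 => (Store.write_of_ne _ hk _ _).trans (d1 k hk hk4)
      · rw [Store.write_same, d2]
        simp only [Expr.eval, d6, Function.update_idem]
      · intro j hj; rw [Store.write_of_ne _ (by decide), d3 j hj]
      · rw [Store.write_of_ne _ (by decide), d4]
      · rw [Store.write_of_ne _ (by decide), d5]
    · intro s' hs'
      simp only [Expr.eval, hI0 _ s' hs', hI1 _ s' hs', Nat.sub_self]
    · intro i hi s' hs'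
      have h12 := hsize i (by omega)
      have h13 := hsz3 0
      simp only [Expr.cost, Expr.eval, hI0 _ s' hs', hI1 _ s' hs']
      omega
    · have : w + (w - 1) + 1 = 2 * w := by omega
      rw [this]
      exact Nat.mul_le_mul_right _ (by omega)
  -- the variable is restored
  rintro s₄ ⟨c1, c2, c3, c4, c5⟩
  refine Halts.set ?_ ⟨?_, ?_, ?_⟩
  · have := hsz3 (v + 1)
    simp only [Expr.cost, Expr.eval, c5]
    omega
  · intro k hk
    by_cases hk3 : k = 3
    · subst hk3
      rw [Store.write_same, c2]
      simp only [Expr.eval, c5, Function.update_idem, Function.update_eq_self]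
    · rw [Store.write_of_ne _ hk3, c1 k hk3 hk]
  · intro j hj; rw [Store.write_of_ne _ (by decide), c3 j hj]
  · rw [Store.write_of_ne _ (by decide), c4]
    rfl

/-- Structural induction; the polynomial depends on the term, but not on the store. -/
theorem Term.poly (t : Term) (r : ℕ) : t.Poly r := by
  induction t generalizing r with
  | lit n => exact Term.poly_lit n r
  | get k t ih => exact Term.poly_get k (ih r)
  | bin o t u iht ihu => exact Term.poly_bin o (iht r) (ihu (r + 1))
  | ite c t u ihc iht ihu => exact Term.poly_ite (ihc r) (iht r) (ihu r)
  | fold o n v t ih => exact Term.poly_fold o n v (ih (r + 2))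

end RAM

/-! ### Programs that fill a table -/

namespace RAM

/-- The program that stores the value of a term in cell `v` of bank `3`. -/
def assign (v : ℕ) (t : Term) : Prog :=
  .comp (t.compile 0) (.set 3 (.lit v) (.get 4 (.lit 0)))

/-- The program that stores, for `i = 0, 1, …`, the value of a term in cell `i` of bank `k`. The
index `i` is kept in cell `1` and the number of entries in cell `2` of bank `3`. -/
def fill (k : ℕ) (t : Term) : Prog :=
  .comp (.set 3 (.lit 1) (.lit 0))
    (.loop (.sub (.get 3 (.lit 2)) (.get 3 (.lit 1))) (.comp (t.compile 0)
      (.comp (.set k (.get 3 (.lit 1)) (.get 4 (.lit 0)))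
        (.set 3 (.lit 1) (.add (.get 3 (.lit 1)) (.lit 1))))))

theorem halts_assign (v : ℕ) (t : Term) : ∃ q : Polynomial ℕ, ∀ (M x : ℕ) (s : Store),
    s.Bounded M → t.eval s = x → Halts (assign v t) s (q.eval M) fun s' =>
      (∀ k ≠ 3, k ≠ 4 → s' k = s k) ∧ s' 3 = Function.update (s 3) v x := by
  obtain ⟨q, hq⟩ := t.poly 0
  refine ⟨4 * q + Polynomial.C (3 * v.size + 20), fun M x s hs hx => ?_⟩
  obtain ⟨h1, h2⟩ := hq M s hs
  have e : (4 * q + Polynomial.C (3 * v.size + 20)).eval M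
      = 4 * q.eval M + (3 * v.size + 20) := by simp
  rw [e]
  refine Halts.comp h2 (T₂ := 3 * q.eval M + (3 * v.size + 19)) ?_ (by omega)
  rintro s' ⟨h3, -, h4⟩
  refine Halts.set ?_ ⟨fun k hk hk4 => ?_, ?_⟩
  · have h5 := Nat.size_le.2 h1
    have h6 : Nat.size 0 = 0 := by simp
    simp only [Expr.cost, Expr.eval, h4]
    omega
  · rw [Store.write_of_ne _ hk, h3 k hk4]
  · rw [Store.write_same, h3 3 (by decide)]
    simp only [Expr.eval, h4, hx]

theorem halts_fill (t : Term) : ∃ q : Polynomial ℕ, ∀ (k M K : ℕ) (s : Store) (f : ℕ → ℕ),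
    k = 1 ∨ k = 2 → s.Bounded M → s 3 2 = K → K ≤ M → (∀ i < K, f i < 2 ^ M) →
    (∀ i < K, ∀ s' : Store, (∀ l ≠ 3, l ≠ 4 → l ≠ k → s' l = s l) →
      s' 3 = Function.update (s 3) 1 i → s' k = (fun j => if j < i then f j else s k j) →
      t.eval s' = f i) →
    Halts (fill k t) s (q.eval M) fun s' => (∀ l ≠ 3, l ≠ 4 → l ≠ k → s' l = s l) ∧
      s' 3 = Function.update (s 3) 1 K ∧ s' k = fun j => if j < K then f j else s k j := by
  obtain ⟨q, hq⟩ := t.poly 0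
  refine ⟨(Polynomial.X + 3) * (q + 30 * Polynomial.X + 60), fun k M K s f hk hs hK hKM hf hev => ?_⟩
  have e : ((Polynomial.X + 3) * (q + 30 * Polynomial.X + 60)).eval M
      = (M + 3) * (q.eval M + 30 * M + 60) := by simp
  rw [e]
  have hk3 : k ≠ 3 := by omega
  have hk4 : k ≠ 4 := by omega
  let I : ℕ → Store → Prop := fun i s' => (∀ l ≠ 3, l ≠ 4 → l ≠ k → s' l = s l) ∧
      s' 3 = Function.update (s 3) 1 i ∧ s' k = fun j => if j < i then f j else s k j
  have hI1 : ∀ i s', I i s' → s' 3 1 = i := fun i s' h => by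
    rw [h.2.1, Function.update_self]
  have hI2 : ∀ i s', I i s' → s' 3 2 = K := fun i s' h => by
    rw [h.2.1, Function.update_of_ne (by omega), hK]
  have hIb : ∀ i ≤ K, ∀ s', I i s' → s'.Bounded M := fun i hi s' h => by
    refine ⟨fun l hl j => ?_, ?_⟩
    · by_cases hl3 : l = 3
      · subst hl3
        rw [h.2.1, Function.update_apply]
        split_ifs
        · exact (hi.trans hKM).trans_lt Nat.lt_two_pow_self
        · exact hs.1 3 hl j
      by_cases hlk : l = k
      · subst hlk
        rw [h.2.2]
        beta_reduce
        split_ifs with hj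
        · exact hf j (by omega)
        · exact hs.1 l hl j
      · rw [h.1 l hl3 hl hlk]; exact hs.1 l hl j
    · rw [h.2.1, Function.update_of_ne (by omega)]; exact hs.2
  have hsize : ∀ i ≤ M, i.size ≤ M := fun i hi =>
    Nat.size_le.2 (Nat.lt_two_pow_self.trans_le (Nat.pow_le_pow_right two_pos hi))
  have hsz0 : Nat.size 0 = 0 := by simp
  have hsz1 : Nat.size 1 = 1 := by simp
  have hsz2 : Nat.size 2 = 2 := by decide
  have hw : (M + 3) * (q.eval M + 30 * M + 60) = (M + 1) * (q.eval M + 30 * M + 60)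
    + 2 * (q.eval M + 30 * M + 60) := by ring
  refine Halts.comp (T₁ := 20) (Q₁ := I 0) (T₂ := (M + 1) * (q.eval M + 30 * M + 60))
    (Halts.set ?_ ⟨?_, ?_, ?_⟩) ?_ (by omega)
  · simp only [Expr.cost, Expr.eval]; omega
  · exact fun l hl _ _ => Store.write_of_ne _ hl _ _
  · rw [Store.write_same]; rfl
  · rw [Store.write_of_ne _ hk3]; simp
  intro s₁ hs₁
  refine Halts.loop (n := K) (T₁ := q.eval M + 20 * M + 40) (T₂ := 5 * M + 19) I hs₁ ?_ ?_ ?_ ?_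
  · intro i hi s' hs'
    refine ⟨by simp only [Expr.eval, hI1 i s' hs', hI2 i s' hs']; omega, ?_⟩
    obtain ⟨h1, h2⟩ := hq M s' (hIb i hi.le s' hs')
    have hv := hev i hi s' hs'.1 hs'.2.1 hs'.2.2
    refine Halts.comp h2 (T₂ := 20 * M + 39) ?_ (by omega)
    rintro s₂ ⟨h3, -, h4⟩
    have h5 : s₂ 3 1 = i := by rw [h3 3 (by decide), hI1 i s' hs']
    have h6 := hsize i (by omega)
    refine Halts.comp (T₁ := 7 * M + 14) (Q₁ := fun s'' =>
        (∀ l ≠ 3, l ≠ 4 → l ≠ k → s'' l = s l) ∧ s'' 3 = Function.update (s 3) 1 i ∧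
        s'' k = fun j => if j < i + 1 then f j else s k j) (T₂ := 13 * M + 24)
      (Halts.set ?_ ⟨?_, ?_, ?_⟩) ?_ (by omega)
    · have h7 := Nat.size_le.2 (hf i hi)
      simp only [Expr.cost, Expr.eval, h4, h5, hv]
      omega
    · intro l hl hl4 hlk
      rw [Store.write_of_ne _ hlk, h3 l hl4, hs'.1 l hl hl4 hlk]
    · rw [Store.write_of_ne _ hk3.symm, h3 3 (by decide), hs'.2.1]
    · rw [Store.write_same, h3 k hk4, hs'.2.2]
      simp only [Expr.eval, h4, h5, hv]
      funext j
      rw [Function.update_apply]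
      by_cases hj : j = i
      · subst hj; simp
      · rw [if_neg hj]
        by_cases hj' : j < i
        · rw [if_pos hj', if_pos (by omega)]
        · rw [if_neg hj', if_neg (by omega)]
    rintro s₃ ⟨d1, d2, d3⟩
    have d4 : s₃ 3 1 = i := by rw [d2, Function.update_self]
    refine Halts.set ?_ ⟨?_, ?_, ?_⟩
    · have h7 := hsize (i + 1) (by omega)
      simp only [Expr.cost, Expr.eval, d4]
      omega
    · exact fun l hl hl4 hlk => (Store.write_of_ne _ hl _ _).trans (d1 l hl hl4 hlk)
    · rw [Store.write_same, d2]
      simp only [Expr.eval, d4, Function.update_idem]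
    · rw [Store.write_of_ne _ hk3, d3]
  · intro s' hs'
    simp only [Expr.eval, hI1 _ s' hs', hI2 _ s' hs', Nat.sub_self]
  · intro i hi s' hs'
    have h12 := hsize i (by omega)
    have h13 := hsize K hKM
    simp only [Expr.cost, Expr.eval, hI1 _ s' hs', hI2 _ s' hs']
    omega
  · exact Nat.mul_le_mul (by omega) (by omega)

/-- A dynamic program: the bound `N` is computed from the input, then a table with `N ^ 3` entries
is filled, each entry being computed from the input and the previous entries by the term `τ`, and
finally the output is computed from the input and the table. -/
theorem exists_prog_of_table (EN τ EL ω : Term) : ∃ (A : Prog) (q : Polynomial ℕ),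
    ∀ (xs : List ℕ) (M N L : ℕ) (f g : ℕ → ℕ),
    N ^ 3 ≤ M → L ≤ M → xs.length < 2 ^ M → (∀ x ∈ xs, x < 2 ^ M) →
    (∀ i < N ^ 3, f i < 2 ^ M) → (∀ i < L, g i < 2 ^ M) →
    (∀ s : Store, s 0 = load xs 0 → EN.eval s = N) →
    (∀ s : Store, s 0 = load xs 0 → s 3 0 = N → EL.eval s = L) →
    (∀ (s : Store) (i : ℕ), i < N ^ 3 → s 0 = load xs 0 → s 3 0 = N → s 3 1 = i →
      (∀ j < i, s 2 j = f j) → τ.eval s = f i) →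
    (∀ (s : Store) (i : ℕ), i < L → s 0 = load xs 0 → s 3 0 = N → s 3 1 = i →
      (∀ j < N ^ 3, s 2 j = f j) → ω.eval s = g i) →
    ComputesWithin A xs ((List.range L).map g) (q.eval M) := by
  obtain ⟨q₁, h₁⟩ := halts_assign 0 EN
  obtain ⟨q₂, h₂⟩ := halts_assign 2
    (.bin .mul (.bin .mul (.get 3 (.lit 0)) (.get 3 (.lit 0))) (.get 3 (.lit 0)))
  obtain ⟨q₃, h₃⟩ := halts_fill τ
  obtain ⟨q₄, h₄⟩ := halts_assign 2 EL
  obtain ⟨q₅, h₅⟩ := halts_fill ω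
  refine ⟨.comp (assign 0 EN) (.comp (assign 2
      (.bin .mul (.bin .mul (.get 3 (.lit 0)) (.get 3 (.lit 0))) (.get 3 (.lit 0))))
      (.comp (fill 2 τ) (.comp (assign 2 EL) (fill 1 ω)))), q₁ + q₂ + q₃ + q₄ + q₅ + 4,
    fun xs M N L f g hN hL hx hx' hf hg hEN hEL hτ hω => ?_⟩
  have e : (q₁ + q₂ + q₃ + q₄ + q₅ + 4).eval M
      = q₁.eval M + q₂.eval M + q₃.eval M + q₄.eval M + q₅.eval M + 4 := by simp
  rw [e]
  have hNM : N ≤ M := (Nat.le_self_pow (by norm_num) N).trans hN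
  have hb0 : (load xs).Bounded M := by
    refine ⟨fun k _ i => ?_, Nat.zero_le _⟩
    rw [load]
    split_ifs
    · rcases i with _ | i
      · simpa using hx
      · rw [List.getD_cons_succ, List.getD_eq_getElem?_getD]
        rcases lt_or_ge i xs.length with hi | hi
        · rw [List.getElem?_eq_getElem hi]
          exact hx' _ (List.getElem_mem hi)
        · rw [List.getElem?_eq_none hi]
          simp
    · positivity
  have hupd : ∀ {s s' : Store} {v x : ℕ}, s.Bounded M → x ≤ M →
      (∀ k ≠ 3, k ≠ 4 → s' k = s k) → s' 3 = Function.update (s 3) v x → s'.Bounded M := by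
    intro s s' v x hs hx h1 h2
    refine ⟨fun k hk j => ?_, ?_⟩
    · by_cases hk3 : k = 3
      · subst hk3
        rw [h2, Function.update_apply]
        split_ifs
        · exact hx.trans_lt Nat.lt_two_pow_self
        · exact hs.1 3 hk j
      · rw [h1 k hk3 hk]; exact hs.1 k hk j
    · rw [h2, Function.update_apply]
      split_ifs
      · exact hx
      · exact hs.2
  suffices H : Halts (.comp (assign 0 EN) (.comp (assign 2
      (.bin .mul (.bin .mul (.get 3 (.lit 0)) (.get 3 (.lit 0))) (.get 3 (.lit 0))))
      (.comp (fill 2 τ) (.comp (assign 2 EL) (fill 1 ω))))) (load xs)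
      (q₁.eval M + q₂.eval M + q₃.eval M + q₄.eval M + q₅.eval M + 4) fun s =>
        s 1 = fun j => if j < L then g j else 0 by
    obtain ⟨s, c, h1, h2, h3⟩ := H
    refine ⟨s, c, h1, h2, h3.trans (funext fun j => ?_)⟩
    rw [List.getD_eq_getElem?_getD, List.getElem?_map]
    split_ifs with hj
    · rw [List.getElem?_range hj]; rfl
    · rw [List.getElem?_eq_none (by simpa using hj)]; rfl
  refine Halts.comp (h₁ M N _ hb0 (hEN _ rfl))
    (T₂ := q₂.eval M + q₃.eval M + q₄.eval M + q₅.eval M + 3) ?_ (by omega)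
  rintro s₁ ⟨a1, a2⟩
  have a3 : s₁ 3 0 = N := by rw [a2, Function.update_self]
  have a4 : s₁.Bounded M := hupd hb0 hNM a1 a2
  refine Halts.comp (h₂ M (N ^ 3) _ a4 (by simp only [Term.eval, Op.fn]; rw [← a3]; ring!))
    (T₂ := q₃.eval M + q₄.eval M + q₅.eval M + 2) ?_ (by omega)
  rintro s₂ ⟨b1, b2⟩
  have b3 : s₂ 3 0 = N := by rw [b2, Function.update_of_ne (by omega), a3]
  have b4 : s₂.Bounded M := hupd a4 hN b1 b2
  have b5 : s₂ 0 = load xs 0 := by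
    rw [b1 0 (by decide) (by decide), a1 0 (by decide) (by decide)]
  have b6 : s₂ 1 = fun _ => 0 := by
    rw [b1 1 (by decide) (by decide), a1 1 (by decide) (by decide)]; rfl
  refine Halts.comp (h₃ 2 M (N ^ 3) s₂ f (.inr rfl) b4 (by rw [b2, Function.update_self]) hN hf ?_)
    (T₂ := q₄.eval M + q₅.eval M + 1) ?_ (by omega)
  · intro i hi s' c1 c2 c3
    refine hτ s' i hi (by rw [c1 0 (by decide) (by decide) (by decide), b5])
      (by rw [c2, Function.update_of_ne (by omega), b3]) (by rw [c2, Function.update_self])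
      fun j hj => by rw [c3]; exact if_pos hj
  rintro s₃ ⟨c1, c2, c3⟩
  have c4 : s₃ 3 0 = N := by rw [c2, Function.update_of_ne (by omega), b3]
  have c5 : s₃.Bounded M := by
    refine ⟨fun k hk j => ?_, ?_⟩
    · by_cases hk3 : k = 3
      · subst hk3
        rw [c2, Function.update_apply]
        split_ifs
        · exact hN.trans_lt Nat.lt_two_pow_self
        · exact b4.1 3 hk j
      by_cases hk2 : k = 2
      · subst hk2
        rw [c3]
        beta_reduce
        split_ifs with hj
        · exact hf j hj
        · exact b4.1 2 hk j
      · rw [c1 k hk3 hk hk2]; exact b4.1 k hk j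
    · rw [c4]; exact hNM
  have c6 : s₃ 0 = load xs 0 := by rw [c1 0 (by decide) (by decide) (by decide), b5]
  refine Halts.comp (h₄ M L _ c5 (hEL _ c6 c4)) (T₂ := q₅.eval M) ?_ (by omega)
  rintro s₄ ⟨d1, d2⟩
  have d3 : s₄ 3 0 = N := by rw [d2, Function.update_of_ne (by omega), c4]
  have d6 : s₄ 0 = load xs 0 := by rw [d1 0 (by decide) (by decide), c6]
  have d7 : s₄ 1 = fun _ => 0 := by
    rw [d1 1 (by decide) (by decide), c1 1 (by decide) (by decide) (by decide), b6]
  refine (h₅ 1 M L s₄ g (.inl rfl) (hupd c5 hL d1 d2) (by rw [d2, Function.update_self]) hL hg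
    ?_).imp le_rfl ?_
  · intro i hi s' e1 e2 e3
    refine hω s' i hi (by rw [e1 0 (by decide) (by decide) (by decide), d6])
      (by rw [e2, Function.update_of_ne (by omega), d3]) (by rw [e2, Function.update_self])
      fun j hj => ?_
    rw [e1 2 (by decide) (by decide) (by decide), d1 2 (by decide) (by decide), c3]
    exact if_pos hj
  · rintro s' ⟨-, -, h⟩
    rw [h, d7]

end RAM

/-! ### Recursions for the coefficients -/

/-- The coefficient of `xⁿ yᵐ`. -/
def coeff₂ (n m : ℕ) (A : ℕ⟦X⟧⟦X⟧) : ℕ := PowerSeries.coeff n (PowerSeries.coeff m A)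

theorem coeff₂_natCast_mul (n m k : ℕ) (A : ℕ⟦X⟧⟦X⟧) :
    coeff₂ n m ((k : ℕ⟦X⟧⟦X⟧) * A) = k * coeff₂ n m A := by
  rw [coeff₂, coeff₂, ← map_natCast (PowerSeries.C (R := ℕ⟦X⟧)), PowerSeries.coeff_C_mul,
    ← map_natCast (PowerSeries.C (R := ℕ)), PowerSeries.coeff_C_mul, Nat.cast_id]

theorem coeff₂_shift (n m b : ℕ) (A : ℕ⟦X⟧⟦X⟧) :
    coeff₂ n m (((NavasBrin.x * NavasBrin.y) ^ 2) ^ b * A)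
      = if 2 * b ≤ n ∧ 2 * b ≤ m then coeff₂ (n - 2 * b) (m - 2 * b) A else 0 := by
  rw [coeff₂, coeff₂, ← pow_mul, mul_pow, NavasBrin.x, NavasBrin.y, ← map_pow, mul_assoc,
    PowerSeries.coeff_C_mul, PowerSeries.coeff_X_pow_mul', ite_and]
  split_ifs with h h'
  · rw [PowerSeries.coeff_X_pow_mul', if_pos h']
  · rw [PowerSeries.coeff_X_pow_mul', if_neg h', map_zero]
  · rfl

/-- Sums over an antidiagonal have the form that terms can express: a guarded sum over a range. -/
theorem sum_antidiagonal_eq_sum_range_ite {R : Type*} [AddCommMonoid R] (f : ℕ → ℕ → R) {n N : ℕ}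
    (h : n < N) : ∑ p ∈ Finset.HasAntidiagonal.antidiagonal n, f p.1 p.2
      = ∑ i ∈ Finset.range N, if i ≤ n then f i (n - i) else 0 := by
  rw [Finset.Nat.sum_antidiagonal_eq_sum_range_succ f, ← Finset.sum_filter]
  refine Finset.sum_congr ?_ fun _ _ => rfl
  ext i
  simp only [Finset.mem_range, Finset.mem_filter]
  omega

theorem coeff₂_mul {n m N : ℕ} (hn : n < N) (hm : m < N) (A B : ℕ⟦X⟧⟦X⟧) :
    coeff₂ n m (A * B) = ∑ i ∈ Finset.range N, ∑ p ∈ Finset.range N,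
      if i ≤ n then if p ≤ m then coeff₂ i p A * coeff₂ (n - i) (m - p) B else 0 else 0 := by
  rw [coeff₂, PowerSeries.coeff_mul, map_sum, sum_antidiagonal_eq_sum_range_ite
    (fun p q => PowerSeries.coeff n (PowerSeries.coeff p A * PowerSeries.coeff q B)) hm,
    Finset.sum_comm]
  refine Finset.sum_congr rfl fun p _ => ?_
  split_ifs with hp
  · rw [PowerSeries.coeff_mul, sum_antidiagonal_eq_sum_range_ite (fun i j => PowerSeries.coeff i
      (PowerSeries.coeff p A) * PowerSeries.coeff j (PowerSeries.coeff (m - p) B)) hn]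
    rfl
  · simp

theorem coeff₂_shift_mul {n m N : ℕ} (hn : n < N) (hm : m < N) (b : ℕ) (A B : ℕ⟦X⟧⟦X⟧) :
    coeff₂ n m (((NavasBrin.x * NavasBrin.y) ^ 2) ^ b * (A * B))
      = ∑ i ∈ Finset.range N, ∑ p ∈ Finset.range N,
        if 2 * b + i ≤ n then if 2 * b + p ≤ m then
          coeff₂ i p A * coeff₂ (n - (2 * b + i)) (m - (2 * b + p)) B else 0 else 0 := by
  rw [coeff₂_shift]
  split_ifs with h
  · rw [coeff₂_mul (N := N) (by omega) (by omega)]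
    refine Finset.sum_congr rfl fun i _ => Finset.sum_congr rfl fun p _ => ?_
    rw [Nat.sub_sub, Nat.sub_sub]
    exact if_congr (by omega) (if_congr (by omega) rfl rfl) rfl
  · refine (Finset.sum_eq_zero fun i _ => Finset.sum_eq_zero fun p _ => ?_).symm
    split_ifs
    · omega
    · rfl
    · rfl

theorem HasSum.coeff₂ {ι : Type*} {f : ι → ℕ⟦X⟧⟦X⟧} {s : ℕ⟦X⟧⟦X⟧} (h : HasSum f s) (n m : ℕ) :
    HasSum (fun i => coeff₂ n m (f i)) (coeff₂ n m s) :=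
  (PowerSeries.WithPiTopology.hasSum_iff_hasSum_coeff _).1
    ((PowerSeries.WithPiTopology.hasSum_iff_hasSum_coeff _).1 h m) n

namespace Walk

variable {α : Type u} {D : Type v} [Group D] (φ : α → D) {deg : α → ℕ}

variable (deg) in
/-- The number of `d`-tuples of nonnegative closed walks with balanced concatenation, of total
length `n` and with `m` steps. -/
def halfCount (d n m : ℕ) : ℕ :=
  coeff₂ n m (halfSeries φ (degWeight deg) (NavasBrin.x * NavasBrin.y) d)

theorem halfCount_zero (n m : ℕ) : halfCount φ deg 0 n m = if n + m = 0 then 1 else 0 := by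
  rw [halfCount, halfSeries_zero, coeff₂, PowerSeries.coeff_one]
  by_cases hm : m = 0
  · by_cases hn : n = 0
    · simp [hn, hm]
    · simp [hm, hn, PowerSeries.coeff_one]
  · simp [hm]

theorem trivCount_zero_zero : trivCount φ deg 0 0 = 1 := by
  rw [trivCount, Set.ncard_eq_one]
  refine ⟨[], Set.ext fun l => ?_⟩
  simp only [Set.mem_ofPred_eq, Set.mem_singleton_iff, List.length_eq_zero_iff]
  exact ⟨fun h => h.2.2, by rintro rfl; simp⟩

variable (hdeg : ∀ n, {a | deg a ≤ n}.Finite)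
include hdeg

theorem coeff₂_lampSeries (k i p : ℕ) : coeff₂ i p (lampSeries φ (degWeight deg) k)
    = (k + p).choose p * trivCount φ deg p i := by
  rw [lampSeries_deg φ hdeg, coeff₂, PowerSeries.coeff_mk, PowerSeries.coeff_mk, add_comm p,
    Nat.choose_symm_add]

theorem coeff₂_closedSeries (n m : ℕ) :
    coeff₂ n m (closedSeries φ (degWeight deg) (NavasBrin.x * NavasBrin.y))
      = closedCount φ deg n m := by
  rw [closedSeries_deg φ hdeg, coeff₂, PowerSeries.coeff_mk, PowerSeries.coeff_mk]

/-- The recursion `hasSum_halfSeries`, read coefficientwise. For `b = 0` the factor `halfCount 0` is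
the indicator of `n = m = 0`; for `b > 0` the length of the tuple on the right is less than `n`. -/
theorem halfCount_succ {n m N : ℕ} (hn : n < N) (hm : m < N) (c : ℕ) :
    halfCount φ deg (c + 1) n m = ∑ b ∈ Finset.range N, (b + c).choose c *
      ∑ i ∈ Finset.range N, ∑ p ∈ Finset.range N,
        if 2 * b + i ≤ n then if 2 * b + p ≤ m then
          (b + c + p).choose p * trivCount φ deg p i *
            halfCount φ deg b (n - (2 * b + i)) (m - (2 * b + p)) else 0 else 0 := by
  have h := (hasSum_halfSeries φ (summable_weight_deg hdeg) c).coeff₂ n m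
  have e : ∀ b, coeff₂ n m (((NavasBrin.x * NavasBrin.y) ^ 2) ^ b * ((b + c).choose c : ℕ⟦X⟧⟦X⟧)
        * lampSeries φ (degWeight deg) (b + c)
        * halfSeries φ (degWeight deg) (NavasBrin.x * NavasBrin.y) b)
      = (b + c).choose c * ∑ i ∈ Finset.range N, ∑ p ∈ Finset.range N,
        if 2 * b + i ≤ n then if 2 * b + p ≤ m then
          (b + c + p).choose p * trivCount φ deg p i *
            halfCount φ deg b (n - (2 * b + i)) (m - (2 * b + p)) else 0 else 0 := fun b => by
    rw [mul_right_comm _ ((b + c).choose c : ℕ⟦X⟧⟦X⟧), mul_right_comm _ ((b + c).choose c : ℕ⟦X⟧⟦X⟧),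
      mul_comm _ ((b + c).choose c : ℕ⟦X⟧⟦X⟧), coeff₂_natCast_mul, mul_assoc,
      coeff₂_shift_mul hn hm]
    simp only [coeff₂_lampSeries φ hdeg, halfCount]
  simp only [e] at h
  refine h.unique (hasSum_sum_of_ne_finset_zero fun b hb => ?_)
  rw [Finset.mem_range] at hb
  rw [Finset.sum_eq_zero, mul_zero]
  intro i _
  refine Finset.sum_eq_zero fun p _ => if_neg (by omega)

/-- One term of the recursion for the number of closed walks: `c` excursions below and `b`
excursions above the starting point. -/
theorem coeff₂_closed_term {n m N : ℕ} (hn : n < N) (hm : m < N) (c b : ℕ) :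
    coeff₂ n m (((NavasBrin.x * NavasBrin.y) ^ 2) ^ (c + b) * ((c + b).choose c : ℕ⟦X⟧⟦X⟧)
        * lampSeries φ (degWeight deg) (c + b)
        * halfSeries φ (degWeight deg) (NavasBrin.x * NavasBrin.y) b
        * halfSeries φ (degWeight deg) (NavasBrin.x * NavasBrin.y) c)
      = (b + c).choose c * ∑ i ∈ Finset.range N, ∑ p ∈ Finset.range N,
        if 2 * (b + c) + i ≤ n then if 2 * (b + c) + p ≤ m then
          (b + c + p).choose p * trivCount φ deg p i *
            ∑ i' ∈ Finset.range N, ∑ p' ∈ Finset.range N,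
              if i' ≤ n - (2 * (b + c) + i) then if p' ≤ m - (2 * (b + c) + p) then
                halfCount φ deg c i' p' * halfCount φ deg b (n - (2 * (b + c) + i) - i')
                  (m - (2 * (b + c) + p) - p') else 0 else 0 else 0 else 0 := by
  have e : ((NavasBrin.x * NavasBrin.y) ^ 2) ^ (c + b) * ((c + b).choose c : ℕ⟦X⟧⟦X⟧)
        * lampSeries φ (degWeight deg) (c + b)
        * halfSeries φ (degWeight deg) (NavasBrin.x * NavasBrin.y) b
        * halfSeries φ (degWeight deg) (NavasBrin.x * NavasBrin.y) c
      = ((c + b).choose c : ℕ⟦X⟧⟦X⟧) * (((NavasBrin.x * NavasBrin.y) ^ 2) ^ (c + b)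
        * (lampSeries φ (degWeight deg) (c + b)
        * (halfSeries φ (degWeight deg) (NavasBrin.x * NavasBrin.y) c
        * halfSeries φ (degWeight deg) (NavasBrin.x * NavasBrin.y) b))) := by ring
  rw [e, coeff₂_natCast_mul, coeff₂_shift_mul hn hm, add_comm c b]
  simp only [coeff₂_lampSeries φ hdeg, halfCount]
  congr 1
  refine Finset.sum_congr rfl fun i _ => Finset.sum_congr rfl fun p _ => ?_
  rw [coeff₂_mul (N := N) (by omega) (by omega)]

/-- The recursion `hasSum_closedSeries`, read coefficientwise. -/
theorem closedCount_eq {n m N : ℕ} (hn : n < N) (hm : m < N) :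
    closedCount φ deg n m = ∑ c ∈ Finset.range N, ∑ b ∈ Finset.range N, (b + c).choose c *
      ∑ i ∈ Finset.range N, ∑ p ∈ Finset.range N,
        if 2 * (b + c) + i ≤ n then if 2 * (b + c) + p ≤ m then
          (b + c + p).choose p * trivCount φ deg p i *
            ∑ i' ∈ Finset.range N, ∑ p' ∈ Finset.range N,
              if i' ≤ n - (2 * (b + c) + i) then if p' ≤ m - (2 * (b + c) + p) then
                halfCount φ deg c i' p' * halfCount φ deg b (n - (2 * (b + c) + i) - i')
                  (m - (2 * (b + c) + p) - p') else 0 else 0 else 0 else 0 := by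
  have h := (hasSum_closedSeries φ (summable_weight_deg hdeg)).coeff₂ n m
  rw [coeff₂_closedSeries φ hdeg] at h
  simp only [coeff₂_closed_term φ hdeg hn hm] at h
  rw [← Finset.sum_product']
  refine h.unique (hasSum_sum_of_ne_finset_zero fun q hq => ?_)
  rw [Finset.mem_product, Finset.mem_range, Finset.mem_range] at hq
  rw [Finset.sum_eq_zero, mul_zero]
  intro i _
  refine Finset.sum_eq_zero fun p _ => if_neg (by omega)

/-- The walks counted by `halfCount` are parts of closed walks. -/
theorem halfCount_le (d n m : ℕ) :
    halfCount φ deg d n m ≤ closedCount φ deg (n + 2 * d) (m + 2 * d) := by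
  have h := (hasSum_closedSeries φ (summable_weight_deg hdeg)).coeff₂ (n + 2 * d) (m + 2 * d)
  rw [coeff₂_closedSeries φ hdeg] at h
  refine le_trans ?_ (le_hasSum h (d, 0) fun _ _ => Nat.zero_le _)
  rw [add_zero, Nat.choose_self, Nat.cast_one, mul_one, halfSeries_zero, mul_one, mul_assoc,
    coeff₂_shift, if_pos (by omega), Nat.add_sub_cancel, Nat.add_sub_cancel,
    coeff₂_mul (N := n + m + 1) (by omega) (by omega)]
  refine le_trans ?_ (Finset.single_le_sum (fun _ _ => Nat.zero_le _)
    (Finset.mem_range.2 (Nat.succ_pos (n + m))))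
  refine le_trans ?_ (Finset.single_le_sum (fun _ _ => Nat.zero_le _)
    (Finset.mem_range.2 (Nat.succ_pos (n + m))))
  rw [if_pos (Nat.zero_le _), if_pos (Nat.zero_le _), coeff₂_lampSeries φ hdeg,
    trivCount_zero_zero φ, Nat.choose_zero_right, one_mul, one_mul, Nat.sub_zero, Nat.sub_zero,
    halfCount]

end Walk

/-! ### Terms for the recursions -/

namespace RAM

theorem Store.write_apply (s : Store) (k i v l j : ℕ) :
    s.write k i v l j = if l = k ∧ j = i then v else s l j := by
  by_cases hl : l = k
  · subst hl
    rw [Store.write_same, Function.update_apply]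
    simp
  · rw [Store.write_of_ne _ hl, if_neg fun h => hl h.1]

namespace Term

instance : Add Term := ⟨.bin .add⟩
instance : Sub Term := ⟨.bin .sub⟩
instance : Mul Term := ⟨.bin .mul⟩
instance : Div Term := ⟨.bin .div⟩

/-- The variable in cell `v` of bank `3`. -/
def var (v : ℕ) : Term := .get 3 (.lit v)

/-- The sum of the values of a term when the variable `v + 1` runs over `0, …, N - 1`. -/
def sum (v : ℕ) (t : Term) : Term := .fold .add 0 v t

/-- The product of the values of a term when the variable `v + 1` runs over `0, …, N - 1`. -/
def prod (v : ℕ) (t : Term) : Term := .fold .mul 1 v t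

/-- The value of `u` if `x ≤ y`, and `0` otherwise. -/
def guard (x y u : Term) : Term := .ite (y + .lit 1 - x) u (.lit 0)

/-- The binomial coefficient `C(x + y, y)`, where `x, y` do not mention the variable `30`. -/
def binom (x y : Term) : Term :=
  prod 29 (.ite (y - var 30) (x + .lit 1 + var 30) (.lit 1))
    / prod 29 (.ite (y - var 30) (var 30 + .lit 1) (.lit 1))

variable (s : Store)

@[simp] theorem eval_lit (n : ℕ) : (Term.lit n).eval s = n := rfl
@[simp] theorem eval_get (k : Fin 4) (t : Term) : (Term.get k t).eval s = s k (t.eval s) := rfl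
@[simp] theorem eval_add (t u : Term) : (t + u).eval s = t.eval s + u.eval s := rfl
@[simp] theorem eval_sub (t u : Term) : (t - u).eval s = t.eval s - u.eval s := rfl
@[simp] theorem eval_mul (t u : Term) : (t * u).eval s = t.eval s * u.eval s := rfl
@[simp] theorem eval_div (t u : Term) : (t / u).eval s = t.eval s / u.eval s := rfl
@[simp] theorem eval_ite (c t u : Term) :
    (Term.ite c t u).eval s = if c.eval s = 0 then u.eval s else t.eval s := rfl
@[simp] theorem eval_var (v : ℕ) : (var v).eval s = s 3 v := rfl

@[simp] theorem eval_sum (v : ℕ) (t : Term) :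
    (sum v t).eval s = ∑ i ∈ Finset.range (s 3 0), t.eval (s.write 3 (v + 1) i) := by
  rw [sum, Term.eval]
  induction s 3 0 with
  | zero => rfl
  | succ n ih => rw [Finset.sum_range_succ, ← ih]; rfl

@[simp] theorem eval_prod (v : ℕ) (t : Term) :
    (prod v t).eval s = ∏ i ∈ Finset.range (s 3 0), t.eval (s.write 3 (v + 1) i) := by
  rw [prod, Term.eval]
  induction s 3 0 with
  | zero => rfl
  | succ n ih => rw [Finset.prod_range_succ, ← ih]; rfl

@[simp] theorem eval_guard (x y u : Term) :
    (guard x y u).eval s = if x.eval s ≤ y.eval s then u.eval s else 0 := by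
  by_cases h : x.eval s ≤ y.eval s
  · rw [if_pos h]
    exact if_neg (show y.eval s + 1 - x.eval s ≠ 0 by omega)
  · rw [if_neg h]
    exact if_pos (show y.eval s + 1 - x.eval s = 0 by omega)

theorem prod_range_ite_lt (f : ℕ → ℕ) {k N : ℕ} (h : k ≤ N) :
    (∏ i ∈ Finset.range N, if k - i = 0 then 1 else f i) = ∏ i ∈ Finset.range k, f i := by
  have h1 : ∀ i, (if k - i = 0 then 1 else f i) = if i < k then f i else 1 := fun i => by
    split_ifs <;> first | rfl | omega
  simp only [h1]
  rw [← Finset.prod_filter]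
  refine Finset.prod_congr ?_ fun _ _ => rfl
  ext i
  simp only [Finset.mem_filter, Finset.mem_range]
  omega

theorem eval_binom {x y : Term} {a b : ℕ} (hx : ∀ i, x.eval (s.write 3 30 i) = a)
    (hy : ∀ i, y.eval (s.write 3 30 i) = b) (hb : b ≤ s 3 0) :
    (binom x y).eval s = (a + b).choose b := by
  simp only [binom, eval_div, eval_prod, eval_ite, eval_sub, eval_add, eval_lit, eval_var, hx, hy,
    Store.write_apply, and_self, if_true]
  rw [prod_range_ite_lt (fun i => a + 1 + i) hb, prod_range_ite_lt (fun i => i + 1) hb,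
    Finset.prod_range_add_one_eq_factorial, ← Nat.ascFactorial_eq_prod_range,
    Nat.choose_eq_asc_factorial_div_factorial]

/-- The entry of the table for the indices `n, m, d`. -/
def entry (n m d : Term) : Term := .get 2 ((n * var 0 + m) * var 0 + d)

/-- The number of `d`-tuples of nonnegative walks: an entry of the table, unless `d = 0`. -/
def half (d n m : Term) : Term := .ite d (entry n m d) (.ite (n + m) (.lit 0) (.lit 1))

/-- The first index of the current entry of the table. -/
def idx₁ : Term := var 1 / (var 0 * var 0)

/-- The second index of the current entry of the table. -/
def idx₂ : Term := var 1 / var 0 - var 0 * (var 1 / (var 0 * var 0))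

/-- The third index of the current entry of the table. -/
def idx₃ : Term := var 1 - var 0 * (var 1 / var 0)

/-- The right side of the recursion for the number of tuples of nonnegative walks. The term `J`
computes the number of trivial words with `p` letters and length `i`, where `i, p` are the
variables `6, 7`. -/
def halfStep (J : Term) : Term :=
  sum 3 (binom (var 4) (idx₃ - .lit 1) * sum 5 (sum 6
    (guard (.lit 2 * var 4 + var 6) idx₁ (guard (.lit 2 * var 4 + var 7) idx₂
      (binom (var 4 + (idx₃ - .lit 1)) (var 7) * J *
        half (var 4) (idx₁ - (.lit 2 * var 4 + var 6)) (idx₂ - (.lit 2 * var 4 + var 7)))))))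

/-- The right side of the recursion for the number of closed walks. -/
def closedStep (J : Term) : Term :=
  sum 4 (sum 3 (binom (var 4) (var 5) * sum 5 (sum 6
    (guard (.lit 2 * (var 4 + var 5) + var 6) idx₁ (guard (.lit 2 * (var 4 + var 5) + var 7) idx₂
      (binom (var 4 + var 5) (var 7) * J * sum 7 (sum 8
        (guard (var 8) (idx₁ - (.lit 2 * (var 4 + var 5) + var 6))
          (guard (var 9) (idx₂ - (.lit 2 * (var 4 + var 5) + var 7))
            (half (var 5) (var 8) (var 9) * half (var 4)
              (idx₁ - (.lit 2 * (var 4 + var 5) + var 6) - var 8)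
              (idx₂ - (.lit 2 * (var 4 + var 5) + var 7) - var 9)))))))))))

/-- The value of the current entry of the table. -/
def tableStep (J : Term) : Term := .ite idx₃ (halfStep J) (closedStep J)

end Term

end RAM

namespace Walk

open RAM

variable {α : Type u} {D : Type v} [Group D] (φ : α → D) (deg : α → ℕ)

/-- The entry with indices `n, m, d` of the table: the number of closed walks for `d = 0`, and the
number of `d`-tuples of nonnegative walks otherwise. -/
def tableVal (n m : ℕ) : ℕ → ℕ
  | 0 => closedCount φ deg n m
  | d + 1 => halfCount φ deg (d + 1) n m

/-- The store holds the input `inp`, the bound `N` and the entries of the table with first index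
less than `n`. -/
structure Ready (inp : ℕ → ℕ) (N n : ℕ) (s : Store) : Prop where
  input : s 0 = inp
  bound : s 3 0 = N
  table : ∀ n' < n, ∀ m < N, ∀ d < N, s 2 ((n' * N + m) * N + d) = tableVal φ deg n' m d

/-- The term `J` computes the numbers of trivial words. -/
def Computes (J : Term) (inp : ℕ → ℕ) (N : ℕ) : Prop :=
  ∀ (s : Store) (n i p : ℕ), Ready φ deg inp N n s → s 3 6 = i → s 3 7 = p → i ≤ n → n < N →
    p < N → J.eval s = trivCount φ deg p i

variable {φ deg}

theorem Ready.write {inp : ℕ → ℕ} {N n : ℕ} {s : Store} (h : Ready φ deg inp N n s) (v i : ℕ) :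
    Ready φ deg inp N n (s.write 3 (v + 1) i) :=
  ⟨by rw [Store.write_of_ne _ (by decide), h.input],
    by rw [Store.write_apply, if_neg (by omega), h.bound],
    by rw [Store.write_of_ne _ (by decide)]; exact h.table⟩

theorem Ready.eval_half {inp : ℕ → ℕ} {N n : ℕ} {s : Store} (h : Ready φ deg inp N n s)
    {td tn tm : Term} {d n' m : ℕ} (hd : td.eval s = d) (hn : tn.eval s = n') (hm : tm.eval s = m)
    (hn' : d ≠ 0 → n' < n) (hmN : m < N) (hdN : d < N) :
    (Term.half td tn tm).eval s = halfCount φ deg d n' m := by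
  simp only [Term.half, Term.entry, Term.eval_ite, Term.eval_get, Term.eval_add, Term.eval_mul,
    Term.eval_var, Term.eval_lit, hd, hn, hm, h.bound]
  cases d with
  | zero => simp [halfCount_zero]
  | succ d =>
    rw [if_neg d.succ_ne_zero]
    exact h.table n' (hn' d.succ_ne_zero) m hmN (d + 1) hdN

variable {inp : ℕ → ℕ} {N n m d : ℕ}

theorem index_div (hd : d < N) : ((n * N + m) * N + d) / N = n * N + m := by
  rw [mul_comm, Nat.mul_add_div (by omega), Nat.div_eq_of_lt hd, add_zero]

theorem index_div_div (hm : m < N) (hd : d < N) : ((n * N + m) * N + d) / (N * N) = n := by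
  rw [← Nat.div_div_eq_div_mul, index_div hd, mul_comm, Nat.mul_add_div (by omega),
    Nat.div_eq_of_lt hm, add_zero]

theorem eval_idx {s : Store} (h0 : s 3 0 = N) (h1 : s 3 1 = (n * N + m) * N + d) (hm : m < N)
    (hd : d < N) : Term.idx₁.eval s = n ∧ Term.idx₂.eval s = m ∧ Term.idx₃.eval s = d := by
  simp only [Term.idx₁, Term.idx₂, Term.idx₃, Term.eval_div, Term.eval_sub, Term.eval_mul,
    Term.eval_var, h0, h1, index_div hd, index_div_div hm hd, true_and]
  rw [mul_comm N n, mul_comm N]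
  omega

variable (hdeg : ∀ n, {a | deg a ≤ n}.Finite)
include hdeg

theorem eval_halfStep {J : Term} (hJ : Computes φ deg J inp N) {s : Store}
    (hs : Ready φ deg inp N n s) (h1 : s 3 1 = (n * N + m) * N + (d + 1)) (hn : n < N) (hm : m < N)
    (hd : d + 1 < N) : (Term.halfStep J).eval s = halfCount φ deg (d + 1) n m := by
  rw [halfCount_succ φ hdeg hn hm]
  simp only [Term.halfStep, Term.eval_sum, hs.bound]
  refine Finset.sum_congr rfl fun b hb => ?_
  have hs₁ := hs.write 3 b
  have hidx : ∀ s' : Store, s' 3 0 = N → s' 3 1 = s 3 1 → Term.idx₁.eval s' = n ∧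
      Term.idx₂.eval s' = m ∧ Term.idx₃.eval s' = d + 1 := fun s' h h' =>
    eval_idx h (h'.trans h1) hm hd
  rw [Finset.mem_range] at hb
  rw [Term.eval_mul, Term.eval_sum, Term.eval_binom (a := b) (b := d)]
  rotate_left
  · intro i; simp [Store.write_apply]
  · intro i
    have := hidx ((s.write 3 (3 + 1) b).write 3 30 i) (by simp [Store.write_apply, hs.bound])
      (by simp [Store.write_apply])
    simp [this]
  · rw [hs₁.bound]; omega
  rw [hs₁.bound]
  congr 1
  refine Finset.sum_congr rfl fun i hi => ?_
  have hs₂ := hs₁.write 5 i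
  rw [Term.eval_sum, hs₂.bound]
  refine Finset.sum_congr rfl fun p hp => ?_
  have hs₃ := hs₂.write 6 p
  rw [Finset.mem_range] at hi hp
  generalize hs' : ((s.write 3 (3 + 1) b).write 3 (5 + 1) i).write 3 (6 + 1) p = s' at hs₃
  obtain ⟨e1, e2, e3⟩ := hidx s' hs₃.bound (by rw [← hs']; simp [Store.write_apply])
  have v4 : s' 3 4 = b := by rw [← hs']; simp [Store.write_apply]
  have v6 : s' 3 6 = i := by rw [← hs']; simp [Store.write_apply]
  have v7 : s' 3 7 = p := by rw [← hs']; simp [Store.write_apply]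
  simp only [Term.eval_guard, Term.eval_add, Term.eval_mul, Term.eval_lit, Term.eval_var, e1, e2,
    v4, v6, v7]
  refine if_ctx_congr Iff.rfl (fun h => if_ctx_congr Iff.rfl (fun h' => ?_) fun _ => rfl)
    fun _ => rfl
  rw [hs₃.eval_half (d := b) (n' := n - (2 * b + i)) (m := m - (2 * b + p)) (by simp [v4])
    (by simp [e1, v4, v6]) (by simp [e2, v4, v7]) (by omega) (by omega) hb,
    hJ s' n i p hs₃ v6 v7 (by omega) hn hp, Term.eval_binom (a := b + d) (b := p)]
  · intro j
    have := hidx (s'.write 3 30 j) (by simp [Store.write_apply, hs₃.bound])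
      (by rw [← hs']; simp [Store.write_apply])
    simp [this, Store.write_apply, v4]
  · intro j; simp [Store.write_apply, v7]
  · rw [hs₃.bound]; omega

theorem eval_closedStep {J : Term} (hJ : Computes φ deg J inp N) {s : Store}
    (hs : Ready φ deg inp N n s) (h1 : s 3 1 = (n * N + m) * N + d) (hn : n < N) (hm : m < N)
    (hd : d < N) : (Term.closedStep J).eval s = closedCount φ deg n m := by
  rw [closedCount_eq φ hdeg hn hm]
  simp only [Term.closedStep, Term.eval_sum _ 4, hs.bound]
  refine Finset.sum_congr rfl fun c hc => ?_
  have hs₀ := hs.write 4 c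
  rw [Term.eval_sum, hs₀.bound]
  refine Finset.sum_congr rfl fun b hb => ?_
  have hs₁ := hs₀.write 3 b
  have hidx : ∀ s' : Store, s' 3 0 = N → s' 3 1 = s 3 1 → Term.idx₁.eval s' = n ∧
      Term.idx₂.eval s' = m ∧ Term.idx₃.eval s' = d := fun s' h h' =>
    eval_idx h (h'.trans h1) hm hd
  rw [Finset.mem_range] at hb hc
  rw [Term.eval_mul, Term.eval_sum, Term.eval_binom (a := b) (b := c)]
  rotate_left
  · intro i; simp [Store.write_apply]
  · intro i; simp [Store.write_apply]
  · rw [hs₁.bound]; omega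
  rw [hs₁.bound]
  congr 1
  refine Finset.sum_congr rfl fun i hi => ?_
  have hs₂ := hs₁.write 5 i
  rw [Term.eval_sum, hs₂.bound]
  refine Finset.sum_congr rfl fun p hp => ?_
  have hs₃ := hs₂.write 6 p
  rw [Finset.mem_range] at hi hp
  generalize hs' : (((s.write 3 (4 + 1) c).write 3 (3 + 1) b).write 3 (5 + 1) i).write 3 (6 + 1) p
    = s' at hs₃
  obtain ⟨e1, e2, -⟩ := hidx s' hs₃.bound (by rw [← hs']; simp [Store.write_apply])
  have v1 : s' 3 1 = s 3 1 := by rw [← hs']; simp [Store.write_apply]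
  have v4 : s' 3 4 = b := by rw [← hs']; simp [Store.write_apply]
  have v5 : s' 3 5 = c := by rw [← hs']; simp [Store.write_apply]
  have v6 : s' 3 6 = i := by rw [← hs']; simp [Store.write_apply]
  have v7 : s' 3 7 = p := by rw [← hs']; simp [Store.write_apply]
  simp only [Term.eval_guard _ (.lit 2 * (.var 4 + .var 5) + .var 6),
    Term.eval_guard _ (.lit 2 * (.var 4 + .var 5) + .var 7), Term.eval_add, Term.eval_mul,
    Term.eval_lit, Term.eval_var, e1, e2, v4, v5, v6, v7]
  refine if_ctx_congr Iff.rfl (fun h => if_ctx_congr Iff.rfl (fun h' => ?_) fun _ => rfl)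
    fun _ => rfl
  rw [hJ s' n i p hs₃ v6 v7 (by omega) hn hp, Term.eval_binom (a := b + c) (b := p)]
  rotate_left
  · intro j; simp [Store.write_apply, v4, v5]
  · intro j; simp [Store.write_apply, v7]
  · rw [hs₃.bound]; omega
  congr 1
  rw [Term.eval_sum, hs₃.bound]
  refine Finset.sum_congr rfl fun i' hi' => ?_
  have hs₄ := hs₃.write 7 i'
  rw [Term.eval_sum, hs₄.bound]
  refine Finset.sum_congr rfl fun p' hp' => ?_
  have hs₅ := hs₄.write 8 p'
  rw [Finset.mem_range] at hi' hp'
  generalize hs'' : (s'.write 3 (7 + 1) i').write 3 (8 + 1) p' = s'' at hs₅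
  obtain ⟨f1, f2, -⟩ := hidx s'' hs₅.bound (by rw [← hs'']; simp [Store.write_apply, v1])
  have w4 : s'' 3 4 = b := by rw [← hs'']; simp [Store.write_apply, v4]
  have w5 : s'' 3 5 = c := by rw [← hs'']; simp [Store.write_apply, v5]
  have w6 : s'' 3 6 = i := by rw [← hs'']; simp [Store.write_apply, v6]
  have w7 : s'' 3 7 = p := by rw [← hs'']; simp [Store.write_apply, v7]
  have w8 : s'' 3 8 = i' := by rw [← hs'']; simp [Store.write_apply]
  have w9 : s'' 3 9 = p' := by rw [← hs'']; simp [Store.write_apply]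
  simp only [Term.eval_guard, Term.eval_add, Term.eval_mul, Term.eval_sub,
    Term.eval_lit, Term.eval_var, f1, f2, w4, w5, w6, w7, w8, w9]
  refine if_ctx_congr Iff.rfl (fun k => if_ctx_congr Iff.rfl (fun k' => ?_) fun _ => rfl)
    fun _ => rfl
  rw [hs₅.eval_half (d := c) (n' := i') (m := p') (by simp [w5]) (by simp [w8]) (by simp [w9])
      (by omega) hp' hc,
    hs₅.eval_half (d := b) (n' := n - (2 * (b + c) + i) - i') (m := m - (2 * (b + c) + p) - p')
      (by simp [w4]) (by simp [f1, w4, w5, w6, w8]) (by simp [f2, w4, w5, w7, w9]) (by omega)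
      (by omega) hb]

/-- The term `tableStep J` computes an entry of the table from the entries of smaller length. -/
theorem eval_tableStep {J : Term} (hJ : Computes φ deg J inp N) {s : Store}
    (hs : Ready φ deg inp N n s) (h1 : s 3 1 = (n * N + m) * N + d) (hn : n < N) (hm : m < N)
    (hd : d < N) : (Term.tableStep J).eval s = tableVal φ deg n m d := by
  rw [Term.tableStep, Term.eval_ite, (eval_idx hs.bound h1 hm hd).2.2]
  cases d with
  | zero => exact eval_closedStep hdeg hJ hs h1 hn hm hd
  | succ d =>
    rw [if_neg d.succ_ne_zero]
    exact eval_halfStep hdeg hJ hs h1 hn hm hd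

end Walk

/-! ### The polynomial time algorithms -/

theorem ncard_list_le {L : Type*} [Finite L] {β : ℕ} (hβ : Nat.card L ≤ 2 ^ β)
    (p : List L → Prop) (n : ℕ) : {w : List L | p w ∧ w.length = n}.ncard ≤ 2 ^ (β * n) := by
  have := Fintype.ofFinite L
  have h1 : {w : List L | w.length = n}.ncard = Nat.card L ^ n := by
    rw [← Nat.card_coe_set_eq, Nat.card_eq_fintype_card (α := L), ← card_vector n,
      ← Nat.card_eq_fintype_card]
    rfl
  calc _ ≤ {w : List L | w.length = n}.ncard :=
        Set.ncard_le_ncard (fun w hw => hw.2) (List.finite_length_eq L n)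
    _ ≤ _ := by rw [h1, pow_mul]; exact Nat.pow_le_pow_left hβ n

namespace Walk

open RAM

theorem tableVal_le {α : Type u} {D : Type v} [Group D] {φ : α → D} {deg : α → ℕ}
    (hdeg : ∀ n, {a | deg a ≤ n}.Finite) (n m d : ℕ) :
    tableVal φ deg n m d ≤ closedCount φ deg (n + 2 * d) (m + 2 * d) := by
  cases d with
  | zero => exact le_rfl
  | succ d => exact halfCount_le φ hdeg (d + 1) n m

/-- A program that tabulates the numbers of closed walks, given a term for the numbers of trivial
words in the letters. -/
theorem exists_prog (EN EL J ω : Term) : ∃ (A : Prog) (q : Polynomial ℕ),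
    ∀ (α : Type u) (D : Type v) [Group D] (φ : α → D) (deg : α → ℕ)
    (xs : List ℕ) (M N L : ℕ) (g : ℕ → ℕ),
    (∀ n, {a | deg a ≤ n}.Finite) →
    N ^ 3 ≤ M → L ≤ M → xs.length < 2 ^ M → (∀ x ∈ xs, x < 2 ^ M) →
    (∀ n m, n < 3 * N → closedCount φ deg n m < 2 ^ M) → (∀ i < L, g i < 2 ^ M) →
    (∀ s : Store, s 0 = load xs 0 → EN.eval s = N) →
    (∀ s : Store, s 0 = load xs 0 → s 3 0 = N → EL.eval s = L) →
    Computes φ deg J (load xs 0) N →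
    (∀ (s : Store) (i : ℕ), i < L → s 0 = load xs 0 → s 3 0 = N → s 3 1 = i →
      (∀ n < N, ∀ m < N, s 2 ((n * N + m) * N) = closedCount φ deg n m) → ω.eval s = g i) →
    ComputesWithin A xs ((List.range L).map g) (q.eval M) := by
  obtain ⟨A, q, h⟩ := exists_prog_of_table EN (.tableStep J) EL ω
  refine ⟨A, q, fun α D _ φ deg xs M N L g hdeg hN hL hx hx' hc hg hEN hEL hJ hω => ?_⟩
  have hindex : ∀ n m d, m < N → d < N → tableVal φ deg (((n * N + m) * N + d) / (N * N))
      (((n * N + m) * N + d) / N % N) (((n * N + m) * N + d) % N) = tableVal φ deg n m d :=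
    fun n m d hm hd => by
      rw [index_div_div hm hd, index_div hd, Nat.mul_add_mod_of_lt hm, Nat.mul_add_mod_of_lt hd]
  refine h xs M N L (fun i => tableVal φ deg (i / (N * N)) (i / N % N) (i % N)) g hN hL hx hx'
    (fun i hi => ?_) hg hEN hEL (fun s i hi h0 h30 h31 h2 => ?_) (fun s i hi h0 h30 h31 h2 => ?_)
  · have hN0 : 0 < N := Nat.pos_of_ne_zero (by rintro rfl; simp at hi)
    refine (tableVal_le hdeg _ _ _).trans_lt (hc _ _ ?_)
    have h1 : i / (N * N) < N := Nat.div_lt_of_lt_mul (by rw [← pow_two, ← pow_succ]; exact hi)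
    have h2 := Nat.mod_lt i hN0
    omega
  · have hN0 : 0 < N := Nat.pos_of_ne_zero (by rintro rfl; simp at hi)
    have h1 : i / (N * N) < N := Nat.div_lt_of_lt_mul (by rw [← pow_two, ← pow_succ]; exact hi)
    have e : i = (i / (N * N) * N + i / N % N) * N + i % N := by
      rw [← Nat.div_div_eq_div_mul, mul_comm (i / N / N), Nat.div_add_mod, mul_comm (i / N),
        Nat.div_add_mod]
    refine eval_tableStep hdeg hJ ⟨h0, h30, fun n' hn' m hm d hd => ?_⟩ (h31.trans e) h1
      (Nat.mod_lt _ hN0) (Nat.mod_lt _ hN0)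
    rw [h2, hindex n' m d hm hd]
    calc (n' * N + m) * N + d < (n' * N + m) * N + N := by omega
      _ = (n' * N + (m + 1)) * N := by ring
      _ ≤ (n' * N + N) * N := Nat.mul_le_mul_right _ (by omega)
      _ = (n' + 1) * (N * N) := by ring
      _ ≤ i / (N * N) * (N * N) := Nat.mul_le_mul_right _ hn'
      _ ≤ i := Nat.div_mul_le_self _ _
  · refine hω s i hi h0 h30 h31 fun n hn m hm => ?_
    have h3 := hindex n m 0 hm (by omega)
    rw [add_zero] at h3
    rw [h2, h3]
    · rfl
    · calc (n * N + m) * N < (n * N + N) * N := Nat.mul_lt_mul_of_pos_right (by omega) (by omega)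
        _ = (n + 1) * (N * N) := by ring
        _ ≤ N * (N * N) := Nat.mul_le_mul_right _ hn
        _ = N ^ 3 := by ring

theorem letterDeg_one {α : Type*} (l : List α) : letterDeg (fun _ => 1) l = l.length := by
  simp [letterDeg]

theorem walkDeg_one {α : Type*} (w : List (Step α)) : walkDeg (fun _ => 1) w = w.length := by
  induction w with
  | nil => rfl
  | cons s w ih => cases s <;> simp [ih, stepDeg, add_comm]

end Walk

theorem load_zero_succ (xs : List ℕ) (i : ℕ) : RAM.load xs 0 (i + 1) = xs.getD i 0 := rfl

namespace WreathZ

open Walk RAM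

variable {G : Type u} [Group G] (S : Set G)

theorem closedCount_eq_ite (n m : ℕ) :
    closedCount (Subtype.val : Letter S → G) (fun _ => 1) n m
      = if n = m then loopCount (gens S) n else 0 := by
  rw [closedCount, loopCount_gens]
  split_ifs with h
  · subst h
    congr 1
    ext w
    simp [walkDeg_one]
  · convert Set.ncard_empty (List (Step (Letter S)))
    refine Set.eq_empty_of_forall_notMem fun w hw => h ?_
    exact hw.2.1.symm.trans ((walkDeg_one w).trans hw.2.2)

theorem trivCount_eq_ite (p i : ℕ) :
    trivCount (Subtype.val : Letter S → G) (fun _ => 1) p i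
      = if i = p then loopCount S p else 0 := by
  rw [trivCount, loopCount_base]
  split_ifs with h
  · subst h
    congr 1
    ext w
    simp [letterDeg_one]
  · convert Set.ncard_empty (List (Letter S))
    refine Set.eq_empty_of_forall_notMem fun w hw => h ?_
    exact hw.2.1.symm.trans ((letterDeg_one w).trans hw.2.2)

/-- The alphabet of `G ≀ ℤ` is finite, and its size is polynomial in `|S|`. -/
theorem card_letter_le (S : Finset G) :
    Finite (Letter (S : Set G)) ∧ Nat.card (Letter (S : Set G)) + 2 ≤ 2 ^ (S.card.size + 1) := by
  classical
  have h1 : ((S : Set G) ∪ (S : Set G)⁻¹).Finite := S.finite_toSet.union S.finite_toSet.inv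
  refine ⟨h1, ?_⟩
  have h2 : Nat.card (Letter (S : Set G)) ≤ S.card + S.card := by
    refine (Set.ncard_union_le (S : Set G) (S : Set G)⁻¹).trans ?_
    rw [Set.ncard_coe_finset, ← Finset.coe_inv, Set.ncard_coe_finset, Finset.card_inv]
  have h3 := Nat.lt_size_self S.card
  rw [pow_succ]
  omega

/-- The cogrowth of `G ≀ ℤ` is computable in polynomial time from that of `G`. -/
theorem exists_prog_loopCount : ∃ (A : Prog) (p : Polynomial ℕ),
    ∀ (G : Type u) [Group G] (S : Finset G) (n : ℕ), ComputesWithin A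
      ((List.range (n + 1)).map (loopCount (S : Set G)))
      ((List.range (n + 1)).map (loopCount (gens (S : Set G))))
      (p.eval (n + Nat.size S.card)) := by
  obtain ⟨A, q, h⟩ := Walk.exists_prog.{u, u} (.get 0 (.lit 0)) (.get 0 (.lit 0))
    (.ite (.var 6 - .var 7 + (.var 7 - .var 6)) (.lit 0) (.get 0 (.var 7 + .lit 1)))
    (.get 2 ((.var 1 * .var 0 + .var 1) * .var 0))
  refine ⟨A, q.comp (3 * (Polynomial.X + 1) ^ 3), fun G _ S n => ?_⟩
  obtain ⟨hfin, hcard⟩ := card_letter_le S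
  set z := n + Nat.size S.card with hz
  -- `M` bounds the size `(n + 1) ^ 3` of the table and the number of bits of its entries, which count
  -- walks of length less than `3 * (n + 1)` over an alphabet with at most `2 ^ (S.card.size + 1)` steps.
  set M := 3 * (z + 1) ^ 3 with hM
  have e : (q.comp (3 * (Polynomial.X + 1) ^ 3)).eval z = q.eval M := by simp [hM]
  rw [e]
  have hM2 : 3 * (z + 1) * (z + 1) ≤ M := by
    rw [hM, pow_succ, pow_two, ← mul_assoc, ← mul_assoc]
    exact Nat.le_mul_of_pos_right _ (by omega)
  have hM1 : n + 1 ≤ M := by nlinarith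
  have hpow : ∀ k < 3 * (n + 1), 2 ^ ((S.card.size + 1) * k) < 2 ^ M := fun k hk => by
    refine Nat.pow_lt_pow_right one_lt_two (lt_of_lt_of_le ?_ hM2)
    calc (S.card.size + 1) * k < (S.card.size + 1) * (3 * (n + 1)) :=
          Nat.mul_lt_mul_of_pos_left hk (by omega)
      _ ≤ (z + 1) * (3 * (z + 1)) := Nat.mul_le_mul (by omega) (by omega)
      _ = 3 * (z + 1) * (z + 1) := by ring
  have hgens : ∀ k < 3 * (n + 1), loopCount (gens (S : Set G)) k < 2 ^ M := fun k hk => by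
    rw [loopCount_gens]
    exact (ncard_list_le (by rw [card_step]; exact hcard) _ k).trans_lt (hpow k hk)
  have hbase : ∀ k < n + 1, loopCount (S : Set G) k < 2 ^ M := fun k hk => by
    rw [loopCount_base]
    exact (ncard_list_le (by omega) _ k).trans_lt (hpow k (by omega))
  have hload : ∀ k < n + 1, load ((List.range (n + 1)).map (loopCount (S : Set G))) 0 (k + 1)
      = loopCount (S : Set G) k := fun k hk => by
    rw [load_zero_succ, List.getD_eq_getElem?_getD, List.getElem?_map, List.getElem?_range hk]
    rfl
  refine h (Letter (S : Set G)) G Subtype.val (fun _ => 1) _ M (n + 1) (n + 1) _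
    (fun _ => Set.toFinite _) ?_ hM1 ?_ ?_ (fun k m hk => ?_) (fun k hk => hgens k (by omega)) ?_ ?_
    ?_ ?_
  · have : (n + 1) ^ 3 ≤ (z + 1) ^ 3 := Nat.pow_le_pow_left (by omega) 3
    omega
  · rw [List.length_map, List.length_range]
    exact hM1.trans_lt Nat.lt_two_pow_self
  · intro x hx
    obtain ⟨k, hk, rfl⟩ := List.mem_map.1 hx
    exact hbase k (List.mem_range.1 hk)
  · rw [closedCount_eq_ite]
    split_ifs
    · exact hgens k hk
    · positivity
  · intro s hs
    simp [hs, load]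
  · intro s hs _
    simp [hs, load]
  · intro s k i p hs h6 h7 hi hk hp
    rw [trivCount_eq_ite]
    simp only [Term.eval_ite, Term.eval_add, Term.eval_sub, Term.eval_var, Term.eval_get,
      Term.eval_lit, h6, h7]
    by_cases hip : i = p
    · rw [if_pos (by omega), if_pos hip, ← hload p hp, ← hs.input]
      rfl
    · rw [if_neg (by omega), if_neg hip]
  · intro s i hi h0 h30 h31 h2
    have h3 := h2 i hi i hi
    rw [closedCount_eq_ite, if_pos rfl] at h3
    simp only [Term.eval_get, Term.eval_add, Term.eval_mul, Term.eval_var, h30, h31]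
    exact h3

end WreathZ

namespace NavasBrin

open Walk (Step Dyck closedCount trivCount walkDeg)
open RAM

theorem length_le_walkDeg (W : List (Step (Dyck Bool))) : W.length ≤ walkDeg excDeg W := by
  induction W with
  | nil => exact le_rfl
  | cons s W ih => cases s <;> simp [Walk.stepDeg, excDeg] <;> omega

theorem closedCount_eq_zero {n m : ℕ} (h : n < m) : closedCount lamp excDeg n m = 0 := by
  rw [closedCount]
  convert Set.ncard_empty (List (Step (Dyck Bool)))
  refine Set.eq_empty_of_forall_notMem fun W hW => ?_
  have := length_le_walkDeg W
  have := hW.2.1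
  have := hW.2.2
  omega

/-- The loops of length `n` are words over an alphabet with four letters. -/
theorem coeff_serG_le (n m : ℕ) : closedCount lamp excDeg n m ≤ 2 ^ (2 * n) := by
  classical
  rw [← coeff_serG, coeff_serG_eq_card]
  refine (Finset.card_filter_le _ _).trans ?_
  rw [← loopCount_eq_card, loopCount_eq_ncard ofStep_injective range_ofStep]
  exact ncard_list_le (by rw [Walk.card_step]; simp) _ n

theorem trivCount_zero (i : ℕ) : trivCount lamp excDeg 0 i = if i = 0 then 1 else 0 := by
  rw [← coeff_serJ, serJ_zero, PowerSeries.coeff_one]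

/-- The equation for `J_{k+1}`, read coefficientwise. -/
theorem trivCount_succ {k i N : ℕ} (hi : i < N) : trivCount lamp excDeg (k + 1) i
    = if 2 * (k + 1) ≤ i then ∑ q ∈ Finset.range N,
      (q + k).choose k * closedCount lamp excDeg (i - 2 * (k + 1)) q else 0 := by
  have h := (PowerSeries.WithPiTopology.hasSum_iff_hasSum_coeff _).1 (hasSum_serJ k.succPNat) i
  rw [Nat.succPNat_coe, coeff_serJ] at h
  have e : ∀ m, PowerSeries.coeff i (PowerSeries.X ^ (2 * k.succ)
      * (((m + k.succ - 1).choose (k.succ - 1) : ℕ) : ℕ⟦X⟧) * PowerSeries.coeff m serG)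
      = if 2 * (k + 1) ≤ i then (m + k).choose k
        * closedCount lamp excDeg (i - 2 * (k + 1)) m else 0 := fun m => by
    rw [mul_assoc, PowerSeries.coeff_X_pow_mul']
    refine if_congr Iff.rfl ?_ rfl
    rw [← map_natCast (PowerSeries.C (R := ℕ)), PowerSeries.coeff_C_mul, Nat.cast_id, coeff_serG]
    rfl
  simp only [e] at h
  refine h.unique ?_
  split_ifs with hk
  · refine hasSum_sum_of_ne_finset_zero fun q hq => ?_
    rw [Finset.mem_range] at hq
    rw [closedCount_eq_zero (by omega), mul_zero]
  · exact hasSum_zero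

/-- The term for the number of `p`-tuples of excursions of total length `i` that multiply to the
identity. -/
def excTerm : Term :=
  .ite (.var 7)
    (.guard (.lit 2 * .var 7) (.var 6) (.sum 9 (.binom (.var 10) (.var 7 - .lit 1)
      * .entry (.var 6 - .lit 2 * .var 7) (.var 10) (.lit 0))))
    (.ite (.var 6) (.lit 0) (.lit 1))

theorem computes_excTerm (inp : ℕ → ℕ) (N : ℕ) : Walk.Computes lamp excDeg excTerm inp N := by
  intro s n i p hs h6 h7 hi hn hp
  cases p with
  | zero => simp [excTerm, h6, h7, trivCount_zero]
  | succ p =>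
    rw [trivCount_succ (N := N) (by omega)]
    simp only [excTerm, Term.eval_ite, Term.eval_guard, Term.eval_mul, Term.eval_lit,
      Term.eval_var, h6, h7, Term.eval_sum, hs.bound]
    rw [if_neg (by omega)]
    refine if_ctx_congr Iff.rfl (fun h => ?_) fun _ => rfl
    refine Finset.sum_congr rfl fun q hq => ?_
    rw [Finset.mem_range] at hq
    have hs' := hs.write 9 q
    have h1 := hs'.table (i - 2 * (p + 1)) (by omega) q hq 0 (by omega)
    rw [Term.eval_binom (a := q) (b := p)]
    · rw [Walk.tableVal] at h1
      rw [← h1]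
      simp [Term.entry, Store.write_apply, h6, h7, hs.bound]
    · intro j; simp [Store.write_apply]
    · intro j; simp [Store.write_apply, h7]
    · rw [hs'.bound]; omega

/-- The coefficients of `G(x, y)` are computable in polynomial time. -/
theorem exists_prog_coeff : ∃ (A : Prog) (p : Polynomial ℕ), ∀ n m : ℕ,
    ComputesWithin A [n, m] [PowerSeries.coeff n (PowerSeries.coeff m serG)]
      (p.eval (n + m)) := by
  obtain ⟨A, q, h⟩ := Walk.exists_prog.{0, 0}
    (.get 0 (.lit 1) + .get 0 (.lit 2) + .lit 1) (.lit 1) excTerm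
    (.entry (.get 0 (.lit 1)) (.get 0 (.lit 2)) (.lit 0))
  refine ⟨A, q.comp ((Polynomial.X + 1) ^ 3 + 6 * (Polynomial.X + 1)), fun n m => ?_⟩
  set N := n + m + 1 with hN
  -- The entries of the table count words of length less than `3 * N` over four letters.
  set M := N ^ 3 + 6 * N with hM
  have e : (q.comp ((Polynomial.X + 1) ^ 3 + 6 * (Polynomial.X + 1))).eval (n + m) = q.eval M := by
    simp [hM, hN]
  have hlt : ∀ k ≤ M, k < 2 ^ M := fun k hk => hk.trans_lt Nat.lt_two_pow_self
  have hc : ∀ k l, k < 3 * N → closedCount lamp excDeg k l < 2 ^ M := fun k l hk =>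
    (coeff_serG_le k l).trans_lt (Nat.pow_lt_pow_right one_lt_two (by omega))
  have h1 : load [n, m] 0 1 = n := rfl
  have h2 : load [n, m] 0 2 = m := rfl
  rw [e]
  refine h (Dyck Bool) _ lamp excDeg [n, m] M N 1
    (fun _ => PowerSeries.coeff n (PowerSeries.coeff m serG)) finite_excDeg (by omega) (by omega)
    (hlt 2 (by omega)) ?_ hc ?_ ?_ ?_ (computes_excTerm _ _) ?_
  · intro x hx
    refine hlt x ?_
    simp only [List.mem_cons, List.not_mem_nil, or_false] at hx
    omega
  · intro i _
    rw [coeff_serG]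
    exact hc n m (by omega)
  · intro s hs
    simp [hs, h1, h2, hN]
  · intro s _ _
    rfl
  · intro s i _ h0 h30 _ h3
    rw [coeff_serG, ← h3 n (by omega) m (by omega)]
    simp [Term.entry, h0, h1, h2, h30]

/-- The cogrowth of the Navas–Brin group is computable in polynomial time. -/
theorem exists_prog_loopCount : ∃ (A : Prog) (p : Polynomial ℕ), ∀ n : ℕ,
    ComputesWithin A [n] ((List.range (n + 1)).map (loopCount ({a, t} : Set NavasBrin)))
      (p.eval n) := by
  obtain ⟨A, q, h⟩ := Walk.exists_prog.{0, 0}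
    (.get 0 (.lit 1) + .lit 1) (.get 0 (.lit 1) + .lit 1) excTerm
    (.ite (.var 1) (.sum 2 (.ite (.var 3)
      (.var 1 * .entry (.var 1) (.var 3) (.lit 0) / .var 3) (.lit 0))) (.lit 1))
  refine ⟨A, q.comp ((Polynomial.X + 1) ^ 3 + 6 * (Polynomial.X + 1)), fun n => ?_⟩
  set N := n + 1 with hN
  set M := N ^ 3 + 6 * N with hM
  have e : (q.comp ((Polynomial.X + 1) ^ 3 + 6 * (Polynomial.X + 1))).eval n = q.eval M := by
    simp [hM, hN]
  have hlt : ∀ k ≤ M, k < 2 ^ M := fun k hk => hk.trans_lt Nat.lt_two_pow_self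
  have hpow : ∀ k < 3 * N, 2 ^ (2 * k) < 2 ^ M := fun k hk =>
    Nat.pow_lt_pow_right one_lt_two (by omega)
  have h1 : load [n] 0 1 = n := rfl
  rw [e]
  refine h (Dyck Bool) _ lamp excDeg [n] M N N
    (loopCount ({a, t} : Set NavasBrin)) finite_excDeg (by omega) (by omega)
    (hlt 1 (by omega)) ?_ (fun k l hk => (coeff_serG_le k l).trans_lt (hpow k hk)) ?_ ?_ ?_
    (computes_excTerm _ _) ?_
  · intro x hx
    refine hlt x ?_
    simp only [List.mem_cons, List.not_mem_nil, or_false] at hx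
    omega
  · intro k hk
    rw [loopCount_eq_ncard ofStep_injective range_ofStep]
    exact (ncard_list_le (by rw [Walk.card_step]; simp) _ k).trans_lt (hpow k (by omega))
  · intro s hs
    simp [hs, h1, hN]
  · intro s hs _
    simp [hs, h1, hN]
  · intro s i hi h0 h30 h31 h3
    simp only [Term.eval_ite, Term.eval_var, h31, Term.eval_sum, h30, Term.eval_lit]
    split_ifs with hi0
    · rw [hi0, loopCount_zero]
    -- The summand for `m = 0` is `0`, and those for `m > i` vanish.
    rw [loopCount_eq_sum_div (by omega : 1 ≤ i), Finset.range_eq_Ico,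
      Finset.sum_eq_sum_Ico_succ_bot (by omega)]
    simp only [Store.write_apply, Term.entry, Term.eval_div, Term.eval_mul, Term.eval_get,
      Term.eval_add, Term.eval_var, Term.eval_lit]
    rw [if_pos (by simp), zero_add]
    symm
    refine Finset.sum_subset_zero_on_sdiff (fun m hm => ?_) (fun m hm => ?_) fun m hm => ?_
    · rw [Finset.mem_Icc] at hm
      exact Finset.mem_Ico.2 ⟨by omega, by omega⟩
    · rw [Finset.mem_sdiff, Finset.mem_Icc, Finset.mem_Ico] at hm
      have h4 := h3 i hi m (by omega)
      rw [closedCount_eq_zero (by omega)] at h4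
      have hm0 : m ≠ 0 := by omega
      simp [hm0, h31, h30, h4]
    · rw [Finset.mem_Icc] at hm
      have h4 := h3 i hi m (by omega)
      have hm0 : m ≠ 0 := by omega
      simp [hm0, h31, h30, h4, coeff_serG]

end NavasBrin

end

theorem mainTheorem5 :
    -- the equations for `G ≀ ℤ` with respect to the generating set `{a} ∪ S`
    (∀ (G : Type*) [Group G] (S : Finset G),
      (∀ d : ℕ+, Summable (chainTerm (PowerSeries.X ^ 2) (serP (S : Set G)) d)) ∧
      (∃ U V : ℕ⟦X⟧,
        HasSum (fun q : ℕ+ × ℕ+ =>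
          PowerSeries.X ^ (2 * (q.1 : ℕ) + 2 * (q.2 : ℕ))
            * ((((q.1 : ℕ) + (q.2 : ℕ)).choose (q.1 : ℕ) : ℕ) : ℕ⟦X⟧)
            * serP (S : Set G) (q.1 + q.2 + 1)
            * serOmega (S : Set G) q.2 * serOmega (S : Set G) q.1) U ∧
        HasSum (fun d : ℕ+ =>
          PowerSeries.X ^ (2 * (d : ℕ)) * serP (S : Set G) (d + 1) * serOmega (S : Set G) d) V ∧
        loopSeries (WreathZ.gens (S : Set G)) = U + 2 * V + serP (S : Set G) 1) ∧
      (∀ d : ℕ+, ∃ R : ℕ⟦X⟧,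
        HasSum (fun b : ℕ+ =>
          PowerSeries.X ^ (2 * (b : ℕ))
            * ((((b : ℕ) + (d : ℕ) - 1).choose ((d : ℕ) - 1) : ℕ) : ℕ⟦X⟧)
            * serP (S : Set G) (b + d) * serOmega (S : Set G) b) R ∧
        serOmega (S : Set G) d = serP (S : Set G) d + R)) ∧
    -- a polynomial time algorithm for the cogrowth of `G ≀ ℤ`, given that of `G`
    (∃ (A : RAM.Prog) (p : Polynomial ℕ), ∀ (G : Type*) [Group G] (S : Finset G) (n : ℕ),
      RAM.ComputesWithin A
        ((List.range (n + 1)).map (loopCount (S : Set G)))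
        ((List.range (n + 1)).map (loopCount (WreathZ.gens (S : Set G))))
        (p.eval (n + Nat.size S.card))) ∧
    -- the equations for the Navas–Brin group
    (∀ d : ℕ+, Summable
      (chainTerm (NavasBrin.x ^ 2 * NavasBrin.y ^ 2) NavasBrin.serH d)) ∧
    (∃ U V : ℕ⟦X⟧⟦X⟧,
      HasSum (fun q : ℕ+ × ℕ+ =>
        NavasBrin.x ^ (2 * (q.1 : ℕ) + 2 * (q.2 : ℕ))
          * NavasBrin.y ^ (2 * (q.1 : ℕ) + 2 * (q.2 : ℕ))
          * ((((q.1 : ℕ) + (q.2 : ℕ)).choose (q.1 : ℕ) : ℕ) : ℕ⟦X⟧⟦X⟧)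
          * NavasBrin.serH (q.1 + q.2 + 1)
          * NavasBrin.serLambda q.2 * NavasBrin.serLambda q.1) U ∧
      HasSum (fun d : ℕ+ =>
        NavasBrin.x ^ (2 * (d : ℕ)) * NavasBrin.y ^ (2 * (d : ℕ))
          * NavasBrin.serH (d + 1) * NavasBrin.serLambda d) V ∧
      NavasBrin.serG = U + 2 * V + NavasBrin.serH 1) ∧
    (∀ d : ℕ+, ∃ R : ℕ⟦X⟧⟦X⟧,
      HasSum (fun b : ℕ+ =>
        NavasBrin.x ^ (2 * (b : ℕ)) * NavasBrin.y ^ (2 * (b : ℕ))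
          * ((((b : ℕ) + (d : ℕ) - 1).choose ((d : ℕ) - 1) : ℕ) : ℕ⟦X⟧⟦X⟧)
          * NavasBrin.serH (b + d) * NavasBrin.serLambda b) R ∧
      NavasBrin.serLambda d = NavasBrin.serH d + R) ∧
    (∀ n : ℕ+,
      HasSum (fun k : ℕ =>
        NavasBrin.y ^ k * (((k + (n : ℕ) - 1).choose ((n : ℕ) - 1) : ℕ) : ℕ⟦X⟧⟦X⟧)
          * PowerSeries.C (NavasBrin.serJ k)) (NavasBrin.serH n)) ∧
    NavasBrin.serJ 0 = 1 ∧
    (∀ k : ℕ+,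
      HasSum (fun m : ℕ =>
        PowerSeries.X ^ (2 * (k : ℕ)) * (((m + (k : ℕ) - 1).choose ((k : ℕ) - 1) : ℕ) : ℕ⟦X⟧)
          * PowerSeries.coeff m NavasBrin.serG) (NavasBrin.serJ k)) ∧
    (∀ n : ℕ, 1 ≤ n →
      HasSum (fun m : ℕ+ =>
        (n : ℚ) / ((m : ℕ) : ℚ)
          * ((PowerSeries.coeff n (PowerSeries.coeff (m : ℕ) NavasBrin.serG) : ℕ) : ℚ))
        (loopCount ({NavasBrin.a, NavasBrin.t} : Set NavasBrin) n : ℚ)) ∧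
    -- polynomial time algorithms for the coefficients of `G(x, y)` and the cogrowth of `B`
    (∃ (A : RAM.Prog) (p : Polynomial ℕ), ∀ n m : ℕ,
      RAM.ComputesWithin A [n, m]
        [PowerSeries.coeff n (PowerSeries.coeff m NavasBrin.serG)] (p.eval (n + m))) ∧
    (∃ (A : RAM.Prog) (p : Polynomial ℕ), ∀ n : ℕ,
      RAM.ComputesWithin A [n]
        ((List.range (n + 1)).map (loopCount ({NavasBrin.a, NavasBrin.t} : Set NavasBrin)))
        (p.eval n)) := by
  obtain ⟨h1, h2, h3⟩ := NavasBrin.equations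
  refine ⟨fun G _ S => ?_, WreathZ.exists_prog_loopCount, h1, h2, h3, NavasBrin.hasSum_serH,
    NavasBrin.serJ_zero, NavasBrin.hasSum_serJ, fun n hn => NavasBrin.hasSum_loopCount hn,
    NavasBrin.exists_prog_coeff, NavasBrin.exists_prog_loopCount⟩
  have := (WreathZ.card_letter_le S).1
  exact WreathZ.equations (S : Set G)
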